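/- **Main Theorem 1.7 (Generalized Cauchy identity).** Let $m,n\ge 0$ and let $\mathbf I=\{0=i_0<\dots<i_r=m\}$, $\mathbf J=\{0=j_0<\dots<j_s=n\}$. Let $\mathbf L_{\mathbf I|\mathbf J}=L_{\mathbf I}\times L_{\mathbf J}$, where $L_{\mathbf I}=GL_{i_1-i_0}\times\dots\times GL_{i_r-i_{r-1}}\le GL_m(\mathbb C)$ (block-diagonal matrices) and $L_{\mathbf J}\le GL_n(\mathbb C)$ is defined likewise. It acts on ${\sf Mat}_{m,n}(\mathbb C)$ by $(p,q)\cdot M=p^{-1}M(q^{-1})^T$ and on functions by $((p,q)\cdot f)(M)=f(pMq^T)$. Let $\mathbf T=T_m\times T_n$ be its torus of pairs of invertible diagonal matrices. For $M\in{\sf Mat}_{m,n}(\mathbb Z_{\ge0})$, the word ${\sf row}(M)$ records $m_{ij}$ copies of $i$ for each entry, the entries being read down the columns, from left to right; ${\sf col}(M)$ records $m_{ij}$ copies of $j$, the entries being read along the rows, from top to bottom. Knuth equivalence of words is generated by $yzx\leftrightarrow yxz$ ($x<y\le z$) and $zxy\leftrightarrow xzy$ ($x\le y<z$); every class contains the reading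 word (columns from left to right, each read bottom to top) of exactly one semistandard tableau. Let ${\sf filterRSK}_{\mathbf I|\mathbf J}(M)=(P^{(1)},\dots,P^{(r)}|Q^{(1)},\dots,Q^{(s)})$, where $P^{(k)}$ is the semistandard tableau whose reading word is Knuth equivalent to the subword of ${\sf row}(M)$ formed by the letters in $[i_{k-1}+1,i_k]$, and $Q^{(k)}$ the one for the subword of ${\sf col}(M)$ formed by the letters in $[j_{k-1}+1,j_k]$. Bicrystal operators: for $1\le i\le m-1$, replace in ${\sf row}(M)$ each $i+1$ by "(" and each $i$ by ")", drop the other letters, and match brackets. If the leftmost unmatched "(" comes from the entry $(i+1,b)$, then $e_i^{\sf row}(M)$ is obtained from $M$ by subtracting $1$ from $m_{i+1,b}$ and adding $1$ to $m_{i,b}$; if the rightmost unmatched ")" comes from the entry $(i,a)$, then $f_i^{\sf row}(M)$ is obtained by subtracting $1$ from $m_{i,a}$ and adding $1$ to $m_{i+1,a}$; if there is no such bracket, the value is $\varnothing$. For $1\le j\le n-1$, $e_j^{\sf col}(M)=(e_j^{\sf row}(M^T))^T$ and $f_j^{\sf col}(M)=(f_j^{\sf row}(M^T))^T$. Let $\mathfrak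 X\subseteq{\sf Mat}_{m,n}(\mathbb C)$ be a Zariski closed subset with ideal $I(\mathfrak X)\subseteq S=\mathbb C[z_{ij}]$ and coordinate ring $\mathbb C[\mathfrak X]=S/I(\mathfrak X)$, and let $<$ be a term order on $S$. Let ${\sf Std}$ be the set of standard monomials, i.e. of the monomials not in the initial ideal of $I(\mathfrak X)$, identified with their exponent matrices in ${\sf Mat}_{m,n}(\mathbb Z_{\ge0})$. Suppose that $\mathfrak X$ is $\mathbf L_{\mathbf I|\mathbf J}$-bicrystalline, as witnessed by $<$: $\mathfrak X$ is stable under $\mathbf L_{\mathbf I|\mathbf J}$, and for all ${\sf m}\in{\sf Std}$ the values $e_i^{\sf row}({\sf m}),f_i^{\sf row}({\sf m})$ ($1\le i\le m-1$, $i\notin\mathbf I$) and $e_j^{\sf col}({\sf m}),f_j^{\sf col}({\sf m})$ ($1\le j\le n-1$, $j\notin\mathbf J$) lie in ${\sf Std}\cup\{\varnothing\}$. Let $\underline\lambda=(\lambda^{(1)},\dots,\lambda^{(r)})$ and $\underline\mu=(\mu^{(1)},\dots,\mu^{(s)})$ run over the tuples of partitions in which $\lambda^{(k)}$ has at most $i_k-i_{k-1}$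 rows and $\mu^{(k)}$ has at most $j_k-j_{k-1}$ rows. Let $T_{\underline\lambda}$ be the tuple of tableaux whose $k$-th member has the shape $\lambda^{(k)}$ and the constant value $i_{k-1}+t$ in its $t$-th row, let $T_{\underline\mu}$ be defined likewise with $\mathbf J$, and put $$c^{\mathfrak X}_{\underline\lambda|\underline\mu}=\#\{{\sf m}\in{\sf Std}:{\sf filterRSK}_{\mathbf I|\mathbf J}({\sf m})=(T_{\underline\lambda}|T_{\underline\mu})\}.$$ Then all these numbers are finite, $\mathbb C[\mathfrak X]$ is the direct sum of its $\mathbf T$-weight spaces, these are finite-dimensional, and only weights with nonnegative entries occur. The $\mathbf T$-character of $\mathbb C[\mathfrak X]$ (the formal sum of $\dim(\mathbb C[\mathfrak X]_{(a,b)})\,\mathbf x^a\mathbf y^b$ over all weights $(a,b)$) is $$\chi_{\mathbb C[\mathfrak X]}=\sum_{\underline\lambda,\underline\mu}c^{\mathfrak X}_{\underline\lambda|\underline\mu}\,s_{\underline\lambda}(\mathbf x)\,s_{\underline\mu}(\mathbf y),$$ where the sum converges coefficientwise in $\mathbb Z[[\mathbf x,\mathbf y]]$, $s_{\underline\lambda}(\mathbf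 x)=\prod_{k=1}^r s_{\lambda^{(k)}}(x_{i_{k-1}+1},\dots,x_{i_k})$ is the split-Schur polynomial, $s_{\underline\mu}(\mathbf y)=\prod_{k=1}^s s_{\mu^{(k)}}(y_{j_{k-1}+1},\dots,y_{j_k})$, and $s_\lambda(t_1,\dots,t_k)=\sum_T\prod_i t_i^{\#i\text{ in }T}$ over the semistandard tableaux $T$ of shape $\lambda$ with entries in $\{1,\dots,k\}$. -/

import Mathlib

open scoped MvPowerSeries.WithPiTopology

namespace GenCauchy

/-!
Conventions.  Rows and columns of matrices, letters of words and entries of tableaux are numbered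
from `0`: the row index `p : Fin m` is the row `p + 1` of the usual numbering `1, …, m`.

A sequence `I = {0 = i_0 < i_1 < ⋯ < i_r = m}` is a composition of `m`: `r = I.length`,
`i_k = I.sizeUpTo k`, and its `k`-th block (`k = 0, …, r - 1`) has the size
`I.blocksFun k = i_{k+1} - i_k` and consists of the `0`-based indices `i_k ≤ p < i_{k+1}`.
-/

section Words

/-- An elementary Knuth move, applied anywhere inside a word. -/
inductive KnuthMove : List ℕ → List ℕ → Prop
  | left (u v : List ℕ) {x y z : ℕ} (hxy : x < y) (hyz : y ≤ z) :
      KnuthMove (u ++ [y, z, x] ++ v) (u ++ [y, x, z] ++ v)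
  | right (u v : List ℕ) {x y z : ℕ} (hxy : x ≤ y) (hyz : y < z) :
      KnuthMove (u ++ [z, x, y] ++ v) (u ++ [x, z, y] ++ v)

/-- Knuth equivalence: the equivalence relation generated by the elementary Knuth moves. -/
def KnuthEquiv : List ℕ → List ℕ → Prop := Relation.EqvGen KnuthMove

/-- The subword of `w` of all letters in the `k`-th block of `I`; these words, for all `k`,
are the `I`-filtration of `w`. -/
def filterWord {m : ℕ} (I : Composition m) (w : List ℕ) (k : Fin I.length) : List ℕ :=
  w.filter fun a => I.sizeUpTo k ≤ a ∧ a < I.sizeUpTo (k + 1)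

end Words

section Tableaux

/-- The column reading word: each column is read bottom to top, the columns from left to right. -/
def readingWord {μ : YoungDiagram} (T : SemistandardYoungTableau μ) : List ℕ :=
  (List.range (μ.rowLen 0)).flatMap fun j => ((List.range (μ.colLen j)).reverse.map fun i => T i j)

/-- Semistandard Young tableaux of arbitrary shape. -/
abbrev Tableau : Type := Σ μ : YoungDiagram, SemistandardYoungTableau μ

/-- The semistandard tableau whose reading word is Knuth equivalent to `w`.  (Every Knuth class
contains the reading word of exactly one semistandard tableau.) -/
noncomputable def tab (w : List ℕ) : Tableau :=
  Classical.epsilon fun T : Tableau => KnuthEquiv w (readingWord T.2)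

/-- The highest-weight tableau of shape `μ` on an alphabet with the smallest letter `a`: its row
`i` (numbered from `0`) is constant with value `a + i`. -/
def highestWeight (a : ℕ) (μ : YoungDiagram) : SemistandardYoungTableau μ where
  entry i j := if (i, j) ∈ μ then a + i else 0
  row_weak' hj hcell := by
    rw [if_pos hcell, if_pos (μ.up_left_mem le_rfl hj.le hcell)]
  col_strict' hi hcell := by
    rw [if_pos hcell, if_pos (μ.up_left_mem hi.le le_rfl hcell)]
    omega
  zeros' not_cell := if_neg not_cell

/-- `I`-filtered partition-tuples: one partition for each block of `I`, with at most as many rows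
as the size of the block. -/
abbrev PartitionTuple {m : ℕ} (I : Composition m) : Type :=
  (k : Fin I.length) → {μ : YoungDiagram // μ.colLen 0 ≤ I.blocksFun k}

/-- The highest-weight tableau-tuple of a partition-tuple. -/
def highestWeightTuple {m : ℕ} (I : Composition m) (lam : PartitionTuple I) :
    Fin I.length → Tableau :=
  fun k => ⟨(lam k).1, highestWeight (I.sizeUpTo k) (lam k).1⟩

end Tableaux

section FilteredRSK

variable {m n : ℕ}

/-- The sequence of cells in which `M i j` copies of the cell `(i, j)` are recorded, columns
being read top to bottom, from left to right. -/
def rowCells (M : Matrix (Fin m) (Fin n) ℕ) : List (Fin m × Fin n) :=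
  (List.finRange n).flatMap fun j => (List.finRange m).flatMap fun i =>
    List.replicate (M i j) (i, j)

/-- The sequence of cells in which `M i j` copies of the cell `(i, j)` are recorded, rows being
read left to right, from top to bottom. -/
def colCells (M : Matrix (Fin m) (Fin n) ℕ) : List (Fin m × Fin n) :=
  (List.finRange m).flatMap fun i => (List.finRange n).flatMap fun j =>
    List.replicate (M i j) (i, j)

/-- The row word of a matrix. -/
def rowWord (M : Matrix (Fin m) (Fin n) ℕ) : List ℕ := (rowCells M).map fun c => (c.1 : ℕ)

/-- The column word of a matrix. -/
def colWord (M : Matrix (Fin m) (Fin n) ℕ) : List ℕ := (colCells M).map fun c => (c.2 : ℕ)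

/-- Filtered RSK. -/
noncomputable def filterRSK (I : Composition m) (J : Composition n)
    (M : Matrix (Fin m) (Fin n) ℕ) : (Fin I.length → Tableau) × (Fin J.length → Tableau) :=
  (fun k => tab (filterWord I (rowWord M) k), fun k => tab (filterWord J (colWord M) k))

end FilteredRSK

section Bicrystals

variable {m n : ℕ}

/-- Bracketing.  Read a sequence `w` of items carrying letters from left to right; an item with the
letter `i + 1` is an opening bracket, an item with the letter `i` is a closing bracket, which
matches the last opening bracket that is still unmatched, if there is one.  The result is the list
of the unmatched closing brackets and the list of the unmatched opening brackets, both from right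
to left. -/
def unmatched {α : Type} (letter : α → ℕ) (i : ℕ) (w : List α) : List α × List α :=
  w.foldl (fun s c =>
    if letter c = i + 1 then (s.1, c :: s.2)
    else if letter c = i then
      match s.2 with
      | [] => (c :: s.1, [])
      | _ :: opens => (s.1, opens)
    else s) ([], [])

/-- The row raising operator.  The index `i` is the operator with index `i + 1` in the `1`-based
numbering.  If the leftmost unmatched opening bracket of the row word comes from the cell
`(i + 1, b)`, one is moved from this entry to the entry `(i, b)`; `none` stands for `∅`. -/
def eRow (i : ℕ) (M : Matrix (Fin m) (Fin n) ℕ) : Option (Matrix (Fin m) (Fin n) ℕ) :=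
  (unmatched (fun c : Fin m × Fin n => (c.1 : ℕ)) i (rowCells M)).2.getLast?.map fun c =>
    Matrix.of fun p q =>
      if (p : ℕ) = i + 1 ∧ q = c.2 then M p q - 1
      else if (p : ℕ) = i ∧ q = c.2 then M p q + 1
      else M p q

/-- The row lowering operator.  If the rightmost unmatched closing bracket of the row word comes
from the cell `(i, a)`, one is moved from this entry to the entry `(i + 1, a)`. -/
def fRow (i : ℕ) (M : Matrix (Fin m) (Fin n) ℕ) : Option (Matrix (Fin m) (Fin n) ℕ) :=
  (unmatched (fun c : Fin m × Fin n => (c.1 : ℕ)) i (rowCells M)).1.head?.map fun c =>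
    Matrix.of fun p q =>
      if (p : ℕ) = i ∧ q = c.2 then M p q - 1
      else if (p : ℕ) = i + 1 ∧ q = c.2 then M p q + 1
      else M p q

/-- The column raising operator. -/
def eCol (j : ℕ) (M : Matrix (Fin m) (Fin n) ℕ) : Option (Matrix (Fin m) (Fin n) ℕ) :=
  (unmatched (fun c : Fin m × Fin n => (c.2 : ℕ)) j (colCells M)).2.getLast?.map fun c =>
    Matrix.of fun p q =>
      if (q : ℕ) = j + 1 ∧ p = c.1 then M p q - 1
      else if (q : ℕ) = j ∧ p = c.1 then M p q + 1
      else M p q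

/-- The column lowering operator. -/
def fCol (j : ℕ) (M : Matrix (Fin m) (Fin n) ℕ) : Option (Matrix (Fin m) (Fin n) ℕ) :=
  (unmatched (fun c : Fin m × Fin n => (c.2 : ℕ)) j (colCells M)).1.head?.map fun c =>
    Matrix.of fun p q =>
      if (q : ℕ) = j ∧ p = c.1 then M p q - 1
      else if (q : ℕ) = j + 1 ∧ p = c.1 then M p q + 1
      else M p q

end Bicrystals

section CoordinateRing

variable {m n : ℕ}

/-- The coordinates of a matrix. -/
def coords (M : Matrix (Fin m) (Fin n) ℂ) : Fin m × Fin n → ℂ := fun p => M p.1 p.2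

/-- Affine varieties (Zariski closed subsets, possibly reducible) in the space of matrices. -/
def IsVariety (X : Set (Matrix (Fin m) (Fin n) ℂ)) : Prop :=
  ∃ K : Ideal (MvPolynomial (Fin m × Fin n) ℂ), X = coords ⁻¹' MvPolynomial.zeroLocus ℂ K

/-- The ideal `I(X)` of all polynomials that vanish on `X`. -/
noncomputable def idealOf (X : Set (Matrix (Fin m) (Fin n) ℂ)) :
    Ideal (MvPolynomial (Fin m × Fin n) ℂ) :=
  MvPolynomial.vanishingIdeal ℂ (coords '' X)

/-- The coordinate ring `ℂ[X]`. -/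
abbrev CoordRing (X : Set (Matrix (Fin m) (Fin n) ℂ)) : Type :=
  MvPolynomial (Fin m × Fin n) ℂ ⧸ idealOf X

/-- The initial ideal of an ideal with respect to a term order. -/
noncomputable def initialIdeal {σ : Type*} (ord : MonomialOrder σ) (K : Ideal (MvPolynomial σ ℂ)) :
    Ideal (MvPolynomial σ ℂ) :=
  Ideal.span (ord.leadingTerm '' (K : Set (MvPolynomial σ ℂ)))

/-- The standard monomials of `ℂ[X]`, each written as the matrix of its exponents. -/
def Std (ord : MonomialOrder (Fin m × Fin n)) (X : Set (Matrix (Fin m) (Fin n) ℂ)) :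
    Set (Matrix (Fin m) (Fin n) ℕ) :=
  {M | (∏ i, ∏ j, MvPolynomial.X (i, j) ^ M i j : MvPolynomial (Fin m × Fin n) ℂ) ∉
    initialIdeal ord (idealOf X)}

end CoordinateRing

section LeviAction

variable {m n : ℕ}

/-- The Levi group `L_I` of all invertible block-diagonal matrices, with blocks given by `I`. -/
def levi (I : Composition m) : Subgroup (GL (Fin m) ℂ) where
  carrier := {g | ∀ a b, I.index a ≠ I.index b → (g : Matrix (Fin m) (Fin m) ℂ) a b = 0}
  one_mem' := by
    intro a b h
    have : a ≠ b := fun e => h (by rw [e])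
    simp [this]
  mul_mem' := by
    intro g h hg hh a b hab
    rw [Units.val_mul, Matrix.mul_apply]
    refine Finset.sum_eq_zero fun c _ => ?_
    by_cases hc : I.index a = I.index c
    · rw [hh c b (fun e => hab (hc.trans e)), mul_zero]
    · rw [hg a c hc, zero_mul]
  inv_mem' := by
    intro g hg a b hab
    let D : Matrix (Fin m) (Fin m) ℂ := Matrix.diagonal fun c => ((I.index c : ℕ) : ℂ)
    have hcomm : Commute (g : Matrix (Fin m) (Fin m) ℂ) D := by
      ext p q
      rw [Matrix.mul_diagonal, Matrix.diagonal_mul]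
      by_cases hpq : I.index p = I.index q
      · rw [hpq, mul_comm]
      · rw [hg p q hpq, zero_mul, mul_zero]
    have h := congrFun (congrFun (hcomm.units_inv_left).eq a) b
    rw [Matrix.mul_diagonal, Matrix.diagonal_mul] at h
    have hne : ((I.index b : ℕ) : ℂ) - ((I.index a : ℕ) : ℂ) ≠ 0 := by
      rw [sub_ne_zero]
      exact fun e => hab (Fin.ext (Nat.cast_injective e).symm)
    have h0 : ((g⁻¹ : GL (Fin m) ℂ) : Matrix (Fin m) (Fin m) ℂ) a b *
        (((I.index b : ℕ) : ℂ) - ((I.index a : ℕ) : ℂ)) = 0 := by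
      rw [mul_sub, h, mul_comm, sub_self]
    exact (mul_eq_zero.mp h0).resolve_right hne

/-- The group `L_{I|J} = L_I × L_J`. -/
def leviProd (I : Composition m) (J : Composition n) :
    Subgroup (GL (Fin m) ℂ × GL (Fin n) ℂ) :=
  (levi I).prod (levi J)

/-- The action of `GL_m × GL_n` on matrices, `(p, q) · M = p⁻¹ M (q⁻¹)ᵀ`. -/
noncomputable def matAct (g : GL (Fin m) ℂ × GL (Fin n) ℂ) (M : Matrix (Fin m) (Fin n) ℂ) :
    Matrix (Fin m) (Fin n) ℂ :=
  ((g.1⁻¹ : GL (Fin m) ℂ) : Matrix (Fin m) (Fin m) ℂ) * M *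
    Matrix.transpose ((g.2⁻¹ : GL (Fin n) ℂ) : Matrix (Fin n) (Fin n) ℂ)

/-- `X` is stable under the action of the subgroup `G`. -/
def IsStable (G : Subgroup (GL (Fin m) ℂ × GL (Fin n) ℂ))
    (X : Set (Matrix (Fin m) (Fin n) ℂ)) : Prop :=
  ∀ g ∈ G, matAct g '' X = X

/-- The substitution that replaces the generic matrix `Z` by `p Z qᵀ`. -/
noncomputable def polyAct (g : GL (Fin m) ℂ × GL (Fin n) ℂ) :
    MvPolynomial (Fin m × Fin n) ℂ →ₐ[ℂ] MvPolynomial (Fin m × Fin n) ℂ :=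
  MvPolynomial.aeval fun c => ∑ k, ∑ l,
    MvPolynomial.C ((g.1 : Matrix (Fin m) (Fin m) ℂ) c.1 k *
      (g.2 : Matrix (Fin n) (Fin n) ℂ) c.2 l) * MvPolynomial.X (k, l)

/-- `((p, q) · f)(M) = f (p M qᵀ)`. -/
theorem aeval_polyAct (g : GL (Fin m) ℂ × GL (Fin n) ℂ) (f : MvPolynomial (Fin m × Fin n) ℂ)
    (M : Matrix (Fin m) (Fin n) ℂ) :
    MvPolynomial.aeval (coords M) (polyAct g f) =
      MvPolynomial.aeval (coords ((g.1 : Matrix (Fin m) (Fin m) ℂ) * M *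
        Matrix.transpose (g.2 : Matrix (Fin n) (Fin n) ℂ))) f := by
  rw [polyAct, ← AlgHom.comp_apply, MvPolynomial.comp_aeval]
  congr 2
  funext c
  simp only [map_sum, map_mul, MvPolynomial.aeval_C, MvPolynomial.aeval_X, coords,
    Matrix.mul_apply, Matrix.transpose_apply, Finset.sum_mul, Algebra.algebraMap_self,
    RingHom.id_apply]
  rw [Finset.sum_comm]
  refine Finset.sum_congr rfl fun l _ => Finset.sum_congr rfl fun k _ => ?_
  ring

theorem idealOf_le_comap {G : Subgroup (GL (Fin m) ℂ × GL (Fin n) ℂ)}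
    {X : Set (Matrix (Fin m) (Fin n) ℂ)} (hX : IsStable G X) (g : G) :
    idealOf X ≤ (idealOf X).comap (polyAct g.1) := by
  rintro f hf _ ⟨M, hM, rfl⟩
  have hg := hX g.1⁻¹ (G.inv_mem g.2)
  rw [aeval_polyAct]
  refine hf _ ⟨_, ?_, rfl⟩
  have : matAct g.1⁻¹ M ∈ matAct g.1⁻¹ '' X := ⟨M, hM, rfl⟩
  rw [hg] at this
  simpa [matAct] using this

/-- The action of an element of `G` on the coordinate ring of a `G`-stable variety, induced by
`((p, q) · f)(M) = f (p M qᵀ)`. -/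
noncomputable def ringAct {G : Subgroup (GL (Fin m) ℂ × GL (Fin n) ℂ)}
    {X : Set (Matrix (Fin m) (Fin n) ℂ)} (hX : IsStable G X) (g : G) :
    CoordRing X →ₐ[ℂ] CoordRing X :=
  Ideal.quotientMapₐ (idealOf X) (polyAct g.1) (idealOf_le_comap hX g)

/-- The invertible diagonal matrix with given entries. -/
noncomputable def diagGL (t : Fin m → ℂˣ) : GL (Fin m) ℂ where
  val := Matrix.diagonal fun i => (t i : ℂ)
  inv := Matrix.diagonal fun i => ((t i)⁻¹ : ℂˣ)
  val_inv := by simp [Matrix.diagonal_mul_diagonal]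
  inv_val := by simp [Matrix.diagonal_mul_diagonal]

/-- The torus `T = T_m × T_n ≅ (ℂˣ)^{m+n}` as a group of pairs of diagonal matrices. -/
noncomputable def torusElt (t : Fin m ⊕ Fin n → ℂˣ) : GL (Fin m) ℂ × GL (Fin n) ℂ :=
  (diagGL fun i => t (Sum.inl i), diagGL fun j => t (Sum.inr j))

theorem torusElt_mem (I : Composition m) (J : Composition n) (t : Fin m ⊕ Fin n → ℂˣ) :
    torusElt t ∈ leviProd I J := by
  refine Subgroup.mem_prod.mpr ⟨fun a b h => ?_, fun a b h => ?_⟩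
  · exact Matrix.diagonal_apply_ne _ fun e => h (by rw [e])
  · exact Matrix.diagonal_apply_ne _ fun e => h (by rw [e])

theorem polyAct_torusElt_X (t : Fin m ⊕ Fin n → ℂˣ) (c : Fin m × Fin n) :
    polyAct (torusElt t) (MvPolynomial.X c) =
      MvPolynomial.C ((t (Sum.inl c.1) : ℂ) * (t (Sum.inr c.2) : ℂ)) * MvPolynomial.X c := by
  rw [polyAct, MvPolynomial.aeval_X, Finset.sum_eq_single c.1, Finset.sum_eq_single c.2]
  · simp [torusElt, diagGL]
  · intro l _ hl
    simp [torusElt, diagGL, Matrix.diagonal_apply_ne _ hl.symm]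
  · simp
  · intro k _ hk
    simp [torusElt, diagGL, Matrix.diagonal_apply_ne _ hk.symm]
  · simp

/-- The coordinate ring of an `L_{I|J}`-stable variety as a representation of the torus
`T ≤ L_{I|J}`. -/
noncomputable def torusRep {I : Composition m} {J : Composition n}
    {X : Set (Matrix (Fin m) (Fin n) ℂ)} (hX : IsStable (leviProd I J) X) :
    Representation ℂ (Fin m ⊕ Fin n → ℂˣ) (CoordRing X) where
  toFun t := (ringAct hX ⟨torusElt t, torusElt_mem I J t⟩).toLinearMap
  map_one' := by
    have h : ringAct hX ⟨torusElt 1, torusElt_mem I J 1⟩ = AlgHom.id ℂ _ := by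
      refine Ideal.Quotient.algHom_ext _ (MvPolynomial.algHom_ext fun c => ?_)
      change Ideal.Quotient.mk _ (polyAct (torusElt 1) (MvPolynomial.X c)) =
        Ideal.Quotient.mk _ (MvPolynomial.X c)
      rw [polyAct_torusElt_X]
      simp
    rw [h]
    rfl
  map_mul' s t := by
    have h : ringAct hX ⟨torusElt (s * t), torusElt_mem I J (s * t)⟩ =
        (ringAct hX ⟨torusElt s, torusElt_mem I J s⟩).comp
          (ringAct hX ⟨torusElt t, torusElt_mem I J t⟩) := by
      refine Ideal.Quotient.algHom_ext _ (MvPolynomial.algHom_ext fun c => ?_)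
      change Ideal.Quotient.mk _ (polyAct (torusElt (s * t)) (MvPolynomial.X c)) =
        Ideal.Quotient.mk _ (polyAct (torusElt s) (polyAct (torusElt t) (MvPolynomial.X c)))
      rw [polyAct_torusElt_X, polyAct_torusElt_X, map_mul (polyAct (torusElt s)), polyAct_torusElt_X,
        MvPolynomial.algHom_C, MvPolynomial.algebraMap_eq, ← mul_assoc, ← MvPolynomial.C_mul]
      congr 3
      simp only [Pi.mul_apply, Units.val_mul]
      ring
    rw [h]
    rfl

end LeviAction

section Characters

variable {σ : Type} [Fintype σ] [DecidableEq σ] {V : Type} [AddCommGroup V] [Module ℂ V]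

/-- The weight space of weight `a` of a representation of the torus `(ℂˣ)^σ`. -/
def weightSpace (ρ : Representation ℂ (σ → ℂˣ) V) (a : σ → ℤ) : Submodule ℂ V where
  carrier := {v | ∀ t : σ → ℂˣ, ρ t v = ((∏ i, t i ^ a i : ℂˣ) : ℂ) • v}
  zero_mem' t := by simp
  add_mem' {v w} hv hw t := by rw [map_add, hv t, hw t, smul_add]
  smul_mem' c v hv t := by rw [map_smul, hv t, smul_comm]

/-- `χ` is the character of the torus representation `ρ`: the space is the direct sum of its
weight spaces, these are finite-dimensional, and `χ = ∑ₐ (dim V_a) t^a` (so that `V_a = 0` for all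
weights `a` with a negative entry). -/
def HasTorusCharacter (ρ : Representation ℂ (σ → ℂˣ) V) (χ : MvPowerSeries σ ℤ) : Prop :=
  DirectSum.IsInternal (weightSpace ρ) ∧
  ∀ a : σ → ℤ, FiniteDimensional ℂ (weightSpace ρ a) ∧
    (Module.finrank ℂ (weightSpace ρ a) : ℤ) =
      if ∀ i, 0 ≤ a i then
        MvPowerSeries.coeff (Finsupp.equivFunOnFinite.symm fun i => (a i).toNat) χ
      else 0

end Characters

section Schur

/-- Semistandard tableaux of shape `μ` with entries in an alphabet of `k` letters `0, …, k - 1`. -/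
abbrev BoundedSSYT (μ : YoungDiagram) (k : ℕ) : Type :=
  {T : SemistandardYoungTableau μ // ∀ c ∈ μ.cells, T c.1 c.2 < k}

instance boundedSSYT_finite (μ : YoungDiagram) (k : ℕ) : Finite (BoundedSSYT μ k) := by
  refine Finite.of_injective
    (fun T : BoundedSSYT μ k => fun c : μ.cells => (⟨T.1 c.1.1 c.1.2, T.2 c.1 c.2⟩ : Fin k)) ?_
  intro T T' h
  refine Subtype.ext (SemistandardYoungTableau.ext fun i j => ?_)
  by_cases hc : (i, j) ∈ μ
  · exact congrArg Fin.val (congrFun h ⟨(i, j), hc⟩)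
  · rw [T.1.zeros hc, T'.1.zeros hc]

noncomputable instance boundedSSYT_fintype (μ : YoungDiagram) (k : ℕ) :
    Fintype (BoundedSSYT μ k) := Fintype.ofFinite _

/-- The Schur polynomial `s_μ(t_0, …, t_{k-1})`. -/
noncomputable def schur (μ : YoungDiagram) (k : ℕ) : MvPolynomial (Fin k) ℤ :=
  ∑ T : BoundedSSYT μ k, ∏ i : Fin k,
    MvPolynomial.X i ^ (μ.cells.filter fun c => T.1 c.1 c.2 = (i : ℕ)).card

/-- The split-Schur polynomial of a partition-tuple: the product of the Schur polynomials
`s_{λ^{(k)}}`, each in the variables of the `k`-th block of `I`. -/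
noncomputable def splitSchur {m : ℕ} (I : Composition m) (lam : PartitionTuple I) :
    MvPolynomial (Fin m) ℤ :=
  ∏ k : Fin I.length, MvPolynomial.rename (I.embedding k) (schur (lam k).1 (I.blocksFun k))

/-- The product `s_λ(x) s_μ(y)`, in the variables `x_i` (`Sum.inl i`) and `y_j` (`Sum.inr j`). -/
noncomputable def splitSchurProd {m n : ℕ} (I : Composition m) (J : Composition n)
    (lam : PartitionTuple I) (mu : PartitionTuple J) : MvPolynomial (Fin m ⊕ Fin n) ℤ :=
  MvPolynomial.rename Sum.inl (splitSchur I lam) * MvPolynomial.rename Sum.inr (splitSchur J mu)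

end Schur

section Bicrystalline

variable {m n : ℕ}

/-- The set `{0 = i_0, i_1, …, i_r = m}` of a composition. -/
def cuts (I : Composition m) : Set ℕ := {a | ∃ k ≤ I.length, a = I.sizeUpTo k}

/-- The standard monomials for the term order `ord` are closed under the bicrystal operators with
(`1`-based) indices `i + 1 ∉ I`, `j + 1 ∉ J`. -/
def IsBicrystalClosed (I : Composition m) (J : Composition n)
    (ord : MonomialOrder (Fin m × Fin n)) (X : Set (Matrix (Fin m) (Fin n) ℂ)) : Prop :=
  ∀ M ∈ Std ord X,
    (∀ i, i + 1 < m → i + 1 ∉ cuts I →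
      (∀ N ∈ eRow i M, N ∈ Std ord X) ∧ (∀ N ∈ fRow i M, N ∈ Std ord X)) ∧
    (∀ j, j + 1 < n → j + 1 ∉ cuts J →
      (∀ N ∈ eCol j M, N ∈ Std ord X) ∧ (∀ N ∈ fCol j M, N ∈ Std ord X))

/-- `X` is `L_{I|J}`-bicrystalline, as witnessed by the term order `ord`. -/
structure IsBicrystalline (I : Composition m) (J : Composition n)
    (ord : MonomialOrder (Fin m × Fin n)) (X : Set (Matrix (Fin m) (Fin n) ℂ)) : Prop where
  stable : IsStable (leviProd I J) X
  closed : IsBicrystalClosed I J ord X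

/-- The standard monomials whose image under filtered RSK is the highest-weight tableau-tuple of
shape `(lam | mu)`. -/
def highestWeightStd (I : Composition m) (J : Composition n)
    (ord : MonomialOrder (Fin m × Fin n)) (X : Set (Matrix (Fin m) (Fin n) ℂ))
    (lam : PartitionTuple I) (mu : PartitionTuple J) : Set (Matrix (Fin m) (Fin n) ℕ) :=
  {M ∈ Std ord X | filterRSK I J M = (highestWeightTuple I lam, highestWeightTuple J mu)}

end Bicrystalline

end GenCauchy

open GenCauchy

namespace GenCauchy

/-! ### Standard monomials form a basis of the quotient ring. -/

section Macaulay

variable {σ : Type*} (ord : MonomialOrder σ) (K : Ideal (MvPolynomial σ ℂ))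

/-! By Macaulay's theorem the standard monomials form a basis of the coordinate ring
(`stdClass_linearIndependent`, `span_stdClass`). Each is a torus weight vector whose weight is the
list of row and column sums of its exponent matrix. So the weight multiplicities count standard
monomials by row and column sums (`hasTorusCharacter_torusRep`), and what remains is a statement
about sets of matrices closed under bicrystal operators.

For a single block of rows the weight sum of such a finite set is computed by Stembridge's
cancellation instead of by decomposing it into crystal components. Reflecting the `i`-strings shows
that the sum is symmetric, so its product with the Vandermonde alternant is a sum of alternants. A
second reflection, shifted by one and applied in the string of the first violation of the highest
weight condition, is a sign-reversing involution: only highest weight matrices survive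
(`alternant_staircase_mul_sum_rowSums`). Semistandard tableaux of a fixed shape, encoded as
matrices, are themselves such a set with exactly one highest weight element. This yields the
bialternant formula `alternant_staircase_mul_schur`, and dividing by the Vandermonde alternant turns
the surviving alternants into Schur polynomials (`sum_xMonomial_rowSums`).

Several blocks, of rows and of columns, are treated one at a time: an operator of one block changes
neither the row (column) sums nor the highest weight property of any other block. Between rows and
columns this is the commutation of the two crystal structures, `Raise.height_swap_le_iff`. The
general exchange argument is `sum_prod_eq_sum_prod`.

Finally, highest weight has to be matched with filtered RSK. Knuth moves preserve content and the
Yamanouchi property, every word is Knuth equivalent to a tableau word by column insertion, and a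
tableau with a Yamanouchi word is a highest weight tableau. Hence `tab w` is a highest weight
tableau exactly when `w` is Yamanouchi (`tab_eq_highestWeight_iff`); the uniqueness of the tableau
in a general Knuth class never enters. Everything is done in one total degree at a time, where all
sets are finite; homogeneity then gives coefficientwise convergence. -/

theorem monomial_mem_initialIdeal {s : σ →₀ ℕ} :
    MvPolynomial.monomial s (1 : ℂ) ∈ initialIdeal ord K ↔
      ∃ f ∈ K, f ≠ 0 ∧ ord.degree f = s := by
  classical
  have hset : ((fun p ↦ MvPolynomial.monomial (ord.degree p) (1 : ℂ)) ''
      ((K : Set (MvPolynomial σ ℂ)) \ {0})) =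
      (fun d => MvPolynomial.monomial d (1 : ℂ)) ''
        (ord.degree '' ((K : Set (MvPolynomial σ ℂ)) \ {0})) := by
    rw [Set.image_image]
  rw [initialIdeal, MonomialOrder.span_leadingTerm_eq_span_monomial', hset,
    MvPolynomial.mem_ideal_span_monomial_image]
  have hsupp : (MvPolynomial.monomial s (1 : ℂ)).support = {s} := by
    rw [MvPolynomial.support_monomial, if_neg one_ne_zero]
  constructor
  · intro h
    obtain ⟨_, ⟨f, ⟨hfK, hf0⟩, rfl⟩, hle⟩ := h s (by simp [hsupp])
    have hf0 : f ≠ 0 := hf0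
    have hm0 : MvPolynomial.monomial (s - ord.degree f) (1 : ℂ) ≠ 0 := by simp
    -- A multiple of a leading monomial is again leading, for the corresponding monomial multiple of
    -- `f`.
    refine ⟨MvPolynomial.monomial (s - ord.degree f) 1 * f, K.mul_mem_left _ hfK,
      mul_ne_zero hm0 hf0, ?_⟩
    rw [ord.degree_mul hm0 hf0, ord.degree_monomial, if_neg one_ne_zero, tsub_add_cancel_of_le hle]
  · rintro ⟨f, hfK, hf0, rfl⟩ x hx
    rw [hsupp, Finset.mem_singleton] at hx
    exact ⟨_, ⟨f, ⟨hfK, hf0⟩, rfl⟩, hx.ge⟩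

/-- The class of a standard monomial in the quotient ring. -/
noncomputable def stdClass
    (s : {s : σ →₀ ℕ // MvPolynomial.monomial s (1 : ℂ) ∉ initialIdeal ord K}) :
    MvPolynomial σ ℂ ⧸ K :=
  Ideal.Quotient.mk K (MvPolynomial.monomial s.1 1)

/-- A relation lifts to a polynomial in `K` supported on standard exponents; if it were nonzero, its
leading exponent would be standard and in the initial ideal at once. -/
theorem stdClass_linearIndependent : LinearIndependent ℂ (stdClass ord K) := by
  classical
  rw [linearIndependent_iff]
  intro l hl
  have h1 : Ideal.Quotient.mk K (l.sum fun s c => MvPolynomial.monomial s.1 c) = 0 := by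
    rw [← hl, Finsupp.linearCombination_apply, Finsupp.sum, Finsupp.sum, map_sum]
    refine Finset.sum_congr rfl fun s _ => ?_
    rw [stdClass, ← Ideal.Quotient.mkₐ_eq_mk ℂ, ← map_smul, MvPolynomial.smul_monomial, smul_eq_mul,
      mul_one]
  rw [Ideal.Quotient.eq_zero_iff_mem] at h1
  set f := l.sum fun s c => MvPolynomial.monomial s.1 c with hf
  have hcoeff : ∀ d, f.coeff d ≠ 0 → ∃ s, s.1 = d ∧ l s ≠ 0 := by
    intro d hd
    by_contra hcon
    push Not at hcon
    apply hd
    rw [hf, Finsupp.sum, MvPolynomial.coeff_sum]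
    refine Finset.sum_eq_zero fun s hs => ?_
    rw [MvPolynomial.coeff_monomial]
    split_ifs with h
    · exact hcon s h
    · rfl
  have hf0 : f = 0 := by
    by_contra hne
    obtain ⟨s, hs, -⟩ := hcoeff (ord.degree f) (ord.coeff_degree_ne_zero_iff.mpr hne)
    exact s.2 ((monomial_mem_initialIdeal ord K).mpr ⟨f, h1, hne, hs.symm⟩)
  ext s
  have := congrArg (MvPolynomial.coeff s.1) hf0
  rw [hf, Finsupp.sum, MvPolynomial.coeff_sum] at this
  simp only [MvPolynomial.coeff_monomial, MvPolynomial.coeff_zero] at this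
  by_contra hne
  apply hne
  rw [Finset.sum_eq_single s] at this
  · simpa using this
  · intro t _ hts
    rw [if_neg fun h => hts (Subtype.ext h)]
  · intro hs
    simpa using hs

/-- Well-founded induction along the term order: a nonstandard monomial leads some element of `K`,
so modulo `K` it is a combination of smaller monomials. -/
theorem span_stdClass : Submodule.span ℂ (Set.range (stdClass ord K)) = ⊤ := by
  classical
  have key : ∀ a : ord.syn, Ideal.Quotient.mk K (MvPolynomial.monomial (ord.toSyn.symm a) 1) ∈
      Submodule.span ℂ (Set.range (stdClass ord K)) := by
    intro a
    induction a using WellFoundedLT.induction with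
    | ind a ih =>
      set s := ord.toSyn.symm a with hs
      by_cases hstd : MvPolynomial.monomial s (1 : ℂ) ∈ initialIdeal ord K
      · obtain ⟨f, hfK, hf0, hdeg⟩ := (monomial_mem_initialIdeal ord K).mp hstd
        have hc : f.coeff s ≠ 0 := hdeg ▸ ord.coeff_degree_ne_zero_iff.mpr hf0
        have hsum : Ideal.Quotient.mk K f = 0 := Ideal.Quotient.eq_zero_iff_mem.mpr hfK
        have hsupp : s ∈ f.support := MvPolynomial.mem_support_iff.mpr hc
        have hmk : ∀ (d : σ →₀ ℕ) (c : ℂ), Ideal.Quotient.mk K (MvPolynomial.monomial d c) =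
            c • Ideal.Quotient.mk K (MvPolynomial.monomial d 1) := by
          intro d c
          rw [← Ideal.Quotient.mkₐ_eq_mk ℂ, ← map_smul, MvPolynomial.smul_monomial, smul_eq_mul,
            mul_one]
        rw [f.as_sum, map_sum, ← Finset.add_sum_erase _ _ hsupp, hmk, add_eq_zero_iff_eq_neg] at hsum
        have hmem : f.coeff s • Ideal.Quotient.mk K (MvPolynomial.monomial s 1) ∈
            Submodule.span ℂ (Set.range (stdClass ord K)) := by
          rw [hsum]
          refine Submodule.neg_mem _ (Submodule.sum_mem _ fun d hd => ?_)
          rw [hmk]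
          refine Submodule.smul_mem _ _ ?_
          have hd' := Finset.mem_erase.mp hd
          have hlt : ord.toSyn d < a := by
            refine lt_of_le_of_ne ?_ ?_
            · have := ord.le_degree hd'.2
              rwa [hdeg, hs, AddEquiv.apply_symm_apply] at this
            · intro h
              exact hd'.1 (by rw [hs, ← h, AddEquiv.symm_apply_apply])
          simpa using ih _ hlt
        exact (Submodule.smul_mem_iff _ hc).mp hmem
      · exact Submodule.subset_span ⟨⟨s, hstd⟩, rfl⟩
  rw [eq_top_iff]
  rintro x -
  obtain ⟨f, rfl⟩ := Ideal.Quotient.mk_surjective x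
  rw [f.as_sum, map_sum]
  refine Submodule.sum_mem _ fun d _ => ?_
  have : Ideal.Quotient.mk K (MvPolynomial.monomial d (f.coeff d)) =
      f.coeff d • Ideal.Quotient.mk K (MvPolynomial.monomial d 1) := by
    rw [← Ideal.Quotient.mkₐ_eq_mk ℂ, ← map_smul, MvPolynomial.smul_monomial, smul_eq_mul, mul_one]
  rw [this]
  exact Submodule.smul_mem _ _ (by simpa using key (ord.toSyn d))

end Macaulay

/-! ### Weight spaces and characters of torus representations. -/

section Weights

variable {σ : Type} [Fintype σ] [DecidableEq σ] {V : Type} [AddCommGroup V] [Module ℂ V]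

/-- The torus element with one coordinate `2` and all others `1` reads off a single exponent. -/
theorem torusCharacter_injective :
    Function.Injective fun (a : σ → ℤ) (t : σ → ℂˣ) => ((∏ i, t i ^ a i : ℂˣ) : ℂ) := by
  intro a b hab
  funext i
  have h := congrFun hab (Function.update 1 i (Units.mk0 2 two_ne_zero))
  have h2 : ∀ c : σ → ℤ, (∏ j, (Function.update (1 : σ → ℂˣ) i (Units.mk0 2 two_ne_zero)) j ^ c j) =
      (Units.mk0 (2 : ℂ) two_ne_zero) ^ c i := by
    intro c
    rw [Finset.prod_eq_single i]
    · simp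
    · intro j _ hj
      simp [Function.update_of_ne hj]
    · simp
  simp only [h2, Units.val_zpow_eq_zpow_val, Units.val_mk0] at h
  -- Taking norms moves the equation to the ordered field `ℝ`, where powers of `2` are injective.
  have h3 : ((2 : ℝ) ^ a i) = 2 ^ b i := by
    simpa using congrArg norm h
  exact zpow_right_injective₀ (by norm_num) (by norm_num) h3

/-- Weight spaces lie in simultaneous generalized eigenspaces of commuting operators, and distinct
weights give distinct systems of eigenvalues. -/
theorem weightSpace_iSupIndep (ρ : Representation ℂ (σ → ℂˣ) V) : iSupIndep (weightSpace ρ) := by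
  have hcomm : ∀ s t : σ → ℂˣ, Commute (ρ s) (ρ t) := by
    intro s t
    rw [Commute, SemiconjBy, ← map_mul, ← map_mul, mul_comm]
  have h := Module.End.independent_iInf_maxGenEigenspace_of_forall_mapsTo (fun t => ρ t)
    (fun i j φ => Module.End.mapsTo_maxGenEigenspace_of_comm (hcomm j i) φ)
  refine iSupIndep.mono (h.comp torusCharacter_injective) fun a v hv => ?_
  have hv' : ∀ t : σ → ℂˣ, ρ t v = ((∏ i, t i ^ a i : ℂˣ) : ℂ) • v := hv
  simp only [Function.comp_apply, Submodule.mem_iInf]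
  intro t
  rw [Module.End.mem_maxGenEigenspace]
  refine ⟨1, ?_⟩
  rw [pow_one, LinearMap.sub_apply, hv' t, LinearMap.smul_apply, Module.End.one_apply, sub_self]

/-- If the representation has a basis of weight vectors, then the weight spaces are spanned by
the basis vectors of the given weight. -/
theorem weightSpace_eq_span {ι : Type} (ρ : Representation ℂ (σ → ℂˣ) V) (b : ι → V)
    (w : ι → σ → ℤ) (hb : ∀ i, b i ∈ weightSpace ρ (w i))
    (hspan : Submodule.span ℂ (Set.range b) = ⊤) (a : σ → ℤ) :
    weightSpace ρ a = Submodule.span ℂ (Set.range fun i : {i // w i = a} => b i.1) := by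
  set U : (σ → ℤ) → Submodule ℂ V :=
    fun a => Submodule.span ℂ (Set.range fun i : {i // w i = a} => b i.1) with hU
  have hle : ∀ a, U a ≤ weightSpace ρ a := by
    intro a
    rw [hU, Submodule.span_le]
    rintro _ ⟨⟨i, rfl⟩, rfl⟩
    exact hb i
  have htop : ⨆ a, U a = ⊤ := by
    rw [eq_top_iff, ← hspan, Submodule.span_le]
    rintro _ ⟨i, rfl⟩
    exact (le_iSup U (w i)) (Submodule.subset_span ⟨⟨i, rfl⟩, rfl⟩)
  refine le_antisymm (fun v hv => ?_) (hle a)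
  -- A vector of weight `a` splits into a part in `U a` and a rest of other weights; the rest also
  -- has weight `a`, so it vanishes by independence.
  have hsup : U a ⊔ ⨆ (c) (_ : c ≠ a), U c = ⊤ := by
    rw [eq_top_iff, ← htop, iSup_le_iff]
    intro c
    by_cases hc : c = a
    · exact hc ▸ le_sup_left
    · exact le_sup_of_le_right (le_iSup₂_of_le c hc le_rfl)
  have hv' : v ∈ U a ⊔ ⨆ (c) (_ : c ≠ a), U c := hsup ▸ Submodule.mem_top
  obtain ⟨x, hx, y, hy, rfl⟩ := Submodule.mem_sup.mp hv'
  have hy1 : y ∈ weightSpace ρ a := by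
    have := Submodule.sub_mem _ hv (hle a hx)
    rwa [add_sub_cancel_left] at this
  have hy2 : y ∈ ⨆ (c) (_ : c ≠ a), weightSpace ρ c := (iSup₂_mono fun c _ => hle c) hy
  have hy0 : y = 0 := by
    have := ((weightSpace_iSupIndep ρ) a).le_bot ⟨hy1, hy2⟩
    simpa using this
  rwa [hy0, add_zero]

/-- By `weightSpace_eq_span` the dimension of a weight space counts the basis vectors of that
weight; weights of basis vectors are natural numbers, so negative entries contribute nothing. -/
theorem hasTorusCharacter_of_basis {ι : Type} (ρ : Representation ℂ (σ → ℂˣ) V) (b : ι → V)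
    (w : ι → σ → ℕ) (hb : ∀ i, b i ∈ weightSpace ρ fun j => (w i j : ℤ))
    (hli : LinearIndependent ℂ b) (hspan : Submodule.span ℂ (Set.range b) = ⊤)
    (hfin : ∀ a, {i | w i = a}.Finite) (χ : MvPowerSeries σ ℤ)
    (hχ : ∀ a : σ → ℕ, MvPowerSeries.coeff (Finsupp.equivFunOnFinite.symm a) χ =
      ({i | w i = a}.ncard : ℤ)) :
    HasTorusCharacter ρ χ := by
  have heq := weightSpace_eq_span ρ b (fun i j => (w i j : ℤ)) hb hspan
  refine ⟨?_, fun a => ?_⟩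
  · rw [DirectSum.isInternal_submodule_iff_iSupIndep_and_iSup_eq_top]
    refine ⟨weightSpace_iSupIndep ρ, ?_⟩
    rw [eq_top_iff, ← hspan, Submodule.span_le]
    rintro _ ⟨i, rfl⟩
    exact (le_iSup (weightSpace ρ) _) (hb i)
  · have hset : {i | (fun j => (w i j : ℤ)) = a} =
        if ∀ j, 0 ≤ a j then {i | w i = fun j => (a j).toNat} else ∅ := by
      split_ifs with h
      · ext i
        simp only [Set.mem_ofPred_eq, funext_iff]
        refine forall_congr' fun j => ?_
        have := h j
        omega
      · ext i
        simp only [Set.mem_ofPred_eq, Set.mem_empty_iff_false, iff_false]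
        rintro rfl
        exact h fun j => Int.natCast_nonneg _
    have hfin' : {i | (fun j => (w i j : ℤ)) = a}.Finite := by
      rw [hset]
      split_ifs
      · exact hfin _
      · exact Set.finite_empty
    have : Fintype {i // (fun j => (w i j : ℤ)) = a} := hfin'.fintype
    have hli' : LinearIndependent ℂ fun i : {i // (fun j => (w i j : ℤ)) = a} => b i.1 :=
      hli.comp _ Subtype.val_injective
    rw [heq a]
    refine ⟨FiniteDimensional.span_of_finite ℂ (Set.finite_range _), ?_⟩
    rw [finrank_span_eq_card hli', ← Nat.card_eq_fintype_card]
    change ((Set.ncard {i | (fun j => (w i j : ℤ)) = a} : ℕ) : ℤ) = _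
    rw [hset]
    split_ifs with h
    · rw [hχ]
    · simp

end Weights

/-! ### The torus action on standard monomials. -/

section CoordinateRing

variable {m n : ℕ}

/-- The exponent vector with the given matrix of exponents. -/
noncomputable def exponent (M : Matrix (Fin m) (Fin n) ℕ) : Fin m × Fin n →₀ ℕ :=
  Finsupp.equivFunOnFinite.symm fun p => M p.1 p.2

theorem prod_X_pow_eq_monomial (M : Matrix (Fin m) (Fin n) ℕ) :
    (∏ i, ∏ j, MvPolynomial.X (i, j) ^ M i j : MvPolynomial (Fin m × Fin n) ℂ) =
      MvPolynomial.monomial (exponent M) 1 := by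
  rw [MvPolynomial.monomial_eq, Finsupp.prod_fintype _ _ (by simp), Fintype.prod_prod_type]
  simp [exponent]

/-- The weight of an exponent matrix: its row sums and its column sums. -/
def matrixWeight (M : Matrix (Fin m) (Fin n) ℕ) : Fin m ⊕ Fin n → ℕ :=
  Sum.elim (fun i => ∑ j, M i j) (fun j => ∑ i, M i j)

/-- Each variable is scaled by the product of its row and column parameters, so a row parameter
collects a row sum and a column parameter a column sum. -/
theorem polyAct_torusElt_monomial (t : Fin m ⊕ Fin n → ℂˣ) (M : Matrix (Fin m) (Fin n) ℕ) :
    polyAct (torusElt t) (MvPolynomial.monomial (exponent M) 1) =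
      ((∏ i, t i ^ (matrixWeight M i : ℤ) : ℂˣ) : ℂ) •
        MvPolynomial.monomial (exponent M) (1 : ℂ) := by
  rw [← prod_X_pow_eq_monomial, map_prod]
  simp only [map_prod, map_pow, polyAct_torusElt_X, mul_pow, Finset.prod_mul_distrib]
  rw [MvPolynomial.smul_eq_C_mul]
  congr 1
  simp only [← map_prod, ← map_pow]
  congr 1
  rw [Fintype.prod_sum_type]
  simp only [matrixWeight, Sum.elim_inl, Sum.elim_inr, zpow_natCast]
  push_cast
  simp only [mul_pow, Finset.prod_mul_distrib]
  congr 1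
  · refine Finset.prod_congr rfl fun i _ => ?_
    rw [Finset.prod_pow_eq_pow_sum]
  · rw [Finset.prod_comm]
    refine Finset.prod_congr rfl fun i _ => ?_
    rw [Finset.prod_pow_eq_pow_sum]

theorem finite_matrixWeight_eq (a : Fin m ⊕ Fin n → ℕ) :
    {M : Matrix (Fin m) (Fin n) ℕ | matrixWeight M = a}.Finite := by
  refine (Set.Finite.pi' fun i : Fin m => Set.Finite.pi' fun _ : Fin n =>
    Set.finite_Iic (a (Sum.inl i))).subset ?_
  intro M hM i j
  have hM : matrixWeight M = a := hM
  rw [Set.mem_Iic, ← hM]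
  exact Finset.single_le_sum (f := fun j => M i j) (fun _ _ => Nat.zero_le _) (Finset.mem_univ j)

/-- The torus character of the coordinate ring counts the standard monomials by weight. -/
theorem hasTorusCharacter_torusRep {I : Composition m} {J : Composition n}
    {X : Set (Matrix (Fin m) (Fin n) ℂ)} (hX : IsStable (leviProd I J) X)
    (ord : MonomialOrder (Fin m × Fin n)) (χ : MvPowerSeries (Fin m ⊕ Fin n) ℤ)
    (hχ : ∀ a : Fin m ⊕ Fin n → ℕ, MvPowerSeries.coeff (Finsupp.equivFunOnFinite.symm a) χ =
      ({M ∈ Std ord X | matrixWeight M = a}.ncard : ℤ)) :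
    HasTorusCharacter (torusRep hX) χ := by
  have hStd : ∀ M : Matrix (Fin m) (Fin n) ℕ, M ∈ Std ord X ↔
      MvPolynomial.monomial (exponent M) (1 : ℂ) ∉ initialIdeal ord (idealOf X) := by
    intro M
    rw [← prod_X_pow_eq_monomial]
    rfl
  let e : Std ord X ≃ {s : Fin m × Fin n →₀ ℕ //
      MvPolynomial.monomial s (1 : ℂ) ∉ initialIdeal ord (idealOf X)} :=
    { toFun := fun M => ⟨exponent M.1, (hStd M.1).mp M.2⟩
      invFun := fun s => ⟨Matrix.of fun i j => s.1 (i, j), (hStd _).mpr (by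
        have : exponent (Matrix.of fun i j => s.1 (i, j)) = s.1 := by
          ext p
          simp [exponent]
        rw [this]
        exact s.2)⟩
      left_inv := fun M => by
        ext i j
        simp [exponent]
      right_inv := fun s => by
        ext p
        simp [exponent] }
  have hncard : ∀ a, ({M : Std ord X | matrixWeight M.1 = a}).ncard =
      {M ∈ Std ord X | matrixWeight M = a}.ncard := by
    intro a
    rw [← Set.ncard_image_of_injective _ Subtype.val_injective]
    congr 1
    ext M
    simp only [Set.mem_image, Set.mem_ofPred_eq, Subtype.exists, exists_and_right, exists_eq_right]
    tauto
  refine hasTorusCharacter_of_basis (torusRep hX) (stdClass ord (idealOf X) ∘ e)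
    (fun M => matrixWeight M.1) ?_ ((stdClass_linearIndependent ord _).comp _ e.injective) ?_ ?_ χ ?_
  · intro M t
    change Ideal.Quotient.mk (idealOf X) (polyAct (torusElt t)
      (MvPolynomial.monomial (exponent M.1) 1)) = _
    rw [polyAct_torusElt_monomial, ← Ideal.Quotient.mkₐ_eq_mk ℂ, map_smul]
    rfl
  · rw [Set.range_comp, e.surjective.range_eq, Set.image_univ, span_stdClass]
  · intro a
    exact (finite_matrixWeight_eq a).preimage Subtype.val_injective.injOn
  · intro a
    rw [hχ, hncard]

end CoordinateRing

/-! ### Alternants and the sign-reversing cancellation. -/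

section Alternants

variable {l : ℕ}

/-- The alternant `det (x_p ^ v_q)`. -/
noncomputable def alternant (v : Fin l → ℕ) : MvPolynomial (Fin l) ℤ :=
  (Matrix.of fun p q : Fin l => (MvPolynomial.X p : MvPolynomial (Fin l) ℤ) ^ v q).det

/-- The staircase `(l - 1, …, 1, 0)`. -/
def staircase (l : ℕ) (q : Fin l) : ℕ := (q.rev : ℕ)

/-- The monomial with the given exponents. -/
noncomputable def xMonomial (v : Fin l → ℕ) : MvPolynomial (Fin l) ℤ :=
  ∏ q, MvPolynomial.X q ^ v q

theorem alternant_comp_swap (v : Fin l → ℕ) {i j : Fin l} (hij : i ≠ j) :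
    alternant (v ∘ Equiv.swap i j) = -alternant v := by
  have h := Matrix.det_permute' (Equiv.swap i j)
    (Matrix.of fun p q : Fin l => (MvPolynomial.X p : MvPolynomial (Fin l) ℤ) ^ v q)
  rw [Equiv.Perm.sign_swap hij] at h
  have h2 : (Matrix.of fun p q : Fin l =>
      (MvPolynomial.X p : MvPolynomial (Fin l) ℤ) ^ (v ∘ Equiv.swap i j) q) =
      (Matrix.of fun p q : Fin l => (MvPolynomial.X p : MvPolynomial (Fin l) ℤ) ^ v q).submatrix id
        (Equiv.swap i j) := rfl
  rw [alternant, alternant, h2, h]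
  simp

/-- Up to the sign of the column reversal this is the Vandermonde determinant in distinct variables.
It is the factor cancelled at the end. -/
theorem alternant_staircase_ne_zero : alternant (staircase l) ≠ 0 := by
  have h := Matrix.det_permute' Fin.revPerm
    (Matrix.vandermonde fun p : Fin l => (MvPolynomial.X p : MvPolynomial (Fin l) ℤ))
  have h2 : (Matrix.vandermonde fun p : Fin l => (MvPolynomial.X p : MvPolynomial (Fin l) ℤ)).det ≠
      0 := Matrix.det_vandermonde_ne_zero_iff.mpr (MvPolynomial.X_injective)
  have h3 : alternant (staircase l) = ((Matrix.vandermonde fun p : Fin l =>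
      (MvPolynomial.X p : MvPolynomial (Fin l) ℤ)).submatrix id Fin.revPerm).det := rfl
  rw [h3, h]
  refine mul_ne_zero ?_ h2
  rcases Int.units_eq_one_or (Equiv.Perm.sign (Fin.revPerm : Equiv.Perm (Fin l))) with h | h <;>
    simp [h]

theorem rename_perm_eq_self {f : MvPolynomial (Fin l) ℤ}
    (hf : ∀ i j : Fin l, (j : ℕ) = i + 1 → MvPolynomial.rename (Equiv.swap i j) f = f)
    (s : Equiv.Perm (Fin l)) : MvPolynomial.rename s f = f := by
  cases l with
  | zero =>
    rw [Subsingleton.elim s 1]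
    exact MvPolynomial.rename_id_apply f
  | succ n =>
    have hs : s ∈ Submonoid.closure
        (Set.range fun i : Fin n ↦ Equiv.swap i.castSucc i.succ) := by
      rw [Equiv.Perm.mclosure_swap_castSucc_succ]
      trivial
    induction hs using Submonoid.closure_induction with
    | mem x hx =>
      obtain ⟨i, rfl⟩ := hx
      exact hf _ _ (by simp)
    | one => exact MvPolynomial.rename_id_apply f
    | mul x y _ _ hx hy =>
      rw [Equiv.Perm.coe_mul, ← MvPolynomial.rename_rename, hy, hx]

variable {β : Type*} (B : Finset β) (wt : β → Fin l → ℕ)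

/-- The involutions `r` make the weight sum symmetric, so in the term of the permutation `s` it can
be replaced by its `s`-translate; then the exponents simply add. -/
theorem alternant_mul_sum
    (hsym : ∀ i j : Fin l, (j : ℕ) = i + 1 → ∃ r : β → β, ∀ b ∈ B, r b ∈ B ∧ r (r b) = b ∧
      wt (r b) = wt b ∘ Equiv.swap i j) (v : Fin l → ℕ) :
    alternant v * ∑ b ∈ B, xMonomial (wt b) = ∑ b ∈ B, alternant (wt b + v) := by
  set χ := ∑ b ∈ B, xMonomial (wt b) with hχ
  have hren : ∀ s : Equiv.Perm (Fin l), MvPolynomial.rename s χ =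
      ∑ b ∈ B, ∏ q, MvPolynomial.X (s q) ^ wt b q := by
    intro s
    simp [hχ, xMonomial, map_sum, map_prod]
  have hinv : ∀ s : Equiv.Perm (Fin l), MvPolynomial.rename s χ = χ := by
    refine rename_perm_eq_self fun i j hij => ?_
    obtain ⟨r, hr⟩ := hsym i j hij
    rw [hren, hχ]
    refine Finset.sum_bij' (fun b _ => r b) (fun b _ => r b) (fun b hb => (hr b hb).1)
      (fun b hb => (hr b hb).1) (fun b hb => (hr b hb).2.1) (fun b hb => (hr b hb).2.1) ?_
    intro b hb
    rw [xMonomial, (hr b hb).2.2]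
    refine Fintype.prod_equiv (Equiv.swap i j) _ _ fun q => ?_
    simp
  simp only [alternant, Matrix.det_apply, Matrix.of_apply]
  rw [Finset.sum_mul, Finset.sum_comm]
  refine Finset.sum_congr rfl fun s _ => ?_
  rw [← hinv s, hren, ← Finset.smul_sum, smul_mul_assoc, Finset.mul_sum]
  congr 1
  refine Finset.sum_congr rfl fun b _ => ?_
  simp only [Pi.add_apply, pow_add, Finset.prod_mul_distrib]
  rw [mul_comm]

/-- The cancellation argument of Stembridge. -/
theorem alternant_staircase_mul_sum (hw : β → Prop) [DecidablePred hw]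
    (hsym : ∀ i j : Fin l, (j : ℕ) = i + 1 → ∃ r : β → β, ∀ b ∈ B, r b ∈ B ∧ r (r b) = b ∧
      wt (r b) = wt b ∘ Equiv.swap i j)
    (hcancel : ∃ t : β → β, ∀ b ∈ B, ¬hw b → t b ∈ B ∧ ¬hw (t b) ∧ t (t b) = b ∧
      ∃ i j : Fin l, i ≠ j ∧ wt (t b) + staircase l = (wt b + staircase l) ∘ Equiv.swap i j) :
    alternant (staircase l) * ∑ b ∈ B, xMonomial (wt b) =
      ∑ b ∈ B with hw b, alternant (wt b + staircase l) := by
  rw [alternant_mul_sum B wt hsym, ← Finset.sum_filter_add_sum_filter_not B hw]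
  have hzero : ∑ b ∈ B with ¬hw b, alternant (wt b + staircase l) = 0 := by
    obtain ⟨t, ht⟩ := hcancel
    have hneg : ∀ b ∈ B.filter fun b => ¬hw b,
        alternant (wt b + staircase l) + alternant (wt (t b) + staircase l) = 0 := by
      intro b hb
      obtain ⟨hb, hb'⟩ := Finset.mem_filter.mp hb
      obtain ⟨i, j, hij, h⟩ := (ht b hb hb').2.2.2
      rw [h, alternant_comp_swap _ hij, add_neg_cancel]
    -- At a fixed point of `t` the alternant equals its own negative, so it is zero.
    refine Finset.sum_involution (fun b _ => t b) hneg ?_ ?_ ?_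
    · intro b hb hne heq
      have := hneg b hb
      rw [heq, ← two_mul] at this
      exact hne ((mul_eq_zero.mp this).resolve_left two_ne_zero)
    · intro b hb
      obtain ⟨hb, hb'⟩ := Finset.mem_filter.mp hb
      exact Finset.mem_filter.mpr ⟨(ht b hb hb').1, (ht b hb hb').2.1⟩
    · intro b hb
      obtain ⟨hb, hb'⟩ := Finset.mem_filter.mp hb
      exact (ht b hb hb').2.2.1
  rw [hzero, add_zero]

end Alternants

/-! ### Strings of a crystal operator and their reflections. -/

section Strings

variable {β : Type*}

/-- A decomposition of a set into finite strings: `rel b b'` says that `b'` is obtained from `b`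
by raising, `eps` is the number of possible raisings and `phi` that of the possible lowerings. -/
structure IsString (rel : β → β → Prop) (eps phi : β → ℕ) : Prop where
  eps_eq : ∀ {a b}, rel a b → eps a = eps b + 1
  phi_eq : ∀ {a b}, rel a b → phi b = phi a + 1
  exists_right : ∀ {a}, 0 < eps a → ∃ b, rel a b
  exists_left : ∀ {b}, 0 < phi b → ∃ a, rel a b
  right_unique : ∀ {a b b'}, rel a b → rel a b' → b = b'
  left_unique : ∀ {a a' b}, rel a b → rel a' b → a = a'

namespace IsString

variable {rel : β → β → Prop} {eps phi : β → ℕ}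

theorem flip (h : IsString rel eps phi) : IsString (fun a b => rel b a) phi eps where
  eps_eq := h.phi_eq
  phi_eq := h.eps_eq
  exists_right := h.exists_left
  exists_left := h.exists_right
  right_unique := h.left_unique
  left_unique := h.right_unique

open Classical in
/-- One step of raising. -/
noncomputable def up (rel : β → β → Prop) (a : β) : β := if h : ∃ b, rel a b then h.choose else a

theorem rel_up (h : IsString rel eps phi) {a : β} (ha : 0 < eps a) : rel a (up rel a) := by
  have := h.exists_right ha
  rw [up, dif_pos this]
  exact this.choose_spec

/-- The last clause lists what is known of the edges on the path climbed from `a`; a predicate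
constant along such edges is constant along the path. -/
theorem iterate_up (h : IsString rel eps phi) (k : ℕ) :
    ∀ a, k ≤ eps a → eps ((up rel)^[k] a) + k = eps a ∧ phi ((up rel)^[k] a) = phi a + k ∧
      (up fun a b => rel b a)^[k] ((up rel)^[k] a) = a ∧
      ∀ P : β → Prop, (∀ x y, rel x y → eps a ≤ eps y + k →
        eps x + phi x = eps a + phi a → eps x ≤ eps a → (P x ↔ P y)) →
        (P a ↔ P ((up rel)^[k] a)) := by
  induction k with
  | zero => simp
  | succ k ih =>
    intro a ha
    have hrel := h.rel_up (a := a) (by omega)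
    have he := h.eps_eq hrel
    have hp := h.phi_eq hrel
    obtain ⟨h1, h2, h3, h4⟩ := ih (up rel a) (by omega)
    rw [Function.iterate_succ_apply]
    refine ⟨by omega, by omega, ?_, ?_⟩
    · rw [Function.iterate_succ_apply', h3]
      exact h.left_unique (h.flip.rel_up (a := up rel a) (by omega)) hrel
    · intro P hP
      exact (hP _ _ hrel (by omega) rfl le_rfl).trans
        (h4 P fun x y hxy hy hs hx => hP x y hxy (by omega) (by omega) (by omega))

/-- The reflection of a string, shifted by `d`: the element with `phi + d` possible raisings. -/
noncomputable def reflect (rel : β → β → Prop) (eps phi : β → ℕ) (d : ℕ) (a : β) : β :=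
  if phi a + d ≤ eps a then (up rel)^[eps a - (phi a + d)] a
  else (up fun a b => rel b a)^[phi a + d - eps a] a

/-- For `d = 0` this flips the whole string; for `d = 1` it flips the string without its top
element. Only edges inside the part `d ≤ eps` are used, so a predicate has to be invariant only
there. -/
theorem reflect_spec (h : IsString rel eps phi) (d : ℕ) {a : β} (ha : d ≤ eps a) :
    eps (reflect rel eps phi d a) = phi a + d ∧ phi (reflect rel eps phi d a) + d = eps a ∧
      reflect rel eps phi d (reflect rel eps phi d a) = a ∧
      ∀ P : β → Prop, (∀ x y, rel x y → d ≤ eps y → (P x ↔ P y)) →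
        (P a ↔ P (reflect rel eps phi d a)) := by
  by_cases hle : phi a + d ≤ eps a
  · obtain ⟨h1, h2, h3, h4⟩ := h.iterate_up (eps a - (phi a + d)) a (by omega)
    have hr : reflect rel eps phi d a = (up rel)^[eps a - (phi a + d)] a := if_pos hle
    rw [← hr] at h1 h2 h3 h4
    refine ⟨by omega, by omega, ?_, fun P hP => h4 P fun x y hxy hy _ _ => hP x y hxy (by omega)⟩
    rcases hle.eq_or_lt with heq | hlt
    · have hra : reflect rel eps phi d a = a := by rw [hr, heq, Nat.sub_self]; rfl
      rw [hra, hra]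
    · rw [reflect, if_neg (by omega)]
      convert h3 using 2
      omega
  · obtain ⟨h1, h2, h3, h4⟩ := h.flip.iterate_up (phi a + d - eps a) a (by omega)
    have hr : reflect rel eps phi d a = (up fun a b => rel b a)^[phi a + d - eps a] a := if_neg hle
    rw [← hr] at h1 h2 h3 h4
    refine ⟨by omega, by omega, ?_, fun P hP => h4 P fun x y hxy hy _ _ => ?_⟩
    · rw [reflect, if_pos (by omega)]
      convert h3 using 2
      omega
    · have := h.phi_eq hxy
      have := h.eps_eq hxy
      exact (hP y x hxy (by omega)).symm

end IsString

end Strings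

/-! ### Combining identities for separate blocks. -/

section Blocks

/-- A product formula that holds in each of several commuting directions holds for all of them. -/
theorem sum_prod_eq_sum_prod {ι κ β R : Type*} [Fintype ι] [DecidableEq ι] [CommRing R]
    (B : Finset β) (τ : ι → β → κ) (u v : ι → κ → R)
    (h : ∀ k, ∀ b₀ ∈ B, ∀ C : Finset β, (∀ b, b ∈ C ↔ b ∈ B ∧ ∀ k', k' ≠ k → τ k' b = τ k' b₀) →
      ∑ b ∈ C, u k (τ k b) = ∑ b ∈ C, v k (τ k b)) :
    ∑ b ∈ B, ∏ k, u k (τ k b) = ∑ b ∈ B, ∏ k, v k (τ k b) := by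
  classical
  -- The factors are exchanged one direction at a time.
  suffices hK : ∀ K : Finset ι, ∑ b ∈ B, ∏ k, u k (τ k b) =
      ∑ b ∈ B, ∏ k, if k ∈ K then v k (τ k b) else u k (τ k b) by
    simpa using hK Finset.univ
  intro K
  induction K using Finset.induction_on with
  | empty => simp
  | insert k K hk ih =>
    rw [ih]
    set G : (ι → κ) → R :=
      fun c => ∏ k' ∈ Finset.univ.erase k, if k' ∈ K then v k' (c k') else u k' (c k') with hG
    have h1 : ∀ b, (∏ k', if k' ∈ K then v k' (τ k' b) else u k' (τ k' b)) =
        u k (τ k b) * G fun k' => τ k' b := by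
      intro b
      rw [← Finset.mul_prod_erase _ _ (Finset.mem_univ k), if_neg hk]
    have h2 : ∀ b, (∏ k', if k' ∈ insert k K then v k' (τ k' b) else u k' (τ k' b)) =
        v k (τ k b) * G fun k' => τ k' b := by
      intro b
      rw [← Finset.mul_prod_erase _ _ (Finset.mem_univ k), if_pos (Finset.mem_insert_self k K)]
      congr 1
      refine Finset.prod_congr rfl fun k' hk' => ?_
      simp only [Finset.mem_insert, (Finset.mem_erase.mp hk').1, false_or]
    simp only [h1, h2]
    -- On a fibre of `π` all statistics except the `k`-th are fixed, so `G` factors out and the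
    -- hypothesis applies to the fibre.
    set π : β → ({k' // k' ≠ k} → κ) := fun b k' => τ k' b with hπ
    rw [← Finset.sum_fiberwise_of_maps_to (g := π) (t := B.image π)
        (fun b hb => Finset.mem_image_of_mem π hb) fun b => u k (τ k b) * _,
      ← Finset.sum_fiberwise_of_maps_to (g := π) (t := B.image π)
        (fun b hb => Finset.mem_image_of_mem π hb) fun b => v k (τ k b) * _]
    refine Finset.sum_congr rfl fun c hc => ?_
    obtain ⟨b₀, hb₀, rfl⟩ := Finset.mem_image.mp hc
    have hfib : ∀ b, π b = π b₀ ↔ ∀ k', k' ≠ k → τ k' b = τ k' b₀ := by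
      intro b
      simp [hπ, funext_iff]
    have hGc : ∀ b ∈ B.filter fun b => π b = π b₀, (G fun k' => τ k' b) = G fun k' => τ k' b₀ := by
      intro b hb
      have hb := (hfib b).mp (Finset.mem_filter.mp hb).2
      refine Finset.prod_congr rfl fun k' hk' => ?_
      simp only [hb k' (Finset.mem_erase.mp hk').1]
    have hfac : ∀ w : κ → R, (∑ b ∈ B with π b = π b₀, w (τ k b) * G fun k' => τ k' b) =
        (∑ b ∈ B with π b = π b₀, w (τ k b)) * G fun k' => τ k' b₀ := by
      intro w
      rw [Finset.sum_mul]
      exact Finset.sum_congr rfl fun b hb => by rw [hGc b hb]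
    rw [hfac, hfac, h k b₀ hb₀ _ fun b => by rw [Finset.mem_filter, hfib]]

end Blocks

/-! ### First and last maxima of finite sequences. -/

section Extrema

theorem exists_last_max (f : ℕ → ℤ) {n : ℕ} (hn : 0 < n) :
    ∃ c < n, (∀ c' < n, f c' ≤ f c) ∧ ∀ c' < n, c < c' → f c' < f c := by
  induction n with
  | zero => omega
  | succ n ih =>
    rcases n.eq_zero_or_pos with rfl | hn'
    · refine ⟨0, one_pos, fun c' hc' => ?_, fun c' hc' h => by omega⟩
      rw [Nat.lt_one_iff.mp hc']
    · obtain ⟨c, hc, h1, h2⟩ := ih hn'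
      by_cases h : f c ≤ f n
      · refine ⟨n, n.lt_succ_self, fun c' hc' => ?_, fun c' hc' h => by omega⟩
        rcases (Nat.lt_succ_iff.mp hc').lt_or_eq with h' | rfl
        · exact (h1 c' h').trans h
        · exact le_rfl
      · refine ⟨c, by omega, fun c' hc' => ?_, fun c' hc' hcc => ?_⟩ <;>
          rcases (Nat.lt_succ_iff.mp hc').lt_or_eq with h' | rfl
        · exact h1 c' h'
        · omega
        · exact h2 c' h' hcc
        · omega

theorem exists_first_max (f : ℕ → ℤ) {n : ℕ} (hn : 0 < n) :
    ∃ c < n, (∀ c' < n, f c' ≤ f c) ∧ ∀ c' < c, f c' < f c := by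
  induction n with
  | zero => omega
  | succ n ih =>
    rcases n.eq_zero_or_pos with rfl | hn'
    · refine ⟨0, one_pos, fun c' hc' => ?_, fun c' hc' => by omega⟩
      rw [Nat.lt_one_iff.mp hc']
    · obtain ⟨c, hc, h1, h2⟩ := ih hn'
      by_cases h : f c < f n
      · refine ⟨n, n.lt_succ_self, fun c' hc' => ?_, fun c' hc' => (h1 c' hc').trans_lt h⟩
        rcases (Nat.lt_succ_iff.mp hc').lt_or_eq with h' | rfl
        · exact ((h1 c' h').trans_lt h).le
        · exact le_rfl
      · refine ⟨c, by omega, fun c' hc' => ?_, h2⟩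
        rcases (Nat.lt_succ_iff.mp hc').lt_or_eq with h' | rfl
        · exact h1 c' h'
        · omega

end Extrema

/-! ### Crystal operators on arrays in terms of column heights. -/

section Crystal

/-- The sum of the first `c` entries of the row `i`. -/
def pre (A : ℕ → ℕ → ℕ) (i c : ℕ) : ℤ := ∑ b ∈ Finset.range c, (A i b : ℤ)

/-- The number of letters `i` in the columns `≤ c` minus the number of letters `i + 1` in the
columns `< c`. -/
def height (A : ℕ → ℕ → ℕ) (i c : ℕ) : ℤ := pre A i (c + 1) - pre A (i + 1) c

/-- The number of letters `i` minus the number of letters `i + 1`. -/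
def excess (n : ℕ) (A : ℕ → ℕ → ℕ) (i : ℕ) : ℤ := pre A i n - pre A (i + 1) n

/-- One is moved from the entry `(i + 1, c)` to the entry `(i, c)`. -/
def raiseAt (i c : ℕ) (A : ℕ → ℕ → ℕ) : ℕ → ℕ → ℕ := fun p q =>
  if p = i + 1 ∧ q = c then A p q - 1 else if p = i ∧ q = c then A p q + 1 else A p q

/-- One is moved from the entry `(i, c)` to the entry `(i + 1, c)`. -/
def lowerAt (i c : ℕ) (A : ℕ → ℕ → ℕ) : ℕ → ℕ → ℕ := fun p q =>
  if p = i ∧ q = c then A p q - 1 else if p = i + 1 ∧ q = c then A p q + 1 else A p q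

/-- `B` is obtained from `A` by the row raising operator. -/
def Raise (n i : ℕ) (A B : ℕ → ℕ → ℕ) : Prop :=
  ∃ c < n, (∀ c' < n, height A i c' ≤ height A i c) ∧
    (∀ c' < n, c < c' → height A i c' < height A i c) ∧ excess n A i < height A i c ∧
    B = raiseAt i c A

/-- The number of unmatched closing brackets. -/
def phi (n i : ℕ) (A : ℕ → ℕ → ℕ) : ℕ := (Finset.range n).sup fun c => (height A i c).toNat

/-- The number of unmatched opening brackets. -/
def eps (n i : ℕ) (A : ℕ → ℕ → ℕ) : ℕ := (phi n i A - excess n A i).toNat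

theorem pre_succ (A : ℕ → ℕ → ℕ) (i c : ℕ) : pre A i (c + 1) = pre A i c + A i c := by
  rw [pre, pre, Finset.sum_range_succ]

theorem pre_zero (A : ℕ → ℕ → ℕ) (i : ℕ) : pre A i 0 = 0 := by simp [pre]

theorem pre_congr {A B : ℕ → ℕ → ℕ} {i : ℕ} (h : ∀ b, A i b = B i b) (c : ℕ) :
    pre A i c = pre B i c := by
  simp [pre, h]

theorem height_zero (A : ℕ → ℕ → ℕ) (i : ℕ) : height A i 0 = A i 0 := by
  simp [height, pre]

theorem height_succ (A : ℕ → ℕ → ℕ) (i c : ℕ) :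
    height A i (c + 1) = height A i c + A i (c + 1) - A (i + 1) c := by
  rw [height, height, pre_succ A i (c + 1), pre_succ A (i + 1) c]
  ring

theorem excess_succ (A : ℕ → ℕ → ℕ) (i c : ℕ) :
    excess (c + 1) A i = height A i c - A (i + 1) c := by
  rw [height, excess, pre_succ A (i + 1) c]
  ring

theorem phi_le_iff {n i : ℕ} {A : ℕ → ℕ → ℕ} {k : ℕ} :
    phi n i A ≤ k ↔ ∀ c < n, height A i c ≤ k := by
  simp [phi, Finset.sup_le_iff, Int.toNat_le]

/-- In each column the closing brackets `i` precede the opening brackets `i + 1`, so the surplus of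
closing over opening brackets peaks at the heights. The truncation in `phi` is harmless: the height
at column `0` is nonnegative. -/
theorem phi_eq_height {n i c : ℕ} {A : ℕ → ℕ → ℕ} (hc : c < n)
    (hmax : ∀ c' < n, height A i c' ≤ height A i c) : (phi n i A : ℤ) = height A i c := by
  have h0 : 0 ≤ height A i c := by
    have := hmax 0 (by omega)
    rw [height_zero] at this
    omega
  apply le_antisymm
  · have : phi n i A ≤ (height A i c).toNat := phi_le_iff.mpr fun c' hc' => by
      have := hmax c' hc'
      omega
    omega
  · exact phi_le_iff.mp le_rfl c hc

theorem excess_le_phi (n i : ℕ) (A : ℕ → ℕ → ℕ) : excess n A i ≤ phi n i A := by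
  cases n with
  | zero => simp [excess, pre]
  | succ n =>
    have := phi_le_iff.mp (le_refl (phi (n + 1) i A)) n n.lt_succ_self
    rw [excess_succ]
    omega

/-- Matching removes equally many brackets of both kinds, so `phi - eps` is the total surplus;
`excess_le_phi` shows that nothing is truncated. -/
theorem eps_cast (n i : ℕ) (A : ℕ → ℕ → ℕ) : (eps n i A : ℤ) = phi n i A - excess n A i := by
  have := excess_le_phi n i A
  rw [eps]
  omega

/-- The drop after the column `c`, to the next height or to the excess, can only come from letters
`i + 1` in that column. -/
theorem pos_of_last_max {n i c : ℕ} {A : ℕ → ℕ → ℕ} (hc : c < n)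
    (hlast : ∀ c' < n, c < c' → height A i c' < height A i c)
    (hex : excess n A i < height A i c) : 0 < A (i + 1) c := by
  rcases (Nat.succ_le_of_lt hc).eq_or_lt with h | h
  · subst h
    rw [Nat.succ_eq_add_one, excess_succ] at hex
    omega
  · have := hlast (c + 1) h c.lt_succ_self
    rw [height_succ] at this
    omega

theorem pos_of_first_max {i c : ℕ} {A : ℕ → ℕ → ℕ}
    (hfirst : ∀ c' < c, height A i c' < height A i c) (hpos : 0 < height A i c) :
    0 < A i c := by
  cases c with
  | zero =>
    rw [height_zero] at hpos
    omega
  | succ c =>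
    have := hfirst c c.lt_succ_self
    rw [height_succ] at this
    omega

theorem raiseAt_of_ne_row {i c p : ℕ} (A : ℕ → ℕ → ℕ) (h1 : p ≠ i) (h2 : p ≠ i + 1) (q : ℕ) :
    raiseAt i c A p q = A p q := by
  simp [raiseAt, h1, h2]

theorem raiseAt_of_ne_col {i c q : ℕ} (A : ℕ → ℕ → ℕ) (h : q ≠ c) (p : ℕ) :
    raiseAt i c A p q = A p q := by
  simp [raiseAt, h]

theorem raiseAt_low (i c : ℕ) (A : ℕ → ℕ → ℕ) : raiseAt i c A i c = A i c + 1 := by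
  simp [raiseAt]

theorem raiseAt_high (i c : ℕ) (A : ℕ → ℕ → ℕ) : raiseAt i c A (i + 1) c = A (i + 1) c - 1 := by
  simp [raiseAt]

theorem lowerAt_raiseAt {i c : ℕ} {A : ℕ → ℕ → ℕ} (h : 0 < A (i + 1) c) :
    lowerAt i c (raiseAt i c A) = A := by
  funext p q
  unfold lowerAt raiseAt
  grind

theorem raiseAt_lowerAt {i c : ℕ} {A : ℕ → ℕ → ℕ} (h : 0 < A i c) :
    raiseAt i c (lowerAt i c A) = A := by
  funext p q
  unfold lowerAt raiseAt
  grind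

theorem pre_raiseAt_low (i c : ℕ) (A : ℕ → ℕ → ℕ) (k : ℕ) :
    pre (raiseAt i c A) i k = pre A i k + if c < k then 1 else 0 := by
  induction k with
  | zero => simp [pre]
  | succ k ih =>
    rw [pre_succ, pre_succ, ih]
    rcases eq_or_ne k c with rfl | h
    · rw [raiseAt_low]
      simp
      ring
    · rw [raiseAt_of_ne_col A h]
      split_ifs <;> omega

theorem pre_raiseAt_high {i c : ℕ} {A : ℕ → ℕ → ℕ} (hpos : 0 < A (i + 1) c) (k : ℕ) :
    pre (raiseAt i c A) (i + 1) k = pre A (i + 1) k - if c < k then 1 else 0 := by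
  induction k with
  | zero => simp [pre]
  | succ k ih =>
    rw [pre_succ, pre_succ, ih]
    rcases eq_or_ne k c with rfl | h
    · rw [raiseAt_high]
      simp
      omega
    · rw [raiseAt_of_ne_col A h]
      split_ifs <;> omega

theorem pre_raiseAt_of_ne {i c p : ℕ} (A : ℕ → ℕ → ℕ) (h1 : p ≠ i) (h2 : p ≠ i + 1) (k : ℕ) :
    pre (raiseAt i c A) p k = pre A p k :=
  pre_congr (raiseAt_of_ne_row A h1 h2) k

/-- Heights left of `c` stay, the one at `c` grows by one, those to the right by two. This turns a
last maximum at `c` into a first maximum at `c`, which makes raising invertible. -/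
theorem height_raiseAt {i c : ℕ} {A : ℕ → ℕ → ℕ} (hpos : 0 < A (i + 1) c) (k : ℕ) :
    height (raiseAt i c A) i k =
      height A i k + (if c ≤ k then 1 else 0) + if c < k then 1 else 0 := by
  rw [height, height, pre_raiseAt_low, pre_raiseAt_high hpos]
  split_ifs <;> omega

theorem excess_raiseAt {n i c : ℕ} {A : ℕ → ℕ → ℕ} (hc : c < n) (hpos : 0 < A (i + 1) c) :
    excess n (raiseAt i c A) i = excess n A i + 2 := by
  rw [excess, excess, pre_raiseAt_low, pre_raiseAt_high hpos, if_pos hc]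
  ring

/-- The raising operator in terms of its result. -/
theorem raise_iff {n i : ℕ} {A B : ℕ → ℕ → ℕ} :
    Raise n i A B ↔ ∃ c < n, (∀ c' < n, height B i c' ≤ height B i c) ∧
      (∀ c' < c, height B i c' < height B i c) ∧ 0 < height B i c ∧ A = lowerAt i c B := by
  constructor
  · rintro ⟨c, hc, hmax, hlast, hex, rfl⟩
    have hpos := pos_of_last_max hc hlast hex
    have h0 : (0 : ℤ) ≤ height A i c := by
      have := phi_eq_height hc hmax
      omega
    refine ⟨c, hc, fun c' hc' => ?_, fun c' hc' => ?_, ?_, (lowerAt_raiseAt hpos).symm⟩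
    · rw [height_raiseAt hpos, height_raiseAt hpos]
      have h1 := hmax c' hc'
      have h2 := hlast c' hc'
      split_ifs <;> omega
    · rw [height_raiseAt hpos, height_raiseAt hpos]
      have h1 := hmax c' (by omega)
      split_ifs <;> omega
    · rw [height_raiseAt hpos]
      split_ifs <;> omega
  · rintro ⟨c, hc, hmax, hfirst, hpos, rfl⟩
    have hB := pos_of_first_max hfirst hpos
    set A := lowerAt i c B with hA
    have hBA : B = raiseAt i c A := (raiseAt_lowerAt hB).symm
    have hA1 : 0 < A (i + 1) c := by simp [hA, lowerAt]
    have hex := excess_le_phi n i B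
    rw [phi_eq_height hc hmax, hBA, excess_raiseAt hc hA1, height_raiseAt hA1] at hex
    refine ⟨c, hc, fun c' hc' => ?_, fun c' hc' hcc => ?_, ?_, hBA⟩
    · have h1 := hmax c' hc'
      have h2 := hfirst c'
      rw [hBA, height_raiseAt hA1, height_raiseAt hA1] at h1 h2
      split_ifs at h1 h2 <;> omega
    · have h1 := hmax c' hc'
      rw [hBA, height_raiseAt hA1, height_raiseAt hA1] at h1
      split_ifs at h1 <;> omega
    · split_ifs at hex <;> omega

/-- A raising increases the maximal height by one and the excess by two, hence lowers `eps` by one.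
Uniqueness in both directions is that of the last and of the first maximum. -/
theorem isString_raise (n i : ℕ) : IsString (Raise n i) (eps n i) (phi n i) := by
  have hphi : ∀ {A B}, Raise n i A B → phi n i B = phi n i A + 1 ∧
      excess n B i = excess n A i + 2 := by
    intro A B h
    obtain ⟨c, hc, hmax, hlast, hex, rfl⟩ := id h
    have hpos := pos_of_last_max hc hlast hex
    refine ⟨?_, excess_raiseAt hc hpos⟩
    have h1 := phi_eq_height hc hmax
    have h2 : (phi n i (raiseAt i c A) : ℤ) = height (raiseAt i c A) i c := by
      refine phi_eq_height hc fun c' hc' => ?_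
      rw [height_raiseAt hpos, height_raiseAt hpos]
      have h1 := hmax c' hc'
      have h2 := hlast c' hc'
      split_ifs <;> omega
    rw [height_raiseAt hpos] at h2
    split_ifs at h2 <;> omega
  refine ⟨fun {A B} h => ?_, fun h => (hphi h).1, fun {A} h => ?_, fun {B} h => ?_, ?_, ?_⟩
  · have h1 := eps_cast n i A
    have h2 := eps_cast n i B
    have h3 := hphi h
    omega
  · have h1 := eps_cast n i A
    have hn : 0 < n := by
      rcases n.eq_zero_or_pos with rfl | hn
      · simp [phi, excess, pre] at h1
        omega
      · exact hn
    obtain ⟨c, hc, hmax, hlast⟩ := exists_last_max (height A i) hn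
    refine ⟨_, c, hc, hmax, hlast, ?_, rfl⟩
    have := phi_eq_height hc hmax
    omega
  · have hn : 0 < n := by
      rcases n.eq_zero_or_pos with rfl | hn
      · simp [phi] at h
      · exact hn
    obtain ⟨c, hc, hmax, hfirst⟩ := exists_first_max (height B i) hn
    have := phi_eq_height hc hmax
    exact ⟨_, raise_iff.mpr ⟨c, hc, hmax, hfirst, by omega, rfl⟩⟩
  · rintro A B B' ⟨c, hc, hmax, hlast, -, rfl⟩ ⟨c', hc', hmax', hlast', -, rfl⟩
    have : c = c' := by
      rcases lt_trichotomy c c' with h | h | h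
      · have := hlast c' hc' h
        have := hmax' c hc
        omega
      · exact h
      · have := hlast' c hc h
        have := hmax c' hc'
        omega
    rw [this]
  · intro A A' B h h'
    obtain ⟨c, hc, hmax, hfirst, -, rfl⟩ := raise_iff.mp h
    obtain ⟨c', hc', hmax', hfirst', -, rfl⟩ := raise_iff.mp h'
    have : c = c' := by
      rcases lt_trichotomy c c' with h | h | h
      · have := hfirst' c h
        have := hmax c' hc'
        omega
      · exact h
      · have := hfirst c' h
        have := hmax' c hc
        omega
    rw [this]

end Crystal

/-! ### Row operators commute with the column structure. -/

section Commutation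

theorem pre_raiseAt {i c : ℕ} {A : ℕ → ℕ → ℕ} (hpos : 0 < A (i + 1) c) (p k : ℕ) :
    pre (raiseAt i c A) p k = pre A p k + (if p = i ∧ c < k then 1 else 0) -
      if p = i + 1 ∧ c < k then 1 else 0 := by
  rcases eq_or_ne p i with rfl | h1
  · rw [pre_raiseAt_low]
    split_ifs <;> omega
  rcases eq_or_ne p (i + 1) with rfl | h2
  · rw [pre_raiseAt_high hpos]
    split_ifs <;> omega
  rw [pre_raiseAt_of_ne A h1 h2]
  simp [h1, h2]

/-- Moving a unit between neighbouring rows of a column changes only the prefix sum that stops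
between them. -/
theorem pre_swap_raiseAt {i c : ℕ} {A : ℕ → ℕ → ℕ} (hpos : 0 < A (i + 1) c) (j k : ℕ) :
    pre (Function.swap (raiseAt i c A)) j k =
      pre (Function.swap A) j k + if j = c ∧ k = i + 1 then 1 else 0 := by
  induction k with
  | zero => simp [pre]
  | succ k ih =>
    rw [pre_succ, pre_succ, ih, Function.swap, Function.swap]
    rcases eq_or_ne j c with rfl | h
    · rcases eq_or_ne k i with rfl | h1
      · rw [raiseAt_low]
        simp
        ring
      rcases eq_or_ne k (i + 1) with rfl | h2
      · rw [raiseAt_high]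
        simp
        omega
      · rw [raiseAt_of_ne_row A h1 h2]
        split_ifs <;> omega
    · rw [raiseAt_of_ne_col A h]
      simp [h]

theorem Raise.pre_of_ne {n i p : ℕ} {A B : ℕ → ℕ → ℕ} (h : Raise n i A B) (h1 : p ≠ i)
    (h2 : p ≠ i + 1) (k : ℕ) : pre B p k = pre A p k := by
  obtain ⟨c, -, -, -, -, rfl⟩ := h
  exact pre_raiseAt_of_ne A h1 h2 k

theorem Raise.pre_low {n i : ℕ} {A B : ℕ → ℕ → ℕ} (h : Raise n i A B) :
    pre B i n = pre A i n + 1 := by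
  obtain ⟨c, hc, -, -, -, rfl⟩ := h
  rw [pre_raiseAt_low, if_pos hc]

theorem Raise.pre_high {n i : ℕ} {A B : ℕ → ℕ → ℕ} (h : Raise n i A B) :
    pre B (i + 1) n = pre A (i + 1) n - 1 := by
  obtain ⟨c, hc, -, hlast, hex, rfl⟩ := h
  rw [pre_raiseAt_high (pos_of_last_max hc hlast hex), if_pos hc]

/-- The row raising operators preserve the column sums. -/
theorem Raise.pre_swap {m n i : ℕ} {A B : ℕ → ℕ → ℕ} (h : Raise n i A B) (hi : i + 1 < m)
    (j : ℕ) : pre (Function.swap B) j m = pre (Function.swap A) j m := by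
  obtain ⟨c, hc, -, hlast, hex, rfl⟩ := h
  rw [pre_swap_raiseAt (pos_of_last_max hc hlast hex), if_neg (by omega), add_zero]

/-- The row raising operators commute with the column structure: all bounds for the column heights
are preserved. -/
theorem Raise.height_swap_le_iff {m n i j : ℕ} {A B : ℕ → ℕ → ℕ} (h : Raise n i A B)
    (hi : i + 1 < m) (hj : j + 1 < n) (K : ℤ) :
    (∀ a < m, height (Function.swap A) j a ≤ K) ↔ ∀ a < m, height (Function.swap B) j a ≤ K := by
  obtain ⟨c', -, -, hfirst', -, hB⟩ := raise_iff.mp h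
  obtain ⟨c, hc, -, hlast, hex, rfl⟩ := h
  have hpos := pos_of_last_max hc hlast hex
  -- Only the column `c` gains a letter `i`, so lowering must undo the change in that same column.
  have hcc : c' = c := by
    by_contra hne
    have h1 : raiseAt i c A i c = A i c + 1 := raiseAt_low i c A
    have h2 := congrFun (congrFun hB i) c
    rw [lowerAt, if_neg (by omega), if_neg (by omega)] at h2
    omega
  subst hcc
  have hh : ∀ a, height (Function.swap (raiseAt i c' A)) j a = height (Function.swap A) j a +
      (if j = c' ∧ a = i then 1 else 0) - if j + 1 = c' ∧ a = i + 1 then 1 else 0 := by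
    intro a
    rw [height, height, pre_swap_raiseAt hpos, pre_swap_raiseAt hpos]
    split_ifs <;> omega
  constructor
  · intro hA a ha
    rw [hh]
    have h1 := hA a ha
    by_cases hcase : j = c' ∧ a = i
    · obtain ⟨rfl, rfl⟩ := hcase
      -- The strict drop of the row height after `j` says `A a (j + 1) < A (a + 1) j`. So the column
      -- height rises from `a` to `a + 1`, and the bound at `a + 1` leaves room for one more at `a`.
      have h2 := hlast (j + 1) hj j.lt_succ_self
      have h3 := hA (a + 1) hi
      rw [height_succ] at h2 h3
      simp only [Function.swap] at h3
      split_ifs <;> omega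
    · split_ifs <;> omega
  · intro hA a ha
    have h1 := hA a ha
    rw [hh] at h1
    by_cases hcase : j + 1 = c' ∧ a = i + 1
    · obtain ⟨rfl, rfl⟩ := hcase
      -- The mirror argument: `c'` is a first maximum of the raised array, so its column height
      -- drops strictly from `i` to `i + 1`.
      have h2 := hfirst' j j.lt_succ_self
      have h3 := hA i (by omega)
      rw [hh] at h3
      rw [height_succ] at h2 ⊢
      rw [raiseAt_low, raiseAt_of_ne_col A (by omega : j ≠ j + 1)] at h2
      simp only [Function.swap]
      split_ifs at h3 <;> omega
    · split_ifs at h1 <;> omega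

end Commutation

/-! ### The cancelling involution for one block of rows. -/

section OneBlock

/-- The condition that all raising operators inside the block of rows `a ≤ p < a + l` vanish. -/
def IsHighest (n a l : ℕ) (A : ℕ → ℕ → ℕ) : Prop :=
  ∀ i, i + 1 < l → ∀ c < n, height A (a + i) c ≤ excess n A (a + i)

/-- The row sums in the block of rows `a ≤ p < a + l`. -/
def rowSums (n a l : ℕ) (A : ℕ → ℕ → ℕ) : Fin l → ℕ := fun p =>
  ∑ q ∈ Finset.range n, A (a + p) q

theorem cast_rowSums (n a l : ℕ) (A : ℕ → ℕ → ℕ) (p : Fin l) :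
    (rowSums n a l A p : ℤ) = pre A (a + p) n := by
  simp [rowSums, pre]

/-- The reflection in the `i`-string, shifted by `d`. -/
noncomputable def rowReflect (n i d : ℕ) (A : ℕ → ℕ → ℕ) : ℕ → ℕ → ℕ :=
  IsString.reflect (Raise n i) (eps n i) (phi n i) d A

theorem rowReflect_rowReflect {n i d : ℕ} {A : ℕ → ℕ → ℕ} (hd : d ≤ eps n i A) :
    rowReflect n i d (rowReflect n i d A) = A :=
  ((isString_raise n i).reflect_spec d hd).2.2.1

theorem rowReflect_iff {n i d : ℕ} {A : ℕ → ℕ → ℕ} (hd : d ≤ eps n i A)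
    (P : (ℕ → ℕ → ℕ) → Prop) (hP : ∀ A B, Raise n i A B → d ≤ eps n i B → (P A ↔ P B)) :
    P A ↔ P (rowReflect n i d A) :=
  ((isString_raise n i).reflect_spec d hd).2.2.2 P hP

/-- Along a string the `i`-th row sum plus `eps` and the next row sum minus `eps` are constant,
while the reflection prescribes the new `eps`. -/
theorem rowSums_rowReflect {n a l d : ℕ} {A : ℕ → ℕ → ℕ} {i j : Fin l} (hij : (j : ℕ) = i + 1)
    (hd : d ≤ eps n (a + i) A) (p : Fin l) :
    (rowSums n a l (rowReflect n (a + i) d A) p : ℤ) =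
      rowSums n a l A (Equiv.swap i j p) - (if p = i then d else 0) + if p = j then d else 0 := by
  have hne : i ≠ j := fun h => by rw [h] at hij; omega
  obtain ⟨h1, h2, -, hinv⟩ := (isString_raise n (a + i)).reflect_spec d hd
  have he := eps_cast n (a + i) A
  rw [excess] at he
  have hj : a + (j : ℕ) = a + i + 1 := by omega
  simp only [cast_rowSums]
  rcases eq_or_ne p i with rfl | hpi
  · have := (hinv (fun B => pre B (a + p) n + eps n (a + p) B = pre A (a + p) n + eps n (a + p) A)
      fun B C h _ => by
        have h3 := h.pre_low
        have h4 := (isString_raise n (a + p)).eps_eq h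
        rw [h3, h4]
        push_cast
        ring_nf).mp rfl
    rw [if_pos rfl, if_neg hne, Equiv.swap_apply_left, hj, rowReflect]
    omega
  rcases eq_or_ne p j with rfl | hpj
  · have := (hinv (fun B => pre B (a + i + 1) n - eps n (a + i) B =
      pre A (a + i + 1) n - eps n (a + i) A)
      fun B C h _ => by
        have h3 := h.pre_high
        have h4 := (isString_raise n (a + i)).eps_eq h
        rw [h3, h4]
        push_cast
        ring_nf).mp rfl
    rw [if_pos rfl, if_neg hpi, Equiv.swap_apply_right, hj, rowReflect]
    omega
  · have hpi' : (p : ℕ) ≠ i := fun h => hpi (Fin.ext h)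
    have hpj' : (p : ℕ) ≠ j := fun h => hpj (Fin.ext h)
    rw [Equiv.swap_apply_of_ne_of_ne hpi hpj, if_neg hpi, if_neg hpj, Nat.cast_zero,
      sub_zero, add_zero]
    exact (hinv (fun B => pre B (a + p) n = pre A (a + p) n) fun B C h _ => by
      rw [h.pre_of_ne (by omega) (by omega)]).mp rfl

/-- The pair `(c, i)` is the first violation of the highest weight condition, when the row word is
read from the right. -/
def IsFirstViolation (n a l : ℕ) (A : ℕ → ℕ → ℕ) (c i : ℕ) : Prop :=
  (i + 1 < l ∧ c < n ∧ excess n A (a + i) < height A (a + i) c) ∧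
    ∀ c' i', i' + 1 < l → c' < n → excess n A (a + i') < height A (a + i') c' →
      c' < c ∨ c' = c ∧ i' ≤ i

theorem IsFirstViolation.unique {n a l c i c' i' : ℕ} {A : ℕ → ℕ → ℕ}
    (h : IsFirstViolation n a l A c i) (h' : IsFirstViolation n a l A c' i') :
    c = c' ∧ i = i' := by
  have h1 := h.2 c' i' h'.1.1 h'.1.2.1 h'.1.2.2
  have h2 := h'.2 c i h.1.1 h.1.2.1 h.1.2.2
  omega

theorem exists_isFirstViolation {n a l : ℕ} {A : ℕ → ℕ → ℕ} (h : ¬IsHighest n a l A) :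
    ∃ c i, IsFirstViolation n a l A c i := by
  classical
  simp only [IsHighest, not_forall, not_le] at h
  obtain ⟨i, hi, c, hc, hv⟩ := h
  set S := (Finset.range n ×ˢ Finset.range l).filter fun x =>
    x.2 + 1 < l ∧ excess n A (a + x.2) < height A (a + x.2) x.1 with hS
  have hmem : ∀ c i, i + 1 < l → c < n → excess n A (a + i) < height A (a + i) c → (c, i) ∈ S := by
    intro c i h1 h2 h3
    simp only [hS, Finset.mem_filter, Finset.mem_product, Finset.mem_range]
    exact ⟨⟨h2, by omega⟩, h1, h3⟩
  -- First from the right means lexicographically largest: the column is compared before the row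
  -- index.
  obtain ⟨x, hx, hmax⟩ := S.exists_max_image (fun x => toLex x) ⟨_, hmem c i hi hc hv⟩
  have hx' := hx
  simp only [hS, Finset.mem_filter, Finset.mem_product, Finset.mem_range] at hx'
  refine ⟨x.1, x.2, ⟨hx'.2.1, hx'.1.1, hx'.2.2⟩, fun c' i' h1 h2 h3 => ?_⟩
  have := hmax _ (hmem c' i' h1 h2 h3)
  rwa [Prod.Lex.toLex_le_toLex] at this

theorem IsFirstViolation.pos {n a l c i : ℕ} {A : ℕ → ℕ → ℕ}
    (h : IsFirstViolation n a l A c i) : 1 ≤ eps n (a + i) A := by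
  have h1 := phi_le_iff.mp (le_refl (phi n (a + i) A)) c h.1.2.1
  have h2 := eps_cast n (a + i) A
  have h3 := h.1.2.2
  omega

/-- The raising acts in some column `x`. Whether `(c', i')` is a violation is unaffected if `x <
c'`, or if `x = c'` and `i < i'`; and `(x, i)` stays a violation, because a further raising is
possible. So the first violation, which is not before `(x, i)` in the order, survives. This makes
the reflection there an involution. -/
theorem Raise.isFirstViolation_iff {n a l c i : ℕ} {A B : ℕ → ℕ → ℕ} (h : Raise n (a + i) A B)
    (hB : 1 ≤ eps n (a + i) B) : IsFirstViolation n a l A c i ↔ IsFirstViolation n a l B c i := by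
  have heps := (isString_raise n (a + i)).eps_eq h
  obtain ⟨x, hx, hmax, hlast, hex, rfl⟩ := h
  have hpos := pos_of_last_max hx hlast hex
  have hphi := phi_eq_height hx hmax
  have hA := eps_cast n (a + i) A
  have hlater : ∀ c' i', x < c' ∨ x = c' ∧ i < i' →
      (excess n (raiseAt (a + i) x A) (a + i') < height (raiseAt (a + i) x A) (a + i') c' ↔
        excess n A (a + i') < height A (a + i') c') := by
    intro c' i' hlt
    simp only [excess, height, pre_raiseAt hpos]
    split_ifs <;> omega
  have hat : ∀ c', (c' ≤ x →
      height (raiseAt (a + i) x A) (a + i) c' - excess n (raiseAt (a + i) x A) (a + i) ≤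
        height A (a + i) c' - excess n A (a + i) - 1) ∧ (c' = x →
      height (raiseAt (a + i) x A) (a + i) c' - excess n (raiseAt (a + i) x A) (a + i) =
        height A (a + i) c' - excess n A (a + i) - 1) := by
    intro c'
    rw [height_raiseAt hpos, excess_raiseAt hx hpos]
    constructor
    · intro hc'
      split_ifs <;> omega
    · rintro rfl
      split_ifs <;> omega
  have hatx := (hat x).2 rfl
  constructor
  · rintro ⟨⟨h1, h2, h3⟩, h4⟩
    have hxc : x ≤ c := by
      have := h4 x i h1 hx hex
      omega
    refine ⟨⟨h1, h2, ?_⟩, fun c' i' h1' h2' h3' => ?_⟩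
    · rcases hxc.lt_or_eq with hlt | rfl
      · exact (hlater c i (Or.inl hlt)).mpr h3
      · omega
    · by_contra hcon
      exact hcon (h4 c' i' h1' h2' ((hlater c' i' (by omega)).mp h3'))
  · rintro ⟨⟨h1, h2, h3⟩, h4⟩
    have hxc : x ≤ c := by
      have := h4 x i h1 hx (by omega)
      omega
    refine ⟨⟨h1, h2, ?_⟩, fun c' i' h1' h2' h3' => ?_⟩
    · rcases hxc.lt_or_eq with hlt | rfl
      · exact (hlater c i (Or.inl hlt)).mp h3
      · omega
    · by_contra hcon
      exact hcon (h4 c' i' h1' h2' ((hlater c' i' (by omega)).mpr h3'))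

open Classical in
/-- The alternating character of a finite set of matrices that is closed under the row operators
of a block. -/
theorem alternant_staircase_mul_sum_rowSums (n a l : ℕ) (F : Finset (ℕ → ℕ → ℕ))
    (hF : ∀ i, i + 1 < l → ∀ A B, Raise n (a + i) A B → (A ∈ F ↔ B ∈ F)) :
    alternant (staircase l) * ∑ A ∈ F, xMonomial (rowSums n a l A) =
      ∑ A ∈ F with IsHighest n a l A, alternant (rowSums n a l A + staircase l) := by
  refine alternant_staircase_mul_sum F (rowSums n a l) (IsHighest n a l) ?_ ?_
  · intro i j hij
    refine ⟨rowReflect n (a + i) 0, fun A hA => ⟨?_, rowReflect_rowReflect (Nat.zero_le _), ?_⟩⟩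
    · exact (rowReflect_iff (Nat.zero_le _) (· ∈ F)
        fun B C h _ => hF i (by omega) B C h).mp hA
    · funext p
      have := rowSums_rowReflect (n := n) (a := a) (A := A) hij (Nat.zero_le _) p
      simpa using this
  -- The involution reflects, with shift one, in the string indexed by the first violation.
  · let t : (ℕ → ℕ → ℕ) → ℕ → ℕ → ℕ := fun A =>
      if h : ∃ x : ℕ × ℕ, IsFirstViolation n a l A x.1 x.2 then
        rowReflect n (a + h.choose.2) 1 A else A
    have ht : ∀ A c i, IsFirstViolation n a l A c i → t A = rowReflect n (a + i) 1 A := by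
      intro A c i h
      have hex : ∃ x : ℕ × ℕ, IsFirstViolation n a l A x.1 x.2 := ⟨(c, i), h⟩
      have := (hex.choose_spec.unique h).2
      simp only [t, dif_pos hex, this]
    refine ⟨t, fun A hA hnot => ?_⟩
    obtain ⟨c, i, hv⟩ := exists_isFirstViolation hnot
    have hpos := hv.pos
    have hv' : IsFirstViolation n a l (t A) c i := by
      rw [ht A c i hv]
      exact (rowReflect_iff hpos (fun B => IsFirstViolation n a l B c i)
        fun B C h hC => h.isFirstViolation_iff hC).mp hv
    refine ⟨?_, ?_, ?_, ⟨i, by have := hv.1.1; omega⟩, ⟨i + 1, hv.1.1⟩, ?_, ?_⟩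
    · rw [ht A c i hv]
      exact (rowReflect_iff hpos (· ∈ F) fun B C h _ => hF i hv.1.1 B C h).mp hA
    · intro hhigh
      have h1 := hhigh i hv'.1.1 c hv'.1.2.1
      have h2 := hv'.1.2.2
      omega
    · rw [ht _ c i hv', ht A c i hv, rowReflect_rowReflect hpos]
    · simp
    · funext p
      set i' : Fin l := ⟨i, by have := hv.1.1; omega⟩ with hi'
      set j' : Fin l := ⟨i + 1, hv.1.1⟩ with hj'
      have h1 := rowSums_rowReflect (n := n) (a := a) (A := A) (i := i') (j := j') rfl hpos p
      have hne : i' ≠ j' := by simp [hi', hj']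
      -- The staircase drops by exactly the shift of the reflection, so after adding it two
      -- exponents are interchanged.
      have hs : (staircase l i' : ℕ) = staircase l j' + 1 := by
        have := hv.1.1
        simp only [staircase, hi', hj', Fin.val_rev]
        omega
      rw [ht A c i hv]
      simp only [Pi.add_apply, Function.comp_apply]
      have hi'' : a + (i' : ℕ) = a + i := rfl
      rw [hi''] at h1
      rcases eq_or_ne p i' with rfl | hpi
      · rw [Equiv.swap_apply_left, if_pos rfl, if_neg hne] at h1
        rw [Equiv.swap_apply_left]
        push_cast at h1
        omega
      rcases eq_or_ne p j' with rfl | hpj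
      · rw [Equiv.swap_apply_right, if_pos rfl, if_neg hne.symm] at h1
        rw [Equiv.swap_apply_right]
        push_cast at h1
        omega
      · rw [Equiv.swap_apply_of_ne_of_ne hpi hpj, if_neg hpi, if_neg hpj] at h1
        rw [Equiv.swap_apply_of_ne_of_ne hpi hpj]
        push_cast at h1
        omega

end OneBlock

theorem mem_iff_lt_card_filter {N : ℕ} {P : ℕ → Prop} [DecidablePred P]
    (hP : ∀ c d, c ≤ d → d < N → P d → P c) {c : ℕ} (hc : c < N) :
    P c ↔ c < ((Finset.range N).filter P).card := by
  constructor
  · intro h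
    have : Finset.range (c + 1) ⊆ (Finset.range N).filter P := by
      intro d hd
      rw [Finset.mem_range] at hd
      exact Finset.mem_filter.mpr ⟨Finset.mem_range.mpr (by omega), hP d c (by omega) hc h⟩
    have := Finset.card_le_card this
    rw [Finset.card_range] at this
    omega
  · intro h
    by_contra hn
    have : (Finset.range N).filter P ⊆ Finset.range c := by
      intro d hd
      obtain ⟨h1, h2⟩ := Finset.mem_filter.mp hd
      rw [Finset.mem_range] at h1 ⊢
      by_contra hcd
      exact hn (hP c d (by omega) h1 h2)
    have := Finset.card_le_card this
    rw [Finset.card_range] at this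
    omega

/-! ### Tableaux as matrices, and the bialternant formula. -/

section TableauMatrix

variable {μ : YoungDiagram} {l : ℕ}

/-- The number of entries `< k` in the row `q` of a tableau. -/
def rowCount (T : SemistandardYoungTableau μ) (q k : ℕ) : ℕ :=
  ((Finset.range (μ.rowLen q)).filter fun c => T q c < k).card

theorem lt_iff_lt_rowCount (T : SemistandardYoungTableau μ) {q c : ℕ} (k : ℕ)
    (hc : c < μ.rowLen q) : T q c < k ↔ c < rowCount T q k := by
  refine mem_iff_lt_card_filter (P := fun c => T q c < k) (fun c d hcd hd h => ?_) hc
  rcases hcd.eq_or_lt with rfl | hlt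
  · exact h
  · exact (T.row_weak hlt (YoungDiagram.mem_iff_lt_rowLen.mpr hd)).trans_lt h

theorem rowCount_le (T : SemistandardYoungTableau μ) (q k : ℕ) : rowCount T q k ≤ μ.rowLen q := by
  have := Finset.card_filter_le (Finset.range (μ.rowLen q)) fun c => T q c < k
  rwa [Finset.card_range] at this

/-- The matrix whose entry in the row `p` and the column `j` counts the entries `p` in the row
`l - 1 - j` of the tableau. -/
def tableauMatrix (l : ℕ) (T : SemistandardYoungTableau μ) : ℕ → ℕ → ℕ := fun p j =>
  if p < l ∧ j < l then
    ((Finset.range (μ.rowLen (l - 1 - j))).filter fun c => T (l - 1 - j) c = p).card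
  else 0

theorem pre_swap_tableauMatrix (T : SemistandardYoungTableau μ) {j k : ℕ} (hj : j < l)
    (hk : k ≤ l) : pre (Function.swap (tableauMatrix l T)) j k = rowCount T (l - 1 - j) k := by
  rw [pre, rowCount, Finset.card_eq_sum_card_fiberwise (f := fun c => T (l - 1 - j) c)
    (t := Finset.range k), Nat.cast_sum]
  · refine Finset.sum_congr rfl fun p hp => ?_
    rw [Finset.mem_range] at hp
    rw [Function.swap, tableauMatrix, if_pos ⟨by omega, hj⟩, Finset.filter_filter]
    congr 2
    ext c
    simp only [Finset.mem_filter]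
    constructor
    · rintro ⟨h1, h2⟩
      exact ⟨h1, by omega, h2⟩
    · rintro ⟨h1, -, h2⟩
      exact ⟨h1, h2⟩
  · intro c hc
    simpa using (Finset.mem_filter.mp hc).2

theorem rowSums_tableauMatrix (hμ : μ.colLen 0 ≤ l) (T : SemistandardYoungTableau μ) (p : Fin l) :
    rowSums l 0 l (tableauMatrix l T) p =
      (μ.cells.filter fun c => T c.1 c.2 = (p : ℕ)).card := by
  have hrow : ∀ c ∈ μ.cells, c.1 < l := by
    intro c hc
    have h1 : (c.1, 0) ∈ μ := μ.up_left_mem le_rfl (Nat.zero_le c.2) hc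
    exact (YoungDiagram.mem_iff_lt_colLen.mp h1).trans_le hμ
  rw [rowSums, Finset.card_eq_sum_card_fiberwise (f := Prod.fst) (t := Finset.range l),
    ← Finset.sum_range_reflect]
  · refine Finset.sum_congr rfl fun q hq => ?_
    rw [Finset.mem_range] at hq
    have hq' : l - 1 - (l - 1 - q) = q := by omega
    rw [zero_add, tableauMatrix, if_pos ⟨p.2, by omega⟩, hq']
    refine Finset.card_bij' (fun c _ => (q, c)) (fun x _ => x.2) ?_ ?_ ?_ ?_
    · intro c hc
      obtain ⟨h1, h2⟩ := Finset.mem_filter.mp hc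
      simp only [Finset.mem_filter, YoungDiagram.mem_cells, and_true]
      exact ⟨YoungDiagram.mem_iff_lt_rowLen.mpr (Finset.mem_range.mp h1), h2⟩
    · rintro ⟨q', c⟩ hx
      simp only [Finset.mem_filter, YoungDiagram.mem_cells] at hx
      obtain ⟨⟨h1, h2⟩, rfl⟩ := hx
      exact Finset.mem_filter.mpr
        ⟨Finset.mem_range.mpr (YoungDiagram.mem_iff_lt_rowLen.mp h1), h2⟩
    · intro c _
      rfl
    · rintro ⟨q', c⟩ hx
      rw [(Finset.mem_filter.mp hx).2.symm]
  · intro c hc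
    simpa using hrow c (Finset.mem_filter.mp hc).1

/-- The conditions that describe the matrices of tableaux. -/
structure IsTableauMatrix (μ : YoungDiagram) (l : ℕ) (A : ℕ → ℕ → ℕ) : Prop where
  support : ∀ p j, A p j ≠ 0 → p < l ∧ j < l
  height_le : ∀ j, j + 1 < l → ∀ a < l, height (Function.swap A) j a ≤ 0
  sum_eq : ∀ j < l, pre (Function.swap A) j l = μ.rowLen (l - 1 - j)

/-- The columns of the matrix list the rows of the tableau from bottom to top. Thus a column height
compares the entries `≤ a` of one row with the entries `< a` of the row above, and column strictness
makes it nonpositive. -/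
theorem isTableauMatrix_tableauMatrix (T : BoundedSSYT μ l) :
    IsTableauMatrix μ l (tableauMatrix l T.1) where
  support p j h := by
    by_contra hn
    exact h (if_neg hn)
  height_le j hj a ha := by
    rw [height, pre_swap_tableauMatrix T.1 (by omega) (by omega),
      pre_swap_tableauMatrix T.1 hj (by omega), sub_nonpos, Nat.cast_le]
    by_contra hcon
    set q := l - 1 - (j + 1) with hq
    have hq1 : l - 1 - j = q + 1 := by omega
    rw [hq1] at hcon
    set c := rowCount T.1 q a with hc
    have hlt : c < rowCount T.1 (q + 1) (a + 1) := by omega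
    have hc1 : c < μ.rowLen (q + 1) := hlt.trans_le (rowCount_le _ _ _)
    have hc2 : c < μ.rowLen q := hc1.trans_le (μ.rowLen_anti q (q + 1) (by omega))
    have h1 := (lt_iff_lt_rowCount T.1 (a + 1) hc1).mpr hlt
    have h2 := T.1.col_strict (Nat.lt_succ_self q) (YoungDiagram.mem_iff_lt_rowLen.mpr hc1)
    have h3 := (lt_iff_lt_rowCount T.1 a hc2).mp (by simp only [Nat.succ_eq_add_one] at h2; omega)
    omega
  sum_eq j hj := by
    rw [pre_swap_tableauMatrix T.1 hj le_rfl, rowCount, Finset.filter_true_of_mem,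
      Finset.card_range]
    intro c hc
    exact T.2 (l - 1 - j, c) (YoungDiagram.mem_iff_lt_rowLen.mpr (Finset.mem_range.mp hc))

/-- A weakly increasing row is determined by how many of its entries lie below each bound. -/
theorem tableauMatrix_injective (hμ : μ.colLen 0 ≤ l) :
    Function.Injective fun T : BoundedSSYT μ l => tableauMatrix l T.1 := by
  intro T T' h
  refine Subtype.ext (SemistandardYoungTableau.ext fun q c => ?_)
  by_cases hc : (q, c) ∈ μ
  · have hq : q < l := (YoungDiagram.mem_iff_lt_colLen.mp
      (μ.up_left_mem le_rfl (Nat.zero_le c) hc)).trans_le hμ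
    have hq' : l - 1 - (l - 1 - q) = q := by omega
    have hc' := YoungDiagram.mem_iff_lt_rowLen.mp hc
    have hcount : ∀ k ≤ l, rowCount T.1 q k = rowCount T'.1 q k := by
      intro k hk
      have h1 := pre_swap_tableauMatrix T.1 (l := l) (j := l - 1 - q) (by omega) hk
      have h2 := pre_swap_tableauMatrix T'.1 (l := l) (j := l - 1 - q) (by omega) hk
      have h : tableauMatrix l T.1 = tableauMatrix l T'.1 := h
      rw [h, h2, hq'] at h1
      exact_mod_cast h1.symm
    have hiff : ∀ k ≤ l, T.1 q c < k ↔ T'.1 q c < k := by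
      intro k hk
      rw [lt_iff_lt_rowCount T.1 k hc', lt_iff_lt_rowCount T'.1 k hc', hcount k hk]
    have h1 := T.2 (q, c) hc
    have h2 := T'.2 (q, c) hc
    have h3 := (hiff (T.1 q c + 1) h1).mp (by omega)
    have h4 := (hiff (T'.1 q c + 1) h2).mpr (by omega)
    omega
  · rw [T.1.zeros hc, T'.1.zeros hc]

theorem exists_tableauMatrix_eq (hμ : μ.colLen 0 ≤ l) {A : ℕ → ℕ → ℕ}
    (hA : IsTableauMatrix μ l A) : ∃ T : BoundedSSYT μ l, tableauMatrix l T.1 = A := by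
  set C : ℕ → ℕ → ℕ := fun q k => ∑ a ∈ Finset.range k, A a (l - 1 - q) with hC
  have hCpre : ∀ q k, (C q k : ℤ) = pre (Function.swap A) (l - 1 - q) k := by
    intro q k
    simp [hC, pre, Function.swap]
  have hCmono : ∀ q k k', k ≤ k' → C q k ≤ C q k' := fun q k k' h =>
    Finset.sum_le_sum_of_subset (Finset.range_mono h)
  have hClast : ∀ q < l, C q l = μ.rowLen q := by
    intro q hq
    have h1 := hA.sum_eq (l - 1 - q) (by omega)
    have hq' : l - 1 - (l - 1 - q) = q := by omega
    rw [← hCpre, hq'] at h1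
    exact_mod_cast h1
  have hCcol : ∀ q, q + 1 < l → ∀ a < l, C (q + 1) (a + 1) ≤ C q a := by
    intro q hq a ha
    have h1 := hA.height_le (l - 1 - (q + 1)) (by omega) a ha
    have hq' : l - 1 - (q + 1) + 1 = l - 1 - q := by omega
    rw [height, hq', ← hCpre, ← hCpre] at h1
    omega
  -- `C q k` must be the number of entries `< k` in row `q`; `t` inverts this counting function, as
  -- `hlt` states.
  set t : ℕ → ℕ → ℕ := fun q c => ((Finset.range l).filter fun k => C q (k + 1) ≤ c).card with ht
  have hlt : ∀ q c k, k ≤ l → (t q c < k ↔ c < C q k) := by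
    intro q c k hk
    rcases k with _ | k
    · simp [hC]
    · have := mem_iff_lt_card_filter (N := l) (P := fun k => C q (k + 1) ≤ c) (c := k)
        (fun k k' h _ h' => (hCmono q _ _ (by omega)).trans h') (by omega)
      simp only [ht]
      omega
  have hrow : ∀ {q c}, (q, c) ∈ μ → q < l := by
    intro q c hc
    exact (YoungDiagram.mem_iff_lt_colLen.mp
      (μ.up_left_mem le_rfl (Nat.zero_le c) hc)).trans_le hμ
  have hbound : ∀ {q c}, (q, c) ∈ μ → t q c < l := by
    intro q c hc
    rw [hlt q c l le_rfl, hClast q (hrow hc)]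
    exact YoungDiagram.mem_iff_lt_rowLen.mp hc
  have hcol : ∀ {q c}, (q + 1, c) ∈ μ → t q c < t (q + 1) c := by
    intro q c hc
    have h1 := hbound hc
    have h2 := (hlt (q + 1) c (t (q + 1) c + 1) h1).mp (by omega)
    exact (hlt q c _ h1.le).mpr (h2.trans_le (hCcol q (hrow hc) _ h1))
  let T : SemistandardYoungTableau μ :=
    { entry := fun q c => if (q, c) ∈ μ then t q c else 0
      row_weak' := by
        intro q c c' hcc hc'
        rw [if_pos hc', if_pos (μ.up_left_mem le_rfl hcc.le hc')]
        have h1 := (hlt q c' (t q c' + 1) (hbound hc')).mp (by omega)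
        have h2 := (hlt q c (t q c' + 1) (hbound hc')).mpr (by omega)
        omega
      col_strict' := by
        intro q q' c hqq hq'
        rw [if_pos hq', if_pos (μ.up_left_mem hqq.le le_rfl hq')]
        induction q', hqq using Nat.le_induction with
        | base => exact hcol hq'
        | succ k hk ih =>
          exact (ih (μ.up_left_mem (Nat.le_succ k) le_rfl hq')).trans (hcol hq')
      zeros' := fun h => if_neg h }
  have hT : ∀ {q c}, (q, c) ∈ μ → T q c = t q c := fun h => if_pos h
  refine ⟨⟨T, fun c hc => ?_⟩, ?_⟩
  · rw [hT (YoungDiagram.mem_cells c |>.mp hc)]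
    exact hbound hc
  · have hcount : ∀ q < l, ∀ k ≤ l, rowCount T q k = C q k := by
      intro q hq k hk
      have : ((Finset.range (μ.rowLen q)).filter fun c => T q c < k) = Finset.range (C q k) := by
        ext c
        rw [Finset.mem_filter, Finset.mem_range, Finset.mem_range]
        have hle := hCmono q k l hk
        rw [hClast q hq] at hle
        constructor
        · rintro ⟨h1, h2⟩
          rw [hT (YoungDiagram.mem_iff_lt_rowLen.mpr h1)] at h2
          exact (hlt q c k hk).mp h2
        · intro h
          have hc : c < μ.rowLen q := by omega
          refine ⟨hc, ?_⟩
          rw [hT (YoungDiagram.mem_iff_lt_rowLen.mpr hc)]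
          exact (hlt q c k hk).mpr h
      rw [rowCount, this, Finset.card_range]
    change tableauMatrix l T = A
    funext p j
    by_cases hpj : p < l ∧ j < l
    · have hj' : l - 1 - (l - 1 - j) = j := by omega
      have hpre : ∀ k ≤ l, pre (Function.swap (tableauMatrix l T)) j k = pre (Function.swap A) j k := by
        intro k hk
        rw [pre_swap_tableauMatrix T hpj.2 hk, hcount _ (by omega) k hk, hCpre, hj']
      have h1 := hpre p hpj.1.le
      have h2 := hpre (p + 1) hpj.1
      rw [pre_succ, pre_succ, h1] at h2
      simp only [Function.swap] at h2
      omega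
    · rw [tableauMatrix, if_neg hpj]
      by_contra hne
      exact hpj (hA.support p j fun h => hne h.symm)

/-- The conditions only involve column sums and the bound `0` on column heights, which row operators
preserve; the support stays in the square because the move does. -/
theorem Raise.isTableauMatrix_iff {i : ℕ} {A B : ℕ → ℕ → ℕ} (h : Raise l i A B) (hi : i + 1 < l) :
    IsTableauMatrix μ l A ↔ IsTableauMatrix μ l B := by
  have hsupp : (∀ p j, A p j ≠ 0 → p < l ∧ j < l) ↔ ∀ p j, B p j ≠ 0 → p < l ∧ j < l := by
    obtain ⟨c, hc, -, -, -, rfl⟩ := h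
    refine forall₂_congr fun p j => ?_
    by_cases hp : (p = i ∨ p = i + 1) ∧ j = c
    · have : p < l ∧ j < l := by omega
      simp [this]
    · have : raiseAt i c A p j = A p j := by
        unfold raiseAt
        rw [if_neg (by tauto), if_neg (by tauto)]
      rw [this]
  constructor
  · rintro ⟨h1, h2, h3⟩
    exact ⟨hsupp.mp h1, fun j hj => (h.height_swap_le_iff hi hj 0).mp (h2 j hj),
      fun j hj => (h.pre_swap hi j).trans (h3 j hj)⟩
  · rintro ⟨h1, h2, h3⟩
    exact ⟨hsupp.mpr h1, fun j hj => (h.height_swap_le_iff hi hj 0).mpr (h2 j hj),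
      fun j hj => (h.pre_swap hi j).symm.trans (h3 j hj)⟩

/-- The matrix of the highest weight tableau. -/
def antidiagonalMatrix (μ : YoungDiagram) (l : ℕ) : ℕ → ℕ → ℕ := fun p j =>
  if p < l ∧ j < l ∧ p + j + 1 = l then μ.rowLen p else 0

theorem pre_antidiagonalMatrix {p : ℕ} (hp : p < l) {k : ℕ} (hk : k ≤ l) :
    pre (antidiagonalMatrix μ l) p k = if l ≤ p + k then (μ.rowLen p : ℤ) else 0 := by
  induction k with
  | zero => rw [pre_zero, if_neg (by omega)]
  | succ k ih =>
    rw [pre_succ, ih (by omega), antidiagonalMatrix]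
    split_ifs <;> omega

theorem pre_swap_antidiagonalMatrix {j : ℕ} (hj : j < l) {k : ℕ} (hk : k ≤ l) :
    pre (Function.swap (antidiagonalMatrix μ l)) j k =
      if l ≤ j + k then (μ.rowLen (l - 1 - j) : ℤ) else 0 := by
  induction k with
  | zero => rw [pre_zero, if_neg (by omega)]
  | succ k ih =>
    rw [pre_succ, ih (by omega), Function.swap, antidiagonalMatrix]
    rcases eq_or_ne (k + j + 1) l with h | h
    · have : l - 1 - j = k := by omega
      rw [this]
      split_ifs <;> omega
    · split_ifs <;> omega

theorem isTableauMatrix_antidiagonalMatrix : IsTableauMatrix μ l (antidiagonalMatrix μ l) where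
  support p j h := by
    by_contra hn
    exact h (if_neg fun h' => hn ⟨h'.1, h'.2.1⟩)
  height_le j hj a ha := by
    rw [height, pre_swap_antidiagonalMatrix (by omega) (by omega),
      pre_swap_antidiagonalMatrix hj ha.le]
    have := μ.rowLen_anti (l - 1 - (j + 1)) (l - 1 - j) (by omega)
    split_ifs <;> omega
  sum_eq j hj := by
    rw [pre_swap_antidiagonalMatrix hj le_rfl, if_pos (by omega)]

theorem isHighest_antidiagonalMatrix : IsHighest l 0 l (antidiagonalMatrix μ l) := by
  intro i hi c hc
  rw [zero_add, height, excess, pre_antidiagonalMatrix (by omega) hc,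
    pre_antidiagonalMatrix hi hc.le, pre_antidiagonalMatrix (by omega) le_rfl,
    pre_antidiagonalMatrix hi le_rfl]
  have := μ.rowLen_anti i (i + 1) (by omega)
  split_ifs <;> omega

/-- The tableau condition kills the entries on one side of the antidiagonal (`hlow`), the highest
weight condition those on the other side (`hhigh`); the column sums then fix the rest. -/
theorem IsTableauMatrix.eq_antidiagonalMatrix {A : ℕ → ℕ → ℕ} (hA : IsTableauMatrix μ l A)
    (hh : IsHighest l 0 l A) : A = antidiagonalMatrix μ l := by
  have hlow : ∀ k j, j + k + 1 ≤ l → pre (Function.swap A) j k = 0 := by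
    intro k
    induction k with
    | zero =>
      intro j _
      rw [pre_zero]
    | succ k ih =>
      intro j hj
      have h1 := hA.height_le j (by omega) k (by omega)
      rw [height, ih (j + 1) (by omega), sub_zero] at h1
      exact le_antisymm h1 (Finset.sum_nonneg fun _ _ => Int.natCast_nonneg _)
  have hhigh : ∀ i c, i < l → c ≤ l → l ≤ i + c → pre A i l - pre A i c = 0 := by
    intro i
    induction i with
    | zero =>
      intro c _ hc h
      have : c = l := by omega
      rw [this, sub_self]
    | succ i ih =>
      intro c hi hc h
      rcases hc.eq_or_lt with rfl | hc
      · rw [sub_self]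
      · have h1 := hh i hi c hc
        rw [zero_add, height, excess] at h1
        have h2 := ih (c + 1) (by omega) hc (by omega)
        have h3 : pre A (i + 1) c ≤ pre A (i + 1) l :=
          Finset.sum_le_sum_of_subset_of_nonneg (Finset.range_mono hc.le)
            fun _ _ _ => Int.natCast_nonneg _
        omega
  have hzero : ∀ p j, p + j + 1 ≠ l → A p j = 0 := by
    intro p j hne
    by_contra h0
    obtain ⟨hp, hj⟩ := hA.support p j h0
    rcases lt_or_gt_of_ne hne with h | h
    · have h1 := hlow (p + 1) j (by omega)
      rw [pre_succ, hlow p j (by omega)] at h1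
      simp only [Function.swap] at h1
      omega
    · have h1 := hhigh p j hp hj.le (by omega)
      have h2 := hhigh p (j + 1) hp hj (by omega)
      rw [pre_succ] at h2
      omega
  funext p j
  by_cases hpj : p < l ∧ j < l ∧ p + j + 1 = l
  · rw [antidiagonalMatrix, if_pos hpj]
    have h1 := hA.sum_eq j hpj.2.1
    have h2 : l - 1 - j = p := by omega
    rw [h2, pre, Finset.sum_eq_single p] at h1
    · simpa [Function.swap] using h1
    · intro a _ ha
      simp [Function.swap, hzero a j (by omega)]
    · intro h
      exact absurd (Finset.mem_range.mpr hpj.1) h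
  · rw [antidiagonalMatrix, if_neg hpj]
    by_contra h0
    have h1 := hA.support p j h0
    exact h0 (hzero p j fun h => hpj ⟨h1.1, h1.2, h⟩)

/-- The bialternant formula. -/
theorem alternant_staircase_mul_schur (hμ : μ.colLen 0 ≤ l) :
    alternant (staircase l) * schur μ l =
      alternant ((fun p : Fin l => μ.rowLen p) + staircase l) := by
  classical
  set F : Finset (ℕ → ℕ → ℕ) := Finset.univ.image fun T : BoundedSSYT μ l => tableauMatrix l T.1
    with hF
  have hmem : ∀ A, A ∈ F ↔ IsTableauMatrix μ l A := by
    intro A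
    simp only [hF, Finset.mem_image, Finset.mem_univ, true_and]
    constructor
    · rintro ⟨T, rfl⟩
      exact isTableauMatrix_tableauMatrix T
    · exact exists_tableauMatrix_eq hμ
  have hschur : schur μ l = ∑ A ∈ F, xMonomial (rowSums l 0 l A) := by
    rw [hF, Finset.sum_image (tableauMatrix_injective hμ).injOn, schur]
    refine Finset.sum_congr rfl fun T _ => Finset.prod_congr rfl fun p _ => ?_
    rw [rowSums_tableauMatrix hμ]
  rw [hschur, alternant_staircase_mul_sum_rowSums l 0 l F fun i hi A B h => by
    rw [hmem, hmem]
    rw [zero_add] at h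
    exact h.isTableauMatrix_iff hi]
  -- A single alternant survives the cancellation.
  have hfilter : (F.filter fun A => IsHighest l 0 l A) = {antidiagonalMatrix μ l} := by
    ext A
    rw [Finset.mem_filter, hmem, Finset.mem_singleton]
    constructor
    · rintro ⟨h1, h2⟩
      exact h1.eq_antidiagonalMatrix h2
    · rintro rfl
      exact ⟨isTableauMatrix_antidiagonalMatrix, isHighest_antidiagonalMatrix⟩
  have hsums : rowSums l 0 l (antidiagonalMatrix μ l) = fun p : Fin l => μ.rowLen p := by
    funext p
    have h1 := cast_rowSums l 0 l (antidiagonalMatrix μ l) p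
    rw [zero_add, pre_antidiagonalMatrix p.2 le_rfl, if_pos (by omega)] at h1
    exact_mod_cast h1
  convert Finset.sum_singleton (fun A => alternant (rowSums l 0 l A + staircase l))
    (antidiagonalMatrix μ l) using 1
  · rw [← hfilter]
  · rw [hsums]

end TableauMatrix

/-! ### The Schur expansion for one block. -/

section OneBlock

theorem exists_youngDiagram {l : ℕ} {v : Fin l → ℕ} (hv : Antitone v) :
    ∃ μ : YoungDiagram, μ.colLen 0 ≤ l ∧ ∀ p : Fin l, μ.rowLen p = v p := by
  have hs : (List.ofFn v).SortedGE := by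
    rw [List.sortedGE_ofFn_iff]
    exact hv
  refine ⟨YoungDiagram.ofRowLens _ hs, ?_, fun p => ?_⟩
  · by_contra hcon
    have h1 := YoungDiagram.mem_iff_lt_colLen.mpr (not_le.mp hcon)
    obtain ⟨h2, -⟩ := YoungDiagram.mem_ofRowLens.mp h1
    simp at h2
  · have := YoungDiagram.rowLen_ofRowLens (hw := hs) (p.cast (by simp))
    simpa using this

theorem YoungDiagram_ext_rowLen {μ ν : YoungDiagram} {l : ℕ} (hμ : μ.colLen 0 ≤ l)
    (hν : ν.colLen 0 ≤ l) (h : ∀ p < l, μ.rowLen p = ν.rowLen p) : μ = ν := by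
  have hzero : ∀ κ : YoungDiagram, κ.colLen 0 ≤ l → ∀ p, l ≤ p → κ.rowLen p = 0 := by
    intro κ hκ p hp
    by_contra h0
    have h1 : (p, 0) ∈ κ := YoungDiagram.mem_iff_lt_rowLen.mpr (Nat.pos_of_ne_zero h0)
    have := YoungDiagram.mem_iff_lt_colLen.mp h1
    omega
  ext ⟨i, j⟩
  rw [YoungDiagram.mem_cells, YoungDiagram.mem_cells, YoungDiagram.mem_iff_lt_rowLen,
    YoungDiagram.mem_iff_lt_rowLen]
  rcases lt_or_ge i l with hi | hi
  · rw [h i hi]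
  · rw [hzero μ hμ i hi, hzero ν hν i hi]

/-- The height at column `0` is nonnegative, so every excess is too. -/
theorem IsHighest.antitone {n a l : ℕ} {A : ℕ → ℕ → ℕ} (h : IsHighest n a l A) :
    Antitone (rowSums n a l A) := by
  have hstep : ∀ i, i + 1 < l → pre A (a + i + 1) n ≤ pre A (a + i) n := by
    intro i hi
    rcases n.eq_zero_or_pos with rfl | hn
    · simp [pre]
    · have := h i hi 0 hn
      rw [height_zero, excess] at this
      omega
  have hall : ∀ d i, i + d < l → pre A (a + (i + d)) n ≤ pre A (a + i) n := by
    intro d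
    induction d with
    | zero => simp
    | succ d ih =>
      intro i hi
      exact (hstep (i + d) (by omega)).trans (ih i (by omega))
  intro p q hpq
  have hpq : (p : ℕ) ≤ q := hpq
  have h1 := hall (q - p) p (by omega)
  rw [show (p : ℕ) + (q - p) = q by omega, ← cast_rowSums, ← cast_rowSums] at h1
  exact_mod_cast h1

open Classical in
/-- The partition with the given row lengths. -/
noncomputable def shapeOf {l : ℕ} (v : Fin l → ℕ) : {μ : YoungDiagram // μ.colLen 0 ≤ l} :=
  -- For highest weight arrays the default `⊥` does not occur, their row sums being antitone.
  if h : ∃ μ : YoungDiagram, μ.colLen 0 ≤ l ∧ ∀ p : Fin l, μ.rowLen p = v p then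
    ⟨h.choose, h.choose_spec.1⟩ else ⟨⊥, by
      by_contra hcon
      exact YoungDiagram.notMem_bot _ (YoungDiagram.mem_iff_lt_colLen.mpr (not_le.mp hcon))⟩

theorem rowLen_shapeOf {l : ℕ} {v : Fin l → ℕ} (hv : Antitone v) (p : Fin l) :
    (shapeOf v).1.rowLen p = v p := by
  have h := exists_youngDiagram hv
  rw [shapeOf, dif_pos h]
  exact h.choose_spec.2 p

theorem shapeOf_eq {l : ℕ} {v : Fin l → ℕ} {μ : {μ : YoungDiagram // μ.colLen 0 ≤ l}}
    (h : ∀ p : Fin l, μ.1.rowLen p = v p) : shapeOf v = μ := by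
  have hex : ∃ μ : YoungDiagram, μ.colLen 0 ≤ l ∧ ∀ p : Fin l, μ.rowLen p = v p := ⟨μ.1, μ.2, h⟩
  rw [shapeOf, dif_pos hex]
  refine Subtype.ext (YoungDiagram_ext_rowLen hex.choose_spec.1 μ.2 fun p hp => ?_)
  rw [hex.choose_spec.2 ⟨p, hp⟩, ← h ⟨p, hp⟩]

open Classical in
/-- The character of a finite set of matrices that is closed under the row operators of a block
is the sum of the Schur polynomials of its highest weight elements. -/
theorem sum_xMonomial_rowSums (n a l : ℕ) (F : Finset (ℕ → ℕ → ℕ))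
    (hF : ∀ i, i + 1 < l → ∀ A B, Raise n (a + i) A B → (A ∈ F ↔ B ∈ F)) :
    ∑ A ∈ F, xMonomial (rowSums n a l A) =
      ∑ A ∈ F, if IsHighest n a l A then schur (shapeOf (rowSums n a l A)).1 l else 0 := by
  -- After multiplication by the Vandermonde alternant, both sides become the same sum of
  -- alternants.
  refine mul_left_cancel₀ (alternant_staircase_ne_zero (l := l)) ?_
  rw [alternant_staircase_mul_sum_rowSums n a l F hF, ← Finset.sum_filter, Finset.mul_sum]
  refine Finset.sum_congr rfl fun A hA => ?_
  have hA := (Finset.mem_filter.mp hA).2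
  rw [alternant_staircase_mul_schur (shapeOf _).2]
  congr 2
  funext p
  exact (rowLen_shapeOf hA.antitone p).symm

end OneBlock

/-! ### Yamanouchi words and their invariance under Knuth moves. -/

section Yamanouchi

/-- Every suffix of the word has at least as many letters `i` as letters `i + 1`. -/
def YamanouchiAt (i : ℕ) (w : List ℕ) : Prop := ∀ s, s <:+ w → s.count (i + 1) ≤ s.count i

theorem yamanouchiAt_nil (i : ℕ) : YamanouchiAt i [] := by
  intro s hs
  rw [List.suffix_nil.mp hs]
  simp

theorem yamanouchiAt_cons {i c : ℕ} {w : List ℕ} : YamanouchiAt i (c :: w) ↔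
    YamanouchiAt i w ∧ (c :: w).count (i + 1) ≤ (c :: w).count i := by
  simp only [YamanouchiAt, List.suffix_cons_iff]
  constructor
  · intro h
    exact ⟨fun s hs => h s (Or.inr hs), h _ (Or.inl rfl)⟩
  · rintro ⟨h1, h2⟩ s (rfl | hs)
    · exact h2
    · exact h1 s hs

theorem YamanouchiAt.append {i : ℕ} {u v : List ℕ} (hu : YamanouchiAt i u)
    (hv : YamanouchiAt i v) : YamanouchiAt i (u ++ v) := by
  induction u with
  | nil => exact hv
  | cons c u ih =>
    rw [List.cons_append, yamanouchiAt_cons]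
    refine ⟨ih (yamanouchiAt_cons.mp hu).1, ?_⟩
    have h1 := (yamanouchiAt_cons.mp hu).2
    have h2 := hv v List.suffix_rfl
    rw [← List.cons_append, List.count_append, List.count_append]
    omega

theorem YamanouchiAt.flatMap {i : ℕ} {α : Type*} {L : List α} {g : α → List ℕ}
    (h : ∀ x ∈ L, YamanouchiAt i (g x)) : YamanouchiAt i (L.flatMap g) := by
  induction L with
  | nil => exact yamanouchiAt_nil i
  | cons x L ih =>
    rw [List.flatMap_cons]
    exact (h x (by simp)).append (ih fun y hy => h y (by simp [hy]))

/-- Suffixes that reach into `u` have the same content on both sides, so only suffixes of `v` and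
`w` matter. -/
theorem yamanouchiAt_append_congr {i : ℕ} (u : List ℕ) {v w : List ℕ} (hp : v.Perm w)
    (h : YamanouchiAt i v ↔ YamanouchiAt i w) :
    YamanouchiAt i (u ++ v) ↔ YamanouchiAt i (u ++ w) := by
  induction u with
  | nil => exact h
  | cons c u ih =>
    rw [List.cons_append, List.cons_append, yamanouchiAt_cons, yamanouchiAt_cons, ih,
      ((hp.append_left u).cons c).count_eq, ((hp.append_left u).cons c).count_eq]

theorem KnuthMove.perm {v w : List ℕ} (h : KnuthMove v w) : v.Perm w := by
  cases h with
  | left u v hxy hyz =>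
    refine List.Perm.append_right v (List.Perm.append_left u ?_)
    exact (List.Perm.swap _ _ []).cons _
  | right u v hxy hyz =>
    refine List.Perm.append_right v (List.Perm.append_left u ?_)
    exact List.Perm.swap _ _ _

/-- Only suffixes starting inside the moved triple can differ. Since the third letter is a witness
between the two exchanged ones, a finite check on which letters are `i` or `i + 1` suffices. -/
theorem KnuthMove.yamanouchiAt_iff {i : ℕ} {v w : List ℕ} (h : KnuthMove v w) :
    YamanouchiAt i v ↔ YamanouchiAt i w := by
  cases h with
  | @left u v x y z hxy hyz =>
    rw [List.append_assoc, List.append_assoc]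
    refine yamanouchiAt_append_congr u
      (List.Perm.append_right v ((List.Perm.swap _ _ []).cons _)) ?_
    simp only [List.cons_append, List.nil_append, yamanouchiAt_cons, List.count_cons, beq_iff_eq]
    have hv : YamanouchiAt i v → v.count (i + 1) ≤ v.count i := fun h => h v List.suffix_rfl
    generalize v.count (i + 1) = p at *
    generalize v.count i = q at *
    split_ifs <;> constructor <;> rintro ⟨⟨⟨h1, h2⟩, h3⟩, h4⟩ <;>
      refine ⟨⟨⟨h1, ?_⟩, ?_⟩, ?_⟩ <;> have := hv h1 <;> omega
  | @right u v x y z hxy hyz =>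
    rw [List.append_assoc, List.append_assoc]
    refine yamanouchiAt_append_congr u (List.Perm.append_right v (List.Perm.swap _ _ _)) ?_
    simp only [List.cons_append, List.nil_append, yamanouchiAt_cons, List.count_cons, beq_iff_eq]
    have hv : YamanouchiAt i v → v.count (i + 1) ≤ v.count i := fun h => h v List.suffix_rfl
    generalize v.count (i + 1) = p at *
    generalize v.count i = q at *
    split_ifs <;> constructor <;> rintro ⟨⟨⟨h1, h2⟩, h3⟩, h4⟩ <;>
      refine ⟨⟨⟨h1, ?_⟩, ?_⟩, ?_⟩ <;> have := hv h1 <;> omega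

theorem KnuthEquiv.perm {v w : List ℕ} (h : KnuthEquiv v w) : v.Perm w := by
  induction h with
  | rel _ _ h => exact h.perm
  | refl _ => exact List.Perm.refl _
  | symm _ _ _ ih => exact ih.symm
  | trans _ _ _ _ _ ih1 ih2 => exact ih1.trans ih2

theorem KnuthEquiv.yamanouchiAt_iff {i : ℕ} {v w : List ℕ} (h : KnuthEquiv v w) :
    YamanouchiAt i v ↔ YamanouchiAt i w := by
  induction h with
  | rel _ _ h => exact h.yamanouchiAt_iff
  | refl _ => exact Iff.rfl
  | symm _ _ _ ih => exact ih.symm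
  | trans _ _ _ _ _ ih1 ih2 => exact ih1.trans ih2

end Yamanouchi

/-! ### Column insertion: every Knuth class contains a tableau word. -/

section Insertion

theorem KnuthEquiv.refl (w : List ℕ) : KnuthEquiv w w := Relation.EqvGen.refl w

theorem KnuthEquiv.trans {u v w : List ℕ} (h : KnuthEquiv u v) (h' : KnuthEquiv v w) :
    KnuthEquiv u w := Relation.EqvGen.trans _ _ _ h h'

theorem KnuthEquiv.symm {u v : List ℕ} (h : KnuthEquiv u v) : KnuthEquiv v u :=
  Relation.EqvGen.symm _ _ h

theorem KnuthMove.append {v w : List ℕ} (h : KnuthMove v w) (s t : List ℕ) :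
    KnuthMove (s ++ v ++ t) (s ++ w ++ t) := by
  cases h with
  | left u v hxy hyz =>
    have := KnuthMove.left (s ++ u) (v ++ t) hxy hyz
    simpa only [List.append_assoc] using this
  | right u v hxy hyz =>
    have := KnuthMove.right (s ++ u) (v ++ t) hxy hyz
    simpa only [List.append_assoc] using this

theorem KnuthEquiv.append {v w : List ℕ} (h : KnuthEquiv v w) (s t : List ℕ) :
    KnuthEquiv (s ++ v ++ t) (s ++ w ++ t) := by
  induction h with
  | rel _ _ h => exact Relation.EqvGen.rel _ _ (h.append s t)
  | refl _ => exact KnuthEquiv.refl _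
  | symm _ _ _ ih => exact ih.symm
  | trans _ _ _ _ _ ih1 ih2 => exact ih1.trans ih2

theorem KnuthEquiv.cons {v w : List ℕ} (h : KnuthEquiv v w) (c : ℕ) :
    KnuthEquiv (c :: v) (c :: w) := by
  simpa using h.append [c] []

/-- The letter `x` moves right past each letter of `D`, the next letter of the decreasing word
serving as the witness of the move. -/
theorem knuthEquiv_pass_larger {x b : ℕ} (hxb : x ≤ b) :
    ∀ {D : List ℕ}, (D ++ [b]).Pairwise (· > ·) →
      KnuthEquiv (x :: (D ++ [b])) (D ++ [x, b]) := by
  intro D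
  induction D with
  | nil => intro _; exact KnuthEquiv.refl _
  | cons d D ih =>
    intro hD
    rw [List.cons_append, List.pairwise_cons] at hD
    refine KnuthEquiv.trans ?_ ((ih hD.2).cons d)
    obtain ⟨e, rest, he⟩ : ∃ e rest, D ++ [b] = e :: rest := by
      cases D with
      | nil => exact ⟨b, [], rfl⟩
      | cons e D => exact ⟨e, D ++ [b], rfl⟩
    have hed : e < d := hD.1 e (by rw [he]; simp)
    have hxe : x ≤ e := by
      have hb : b ∈ e :: rest := he ▸ List.mem_append_right D (List.mem_singleton_self b)
      have hp := hD.2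
      rw [he, List.pairwise_cons] at hp
      rcases List.mem_cons.mp hb with rfl | hb
      · exact hxb
      · exact hxb.trans (hp.1 b hb).le
    rw [List.cons_append, he]
    have := KnuthMove.right [] rest hxe hed
    exact (Relation.EqvGen.rel _ _ this).symm

/-- The letter `z` moves right past `D`; the witness is always the letter just before it. -/
theorem knuthEquiv_pass_smaller {z : ℕ} :
    ∀ {D : List ℕ} {a : ℕ}, a ≤ z → (a :: D).Pairwise (· > ·) →
      KnuthEquiv (a :: z :: D) (a :: (D ++ [z])) := by
  intro D
  induction D with
  | nil => intro a _ _; exact KnuthEquiv.refl _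
  | cons d D ih =>
    intro a haz hD
    rw [List.pairwise_cons] at hD
    have hda : d < a := hD.1 d (by simp)
    refine KnuthEquiv.trans ?_ ((ih (hda.le.trans haz) hD.2).cons a)
    exact Relation.EqvGen.rel _ _ (KnuthMove.left [] D hda haz)

/-- One bump: `x` travels right to the place of `b`, then `b` travels out of the column. -/
theorem knuthEquiv_bump {x b : ℕ} {D E : List ℕ} (hxb : x ≤ b)
    (hD : (D ++ b :: E).Pairwise (· > ·)) (hE : (x :: E).Pairwise (· > ·)) :
    KnuthEquiv (x :: (D ++ b :: E)) (D ++ x :: E ++ [b]) := by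
  have hDb : (D ++ [b]).Pairwise (· > ·) := by
    refine hD.sublist ?_
    exact List.Sublist.append_left (List.singleton_sublist.mpr (by simp)) D
  have h1 := (knuthEquiv_pass_larger hxb hDb).append [] E
  have h2 := (knuthEquiv_pass_smaller hxb hE).append D []
  refine KnuthEquiv.trans ?_ (KnuthEquiv.trans ?_ h2) (v := D ++ x :: b :: E) |>.trans ?_
  · simpa using h1
  · simpa using KnuthEquiv.refl (D ++ x :: b :: E)
  · simpa using KnuthEquiv.refl (D ++ x :: E ++ [b])

/-- The reading word of a column with `k` entries `f 0 < ⋯ < f (k - 1)`. -/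
def columnWord (k : ℕ) (f : ℕ → ℕ) : List ℕ := (List.range k).reverse.map f

theorem columnWord_succ (k : ℕ) (f : ℕ → ℕ) : columnWord (k + 1) f = f k :: columnWord k f := by
  simp [columnWord, List.range_succ]

theorem columnWord_congr {k : ℕ} {f g : ℕ → ℕ} (h : ∀ i < k, f i = g i) :
    columnWord k f = columnWord k g := by
  refine List.map_congr_left fun i hi => h i ?_
  simpa using hi

theorem exists_columnWord_eq {i k : ℕ} (hi : i < k) (f : ℕ → ℕ) :
    ∃ D, ∀ x, columnWord k (Function.update f i x) = D ++ x :: columnWord i f := by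
  induction k, hi using Nat.le_induction with
  | base =>
    refine ⟨[], fun x => ?_⟩
    rw [Nat.succ_eq_add_one, columnWord_succ, Function.update_self]
    exact congrArg _ (columnWord_congr fun j hj => Function.update_of_ne (by omega) _ _)
  | succ k hk ih =>
    obtain ⟨D, hD⟩ := ih
    refine ⟨f k :: D, fun x => ?_⟩
    rw [columnWord_succ, hD, Function.update_of_ne (by omega), List.cons_append]

theorem pairwise_columnWord {k : ℕ} {f : ℕ → ℕ} (hf : ∀ a b, a < b → b < k → f a < f b) :
    (columnWord k f).Pairwise (· > ·) := by
  induction k with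
  | zero => simp [columnWord]
  | succ k ih =>
    rw [columnWord_succ, List.pairwise_cons]
    refine ⟨fun c hc => ?_, ih fun a b hab hb => hf a b hab (by omega)⟩
    simp only [columnWord, List.mem_map, List.mem_reverse, List.mem_range] at hc
    obtain ⟨j, hj, rfl⟩ := hc
    exact hf j k hj k.lt_succ_self

/-- The column `c` can stand to the left of the columns `cs` of a tableau. -/
def FitsLeft (c : ℕ × (ℕ → ℕ)) (cs : List (ℕ × (ℕ → ℕ))) : Prop :=
  ∀ d ∈ cs.head?, d.1 ≤ c.1 ∧ ∀ i < d.1, c.2 i ≤ d.2 i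

/-- The sequences of the columns of semistandard tableaux. -/
def IsColumnTableau : List (ℕ × (ℕ → ℕ)) → Prop
  | [] => True
  | c :: cs => 0 < c.1 ∧ (∀ a b, a < b → b < c.1 → c.2 a < c.2 b) ∧ FitsLeft c cs ∧
      IsColumnTableau cs

/-- The reading word of a sequence of columns. -/
def columnsWord (cs : List (ℕ × (ℕ → ℕ))) : List ℕ := cs.flatMap fun c => columnWord c.1 c.2

/-- Column insertion. -/
theorem exists_insert : ∀ (cs : List (ℕ × (ℕ → ℕ))) (x : ℕ), IsColumnTableau cs →
    ∃ cs', IsColumnTableau cs' ∧ KnuthEquiv (x :: columnsWord cs) (columnsWord cs') ∧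
      ∀ c : ℕ × (ℕ → ℕ), FitsLeft c cs → ∀ i < c.1, (∀ j ≤ i, c.2 j ≤ x) →
        (∀ d ∈ cs.head?, i < d.1 → x ≤ d.2 i) → FitsLeft c cs' := by
  -- The last clause strengthens the induction. In use, `c` is the column to the left after it has
  -- lost `x` from row `i`; the clause ensures that it still fits next to the new columns.
  intro cs
  induction cs with
  | nil =>
    intro x _
    refine ⟨[(1, fun _ => x)], ?_, KnuthEquiv.refl _, ?_⟩
    · refine ⟨one_pos, fun a b h1 h2 => ?_, fun d hd => ?_, trivial⟩
      · simp only at h2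
        omega
      · simp at hd
    · intro c _ i hi hx _ d hd
      simp only [List.head?_cons, Option.mem_def, Option.some.injEq] at hd
      subst hd
      refine ⟨by simp only; omega, fun j hj => ?_⟩
      simp only at hj ⊢
      exact hx j (by omega)
  | cons d cs ih =>
    rintro x ⟨hd0, hds, hdf, hcs⟩
    -- Either `x` exceeds the whole column and goes to its bottom, or it replaces the first entry `≥
    -- x`, which is inserted into the remaining columns.
    by_cases hall : ∀ j < d.1, d.2 j < x
    · refine ⟨(d.1 + 1, Function.update d.2 d.1 x) :: cs, ⟨by simp, ?_, ?_, hcs⟩, ?_, ?_⟩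
      · intro a b hab hb
        simp only at hb ⊢
        rw [Function.update_of_ne (by omega : a ≠ d.1)]
        rcases (Nat.lt_succ_iff.mp hb).eq_or_lt with rfl | hb
        · rw [Function.update_self]
          exact hall a hab
        · rw [Function.update_of_ne hb.ne]
          exact hds a b hab hb
      · intro e he
        obtain ⟨h1, h2⟩ := hdf e he
        refine ⟨by simp only; omega, fun j hj => ?_⟩
        simp only
        rw [Function.update_of_ne (by omega)]
        exact h2 j hj
      · have : columnsWord ((d.1 + 1, Function.update d.2 d.1 x) :: cs) =
            x :: columnsWord (d :: cs) := by
          simp only [columnsWord, List.flatMap_cons, columnWord_succ, Function.update_self,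
            List.cons_append]
          rw [columnWord_congr fun j hj => Function.update_of_ne (by omega) _ _]
        rw [this]
        exact KnuthEquiv.refl _
      · intro c hc i hi hx hxd e he
        simp only [List.head?_cons, Option.mem_def, Option.some.injEq] at he
        subst he
        obtain ⟨h1, h2⟩ := hc d rfl
        have hid : d.1 ≤ i := by
          by_contra hlt
          have h3 := hxd d rfl (by omega)
          have h4 := hall i (by omega)
          omega
        refine ⟨by simp only; omega, fun j hj => ?_⟩
        simp only at hj ⊢
        rcases (Nat.lt_succ_iff.mp hj).eq_or_lt with rfl | hj
        · rw [Function.update_self]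
          exact hx _ hid
        · rw [Function.update_of_ne hj.ne]
          exact h2 j hj
    · push Not at hall
      classical
      set j := Nat.find hall with hj
      obtain ⟨hjd, hxj⟩ := Nat.find_spec hall
      rw [← hj] at hjd hxj
      have hmin : ∀ a < j, d.2 a < x := by
        intro a ha
        have := Nat.find_min hall ha
        push Not at this
        exact this (by omega)
      have hupd : ∀ a, Function.update d.2 j x a ≤ d.2 a := by
        intro a
        rcases eq_or_ne a j with rfl | ha
        · rw [Function.update_self]
          exact hxj
        · rw [Function.update_of_ne ha]
      have hstrict : ∀ a b, a < b → b < d.1 →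
          Function.update d.2 j x a < Function.update d.2 j x b := by
        intro a b hab hb
        rcases eq_or_ne b j with rfl | hbj
        · rw [Function.update_self, Function.update_of_ne (by omega)]
          exact hmin a hab
        · rw [Function.update_of_ne hbj]
          exact (hupd a).trans_lt (hds a b hab hb)
      obtain ⟨cs', h1, h2, h3⟩ := ih (d.2 j) hcs
      refine ⟨(d.1, Function.update d.2 j x) :: cs', ⟨hd0, hstrict, ?_, h1⟩, ?_, ?_⟩
      · refine h3 (d.1, Function.update d.2 j x) (fun e he => ?_) j hjd (fun a ha => ?_) ?_
        · exact ⟨(hdf e he).1, fun i hi => (hupd i).trans ((hdf e he).2 i hi)⟩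
        · rcases ha.eq_or_lt with rfl | ha
          · exact hupd _
          · exact (hupd a).trans (hds a j ha hjd).le
        · intro e he hje
          exact (hdf e he).2 j hje
      · obtain ⟨D, hD⟩ := exists_columnWord_eq hjd d.2
        have hself : columnWord d.1 d.2 = D ++ d.2 j :: columnWord j d.2 := by
          rw [← hD, Function.update_eq_self]
        have hp1 := pairwise_columnWord hds
        have hp2 := pairwise_columnWord hstrict
        rw [hself] at hp1
        rw [hD] at hp2
        have hb := knuthEquiv_bump hxj hp1 (hp2.sublist (List.sublist_append_right _ _))
        have hb' := hb.append [] (columnsWord cs)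
        have h2' := h2.append (D ++ x :: columnWord j d.2) []
        simp only [columnsWord, List.flatMap_cons, hself, hD] at h2' hb' ⊢
        refine KnuthEquiv.trans (v := D ++ x :: columnWord j d.2 ++ d.2 j ::
          cs.flatMap fun c => columnWord c.1 c.2) ?_ ?_
        · simpa using hb'
        · simpa using h2'
      · intro c hc i hi hx hxd e he
        simp only [List.head?_cons, Option.mem_def, Option.some.injEq] at he
        subst he
        obtain ⟨h4, h5⟩ := hc d rfl
        refine ⟨h4, fun a ha => ?_⟩
        simp only at ha ⊢
        rcases eq_or_ne a j with rfl | haj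
        · rw [Function.update_self]
          refine hx _ ?_
          by_contra hcon
          have h6 := hxd d rfl (by omega)
          have h7 := hmin i (by omega)
          omega
        · rw [Function.update_of_ne haj]
          exact h5 a ha

theorem exists_knuthEquiv_columnsWord (w : List ℕ) :
    ∃ cs, IsColumnTableau cs ∧ KnuthEquiv w (columnsWord cs) := by
  induction w with
  | nil => exact ⟨[], trivial, KnuthEquiv.refl _⟩
  | cons x w ih =>
    obtain ⟨cs, h1, h2⟩ := ih
    obtain ⟨cs', h3, h4, -⟩ := exists_insert cs x h1
    exact ⟨cs', h3, (h2.cons x).trans h4⟩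

theorem columnsWord_eq_flatMap_range (cs : List (ℕ × (ℕ → ℕ))) :
    columnsWord cs = (List.range cs.length).flatMap fun j =>
      columnWord (cs.getD j (0, 0)).1 (cs.getD j (0, 0)).2 := by
  induction cs with
  | nil => rfl
  | cons c cs ih =>
    rw [List.length_cons, List.range_succ_eq_map, List.flatMap_cons, List.flatMap_map,
      columnsWord, List.flatMap_cons]
    simp only [List.getD_cons_zero, List.getD_cons_succ]
    rw [← ih]
    rfl

/-- The default `(0, 0)` is an empty column, so the conditions extend to all `j` past the end of the
list. -/
theorem IsColumnTableau.getD {cs : List (ℕ × (ℕ → ℕ))} (h : IsColumnTableau cs) (j : ℕ) :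
    ((cs.getD (j + 1) (0, 0)).1 ≤ (cs.getD j (0, 0)).1 ∧
      ∀ i < (cs.getD (j + 1) (0, 0)).1, (cs.getD j (0, 0)).2 i ≤ (cs.getD (j + 1) (0, 0)).2 i) ∧
    (∀ a b, a < b → b < (cs.getD j (0, 0)).1 → (cs.getD j (0, 0)).2 a < (cs.getD j (0, 0)).2 b) ∧
    (0 < (cs.getD j (0, 0)).1 ↔ j < cs.length) := by
  induction cs generalizing j with
  | nil => simp
  | cons c cs ih =>
    obtain ⟨h1, h2, h3, h4⟩ := h
    cases j with
    | zero =>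
      refine ⟨?_, h2, by simpa using h1⟩
      cases cs with
      | nil => simp
      | cons d cs => simpa using h3 d rfl
    | succ j => simpa using ih h4 j

theorem IsColumnTableau.exists_tableau {cs : List (ℕ × (ℕ → ℕ))} (h : IsColumnTableau cs) :
    ∃ T : Tableau, readingWord T.2 = columnsWord cs := by
  set k : ℕ → ℕ := fun j => (cs.getD j (0, 0)).1 with hk
  set f : ℕ → ℕ → ℕ := fun j => (cs.getD j (0, 0)).2 with hf
  have hanti : Antitone k := antitone_nat_of_succ_le fun j => (h.getD j).1.1
  have hpos : ∀ j, 0 < k j ↔ j < cs.length := fun j => (h.getD j).2.2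
  let μ : YoungDiagram :=
    { cells := (Finset.range (k 0) ×ˢ Finset.range cs.length).filter fun c => c.1 < k c.2
      isLowerSet := by
        rintro ⟨i, j⟩ ⟨i', j'⟩ hle hmem
        obtain ⟨hi, hj⟩ := hle
        simp only at hi hj
        simp only [Finset.coe_filter, Finset.mem_product, Finset.mem_range,
          Set.mem_ofPred_eq] at hmem ⊢
        have := hanti hj
        exact ⟨⟨by omega, by omega⟩, by omega⟩ }
  have hmem : ∀ i j, (i, j) ∈ μ ↔ i < k j := by
    intro i j
    rw [← YoungDiagram.mem_cells]
    simp only [μ, Finset.mem_filter, Finset.mem_product, Finset.mem_range]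
    constructor
    · exact fun h => h.2
    · intro hi
      have h1 := (hpos j).mp (by omega)
      have h2 := hanti (Nat.zero_le j)
      exact ⟨⟨by omega, h1⟩, hi⟩
  have hweak : ∀ i j j', j ≤ j' → i < k j' → f j i ≤ f j' i := by
    intro i j j' hjj
    induction j', hjj using Nat.le_induction with
    | base => exact fun _ => le_rfl
    | succ j' hjj' ih =>
      intro hi
      have h1 := (h.getD j').1
      exact (ih (hi.trans_le h1.1)).trans (h1.2 i hi)
  let T : SemistandardYoungTableau μ :=
    { entry := fun i j => if i < k j then f j i else 0
      row_weak' := by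
        intro i j j' hjj hc
        rw [hmem] at hc
        rw [if_pos hc, if_pos (hc.trans_le (hanti hjj.le))]
        exact hweak i j j' hjj.le hc
      col_strict' := by
        intro i i' j hii hc
        rw [hmem] at hc
        rw [if_pos hc, if_pos (hii.trans hc)]
        exact (h.getD j).2.1 i i' hii hc
      zeros' := by
        intro i j hc
        rw [hmem] at hc
        exact if_neg hc }
  have heq : ∀ a b : ℕ, (∀ i, i < a ↔ i < b) → a = b := by
    intro a b hab
    have h1 := hab a
    have h2 := hab b
    omega
  have hcol : ∀ j, μ.colLen j = k j := fun j => heq _ _ fun i => by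
    rw [← YoungDiagram.mem_iff_lt_colLen, hmem]
  have hrow : μ.rowLen 0 = cs.length := heq _ _ fun j => by
    rw [← YoungDiagram.mem_iff_lt_rowLen, hmem, hpos]
  refine ⟨⟨μ, T⟩, ?_⟩
  rw [columnsWord_eq_flatMap_range, readingWord]
  simp only [hrow, hcol]
  congr 1
  funext j
  refine List.map_congr_left fun i hi => ?_
  have hi : i < k j := by simpa using hi
  exact if_pos hi

/-- Every word is Knuth equivalent to the reading word of a tableau. -/
theorem knuthEquiv_readingWord_tab (w : List ℕ) : KnuthEquiv w (readingWord (tab w).2) := by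
  obtain ⟨cs, h1, h2⟩ := exists_knuthEquiv_columnsWord w
  obtain ⟨T, hT⟩ := h1.exists_tableau
  exact Classical.epsilon_spec (p := fun T : Tableau => KnuthEquiv w (readingWord T.2))
    ⟨T, hT ▸ h2⟩

end Insertion

/-! ### Highest weight tableaux and Yamanouchi words. -/

section HighestWeight

variable {μ : YoungDiagram}

theorem mem_readingWord {T : SemistandardYoungTableau μ} {i j : ℕ} (h : (i, j) ∈ μ) :
    T i j ∈ readingWord T := by
  refine List.mem_flatMap.mpr ⟨j, ?_, List.mem_map.mpr ⟨i, ?_, rfl⟩⟩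
  · exact List.mem_range.mpr
      (YoungDiagram.mem_iff_lt_rowLen.mp (μ.up_left_mem (Nat.zero_le i) le_rfl h))
  · exact List.mem_reverse.mpr (List.mem_range.mpr (YoungDiagram.mem_iff_lt_colLen.mp h))

theorem columnWord_suffix {i k : ℕ} (hi : i ≤ k) (f : ℕ → ℕ) :
    columnWord i f <:+ columnWord k f := by
  induction k, hi using Nat.le_induction with
  | base => exact List.suffix_rfl
  | succ k hk ih =>
    rw [columnWord_succ]
    exact ih.trans (List.suffix_cons _ _)

/-- From a cell on, the word reads that cell, the cells above it and the columns to its right. -/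
theorem suffix_readingWord (T : SemistandardYoungTableau μ) {i j : ℕ} (h : (i, j) ∈ μ) :
    T i j :: (columnWord i (fun i => T i j) ++
      (List.range' (j + 1) (μ.rowLen 0 - (j + 1))).flatMap fun j =>
        columnWord (μ.colLen j) fun i => T i j) <:+ readingWord T := by
  have hj : j < μ.rowLen 0 :=
    YoungDiagram.mem_iff_lt_rowLen.mp (μ.up_left_mem (Nat.zero_le i) le_rfl h)
  have hi : i < μ.colLen j := YoungDiagram.mem_iff_lt_colLen.mp h
  have hrange : List.range (μ.rowLen 0) =
      List.range j ++ j :: List.range' (j + 1) (μ.rowLen 0 - (j + 1)) := by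
    rw [List.range_eq_range', List.range_eq_range', ← List.range'_succ]
    have h1 : μ.rowLen 0 = j + (μ.rowLen 0 - (j + 1) + 1) := by omega
    conv_lhs => rw [h1]
    rw [← List.range'_append_1]
    simp
  obtain ⟨D, hD⟩ := columnWord_suffix (Nat.succ_le_of_lt hi) fun i => T i j
  have hword : readingWord T = (List.range (μ.rowLen 0)).flatMap fun j =>
      columnWord (μ.colLen j) fun i => T i j := rfl
  rw [hword, hrange, List.flatMap_append, List.flatMap_cons, ← hD, Nat.succ_eq_add_one,
    columnWord_succ]
  refine ⟨(List.range j).flatMap (fun j => columnWord (μ.colLen j) fun i => T i j) ++ D, ?_⟩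
  simp

theorem mem_columnWord {c k : ℕ} {f : ℕ → ℕ} : c ∈ columnWord k f ↔ ∃ i < k, f i = c := by
  simp [columnWord]

/-- A tableau with a Yamanouchi reading word is a highest weight tableau. -/
theorem eq_highestWeight {a : ℕ} {T : SemistandardYoungTableau μ}
    (ha : ∀ c ∈ readingWord T, a ≤ c) (hy : ∀ i, a ≤ i → YamanouchiAt i (readingWord T)) :
    T = highestWeight a μ := by
  -- Induction over the columns from right to left, and from top to bottom in each.
  have key : ∀ d j, μ.rowLen 0 - j ≤ d → ∀ i, (i, j) ∈ μ → T i j = a + i := by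
    intro d
    induction d with
    | zero =>
      intro j hj i hi
      have := YoungDiagram.mem_iff_lt_rowLen.mp (μ.up_left_mem (Nat.zero_le i) le_rfl hi)
      omega
    | succ d ih =>
      intro j hj i
      induction i using Nat.strong_induction_on with
      | _ i ihi =>
        intro hi
        have hlow : a + i ≤ T i j := by
          cases i with
          | zero => exact ha _ (mem_readingWord hi)
          | succ i =>
            have h1 := ihi i i.lt_succ_self (μ.up_left_mem i.le_succ le_rfl hi)
            have h2 := T.col_strict i.lt_succ_self hi
            simp only [Nat.succ_eq_add_one] at h2
            omega
        by_contra hne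
        have hgt : a + i < T i j := by omega
        -- An entry that is too large must be answered by its predecessor later in the word. The
        -- cells above are too small, and such a cell in a column to the right forces a cell `(i, j
        -- + 1)` with entry `a + i`, contrary to row weakness.
        have hsuff := hy (T i j - 1) (by omega) _ (suffix_readingWord T hi)
        rw [Nat.sub_add_cancel (by omega), List.count_cons_self] at hsuff
        have hmem : T i j - 1 ∈ T i j :: (columnWord i (fun i => T i j) ++
            (List.range' (j + 1) (μ.rowLen 0 - (j + 1))).flatMap fun j =>
              columnWord (μ.colLen j) fun i => T i j) :=
          List.count_pos_iff.mp (by omega)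
        rw [List.mem_cons, List.mem_append, mem_columnWord, List.mem_flatMap] at hmem
        rcases hmem with h | ⟨i', hi', h⟩ | ⟨j', hj', h⟩
        · omega
        · rw [ihi i' hi' (μ.up_left_mem hi'.le le_rfl hi)] at h
          omega
        · rw [List.mem_range'_1] at hj'
          obtain ⟨i', hi', h⟩ := mem_columnWord.mp h
          have hc := YoungDiagram.mem_iff_lt_colLen.mpr hi'
          rw [ih j' (by omega) i' hc] at h
          have hij : (i, j + 1) ∈ μ := μ.up_left_mem (by omega) (by omega) hc
          have h1 := ih (j + 1) (by omega) i hij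
          have h2 := T.row_weak j.lt_succ_self hij
          simp only [Nat.succ_eq_add_one] at h2
          omega
  refine SemistandardYoungTableau.ext fun i j => ?_
  by_cases hc : (i, j) ∈ μ
  · rw [key _ j le_rfl i hc]
    exact (if_pos hc).symm
  · rw [T.zeros hc]
    exact (if_neg hc).symm

theorem readingWord_highestWeight (a : ℕ) (μ : YoungDiagram) :
    readingWord (highestWeight a μ) =
      (List.range (μ.rowLen 0)).flatMap fun j => columnWord (μ.colLen j) (a + ·) := by
  rw [readingWord]
  congr 1
  funext j
  refine List.map_congr_left fun i hi => ?_
  have hi : i < μ.colLen j := by simpa using hi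
  exact if_pos (YoungDiagram.mem_iff_lt_colLen.mpr hi)

theorem count_columnWord_add (a k p : ℕ) :
    (columnWord k (a + ·)).count (a + p) = if p < k then 1 else 0 := by
  induction k with
  | zero => simp [columnWord]
  | succ k ih =>
    rw [columnWord_succ, List.count_cons, ih]
    simp only [beq_iff_eq]
    split_ifs <;> omega

theorem yamanouchiAt_readingWord_highestWeight {a i : ℕ} (hi : a ≤ i) (μ : YoungDiagram) :
    YamanouchiAt i (readingWord (highestWeight a μ)) := by
  rw [readingWord_highestWeight]
  refine YamanouchiAt.flatMap fun j _ => ?_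
  obtain ⟨p, rfl⟩ := Nat.exists_eq_add_of_le hi
  induction μ.colLen j with
  | zero => exact yamanouchiAt_nil _
  | succ k ih =>
    rw [columnWord_succ, yamanouchiAt_cons]
    refine ⟨ih, ?_⟩
    rw [← columnWord_succ (f := (a + ·)), add_assoc, count_columnWord_add, count_columnWord_add]
    split_ifs <;> omega

theorem count_readingWord_highestWeight (a : ℕ) (μ : YoungDiagram) (p : ℕ) :
    (readingWord (highestWeight a μ)).count (a + p) = μ.rowLen p := by
  rw [readingWord_highestWeight, List.count_flatMap]
  have h1 : (List.count (a + p) ∘ fun j => columnWord (μ.colLen j) (a + ·)) =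
      fun j => if j < μ.rowLen p then 1 else 0 := by
    funext j
    rw [Function.comp_apply, count_columnWord_add]
    simp only [← YoungDiagram.mem_iff_lt_colLen, ← YoungDiagram.mem_iff_lt_rowLen]
  have h4 : ((List.range (μ.rowLen 0)).map fun j => if j < μ.rowLen p then 1 else 0).sum =
      ∑ j ∈ Finset.range (μ.rowLen 0), if j < μ.rowLen p then 1 else 0 := rfl
  rw [h1, h4, Finset.sum_boole]
  have h2 := μ.rowLen_anti 0 p (Nat.zero_le p)
  have h3 : (Finset.range (μ.rowLen 0)).filter (fun j => j < μ.rowLen p) =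
      Finset.range (μ.rowLen p) := by
    ext j
    simp only [Finset.mem_filter, Finset.mem_range]
    omega
  rw [h3, Finset.card_range, Nat.cast_id]

/-- The tableau of a word is a highest weight tableau if and only if the word is a Yamanouchi
word. -/
theorem tab_eq_highestWeight_iff {a : ℕ} {w : List ℕ} (hw : ∀ c ∈ w, a ≤ c) (μ : YoungDiagram) :
    tab w = ⟨μ, highestWeight a μ⟩ ↔
      (∀ i, a ≤ i → YamanouchiAt i w) ∧ ∀ p, w.count (a + p) = μ.rowLen p := by
  have hT := knuthEquiv_readingWord_tab w
  constructor
  · intro h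
    rw [h] at hT
    refine ⟨fun i hi => hT.yamanouchiAt_iff.mpr (yamanouchiAt_readingWord_highestWeight hi μ),
      fun p => ?_⟩
    rw [hT.perm.count_eq, count_readingWord_highestWeight]
  · rintro ⟨h1, h2⟩
    -- Of `tab w` only the Knuth equivalence with `w` is used from here on; the Yamanouchi property
    -- fixes the filling and the letter counts fix the shape.
    generalize tab w = T at hT
    obtain ⟨ν, T⟩ := T
    have hTν : T = highestWeight a ν :=
      eq_highestWeight (fun c hc => hw c (hT.perm.mem_iff.mpr hc))
        fun i hi => hT.yamanouchiAt_iff.mp (h1 i hi)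
    subst hTν
    have hνμ : ν = μ := by
      ext ⟨i, j⟩
      rw [YoungDiagram.mem_cells, YoungDiagram.mem_cells, YoungDiagram.mem_iff_lt_rowLen,
        YoungDiagram.mem_iff_lt_rowLen, ← h2, hT.perm.count_eq, count_readingWord_highestWeight]
    rw [hνμ]

end HighestWeight

/-! ### The bracketing algorithm on words. -/

section Bracketing

variable {α β : Type}

/-- One step of the bracketing algorithm. -/
def bracketStep (letter : α → ℕ) (i : ℕ) (s : List α × List α) (c : α) : List α × List α :=
  if letter c = i + 1 then (s.1, c :: s.2)
  else if letter c = i then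
    match s.2 with
    | [] => (c :: s.1, [])
    | _ :: opens => (s.1, opens)
  else s

theorem unmatched_eq_foldl (letter : α → ℕ) (i : ℕ) (w : List α) :
    unmatched letter i w = w.foldl (bracketStep letter i) ([], []) := by
  rfl

theorem unmatched_map (letter : β → ℕ) (i : ℕ) (g : α → β) (w : List α) :
    unmatched letter i (w.map g) =
      ((unmatched (letter ∘ g) i w).1.map g, (unmatched (letter ∘ g) i w).2.map g) := by
  have key : ∀ (w : List α) (s : List α × List α),
      (w.map g).foldl (bracketStep letter i) (s.1.map g, s.2.map g) =
        ((w.foldl (bracketStep (letter ∘ g) i) s).1.map g,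
          (w.foldl (bracketStep (letter ∘ g) i) s).2.map g) := by
    intro w
    induction w with
    | nil => intro s; rfl
    | cons c w ih =>
      intro s
      rw [List.map_cons, List.foldl_cons, List.foldl_cons, ← ih]
      congr 1
      obtain ⟨s1, s2⟩ := s
      simp only [bracketStep, Function.comp_apply]
      split_ifs
      · rfl
      · cases s2 <;> rfl
      · rfl
  simpa [unmatched_eq_foldl] using key w ([], [])

/-- Words grow at the right end: a new opening bracket tightens the bound by one and a closing one
relaxes it by one, so `K` has to vary in the induction. -/
theorem length_unmatched_le_iff (i : ℕ) (w : List ℕ) (K : ℕ) :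
    (unmatched id i w).2.length ≤ K ↔ ∀ s, s <:+ w → s.count (i + 1) ≤ s.count i + K := by
  induction w using List.reverseRecOn generalizing K with
  | nil =>
    simp only [unmatched_eq_foldl, List.foldl_nil, List.length_nil, Nat.zero_le, true_iff]
    intro s hs
    rw [List.suffix_nil.mp hs]
    simp
  | append_singleton w c ih =>
    have hs : (∀ s, s <:+ w ++ [c] → s.count (i + 1) ≤ s.count i + K) ↔
        ∀ s, s <:+ w → (s ++ [c]).count (i + 1) ≤ (s ++ [c]).count i + K := by
      constructor
      · rintro h s ⟨t, rfl⟩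
        exact h _ ⟨t, by simp⟩
      · rintro h s ⟨t, ht⟩
        rcases s.eq_nil_or_concat with rfl | ⟨s', b, rfl⟩
        · simp
        · rw [List.concat_eq_append, ← List.append_assoc] at ht
          obtain ⟨h1, h2⟩ := List.append_inj' ht rfl
          rw [List.singleton_inj] at h2
          rw [List.concat_eq_append, h2]
          exact h s' ⟨t, h1⟩
    rw [hs, unmatched_eq_foldl, List.foldl_append, List.foldl_cons, List.foldl_nil,
      ← unmatched_eq_foldl]
    simp only [List.count_append, List.count_singleton, beq_iff_eq]
    by_cases h1 : c = i + 1
    · rw [bracketStep, if_pos (by exact h1)]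
      simp only [List.length_cons, h1]
      rcases K with _ | K
      · simp only [Nat.le_zero, Nat.add_one_ne_zero, false_iff, not_forall]
        -- The last letter alone is a suffix that violates the bound `0`.
        exact ⟨[], List.nil_suffix, by simp⟩
      · rw [Nat.add_le_add_iff_right, ih]
        refine forall₂_congr fun s _ => ?_
        simp
        omega
    · by_cases h2 : c = i
      · have hlen : (bracketStep id i (unmatched id i w) c).2.length ≤ K ↔
            (unmatched id i w).2.length ≤ K + 1 := by
          rw [bracketStep, if_neg (by exact h1), if_pos (by exact h2)]
          cases (unmatched id i w).2 <;> simp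
        rw [hlen, ih]
        refine forall₂_congr fun s _ => ?_
        simp [h2]
        omega
      · rw [bracketStep, if_neg (by exact h1), if_neg (by exact h2), ih]
        simp [h1, h2]

theorem foldl_bracketStep_open {letter : α → ℕ} {i : ℕ} {c : α} (hc : letter c = i + 1) (k : ℕ)
    (s : List α × List α) :
    (List.replicate k c).foldl (bracketStep letter i) s = (s.1, List.replicate k c ++ s.2) := by
  induction k generalizing s with
  | zero => rfl
  | succ k ih =>
    rw [List.replicate_succ, List.foldl_cons, bracketStep, if_pos hc, ih,
      ← List.replicate_succ, List.replicate_succ']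
    simp

theorem foldl_bracketStep_close {letter : α → ℕ} {i : ℕ} {c : α} (hc : letter c = i) (k : ℕ)
    (s : List α × List α) :
    (List.replicate k c).foldl (bracketStep letter i) s =
      (List.replicate (k - s.2.length) c ++ s.1, s.2.drop k) := by
  induction k generalizing s with
  | zero => simp
  | succ k ih =>
    rw [List.replicate_succ, List.foldl_cons, bracketStep, if_neg (by omega), if_pos hc]
    obtain ⟨s1, s2⟩ := s
    cases s2 with
    | nil =>
      rw [ih]
      simp [List.replicate_succ']
    | cons d s2 =>
      rw [ih]
      simp

theorem foldl_bracketStep_skip {letter : α → ℕ} {i : ℕ} {w : List α}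
    (hw : ∀ c ∈ w, letter c ≠ i ∧ letter c ≠ i + 1) (s : List α × List α) :
    w.foldl (bracketStep letter i) s = s := by
  induction w with
  | nil => rfl
  | cons c w ih =>
    have hc := hw c (by simp)
    rw [List.foldl_cons, bracketStep, if_neg hc.2, if_neg hc.1]
    exact ih fun d hd => hw d (by simp [hd])

end Bracketing

/-! ### The bicrystal operators agree with the operators on arrays. -/

section RowCells

variable {m n : ℕ}

/-- The entries of a matrix, extended by zero. -/
def entries (M : Matrix (Fin m) (Fin n) ℕ) : ℕ → ℕ → ℕ := fun p q =>
  if h : p < m ∧ q < n then M ⟨p, h.1⟩ ⟨q, h.2⟩ else 0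

theorem entries_apply (M : Matrix (Fin m) (Fin n) ℕ) (p : Fin m) (q : Fin n) :
    entries M p q = M p q := by
  rw [entries, dif_pos ⟨p.2, q.2⟩]

theorem entries_mk (M : Matrix (Fin m) (Fin n) ℕ) {p q : ℕ} (hp : p < m) (hq : q < n) :
    entries M p q = M ⟨p, hp⟩ ⟨q, hq⟩ := by
  rw [entries, dif_pos ⟨hp, hq⟩]

theorem entries_transpose (M : Matrix (Fin m) (Fin n) ℕ) :
    entries M.transpose = Function.swap (entries M) := by
  funext p q
  by_cases h : p < n ∧ q < m
  · rw [entries_mk _ h.1 h.2, Function.swap, entries_mk _ h.2 h.1, Matrix.transpose_apply]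
  · rw [entries, dif_neg h, Function.swap, entries, dif_neg fun h' => h h'.symm]

theorem entries_injective : Function.Injective (entries : Matrix (Fin m) (Fin n) ℕ → _) := by
  intro M N h
  ext p q
  rw [← entries_apply M p q, ← entries_apply N p q, h]

/-- The letter of a cell in the row word. -/
abbrev rowLetter (c : Fin m × Fin n) : ℕ := c.1

/-- Row `i` comes before row `i + 1` in a column: its closing brackets first consume pending opening
ones, then the new opening ones are stacked; all other rows are skipped. -/
theorem foldl_bracketStep_column (M : Matrix (Fin m) (Fin n) ℕ) {i : ℕ} (hi : i + 1 < m)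
    (j : Fin n) (s : List (Fin m × Fin n) × List (Fin m × Fin n)) :
    ((List.finRange m).flatMap fun p => List.replicate (M p j) (p, j)).foldl
        (bracketStep rowLetter i) s =
      (List.replicate (entries M i j - s.2.length) (⟨i, by omega⟩, j) ++ s.1,
        List.replicate (entries M (i + 1) j) (⟨i + 1, hi⟩, j) ++ s.2.drop (entries M i j)) := by
  have hpw := List.pairwise_lt_finRange m
  obtain ⟨L1, L2, hL⟩ := List.append_of_mem (List.mem_finRange (⟨i, by omega⟩ : Fin m))
  have hmem : (⟨i + 1, hi⟩ : Fin m) ∈ L2 := by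
    have h := List.mem_finRange (⟨i + 1, hi⟩ : Fin m)
    rw [hL] at h hpw
    rcases List.mem_append.mp h with h | h
    · have := (List.pairwise_append.mp hpw).2.2 _ h ⟨i, by omega⟩ (by simp)
      simp [Fin.lt_def] at this
    · simpa using h
  obtain ⟨L3, L4, hL'⟩ := List.append_of_mem hmem
  rw [hL, hL'] at hpw ⊢
  simp only [List.pairwise_append, List.pairwise_cons, List.mem_cons, List.mem_append] at hpw
  have skip : ∀ (L : List (Fin m)), (∀ p ∈ L, (p : ℕ) ≠ i ∧ (p : ℕ) ≠ i + 1) →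
      ∀ s, (L.flatMap fun p => List.replicate (M p j) (p, j)).foldl (bracketStep rowLetter i) s =
        s := by
    intro L hL s
    refine foldl_bracketStep_skip (fun c hc => ?_) s
    obtain ⟨p, hp, hc⟩ := List.mem_flatMap.mp hc
    rw [List.eq_of_mem_replicate hc]
    exact hL p hp
  obtain ⟨-, ⟨h34, -, ⟨h4, -⟩, h3⟩, h1⟩ := hpw
  rw [List.flatMap_append, List.foldl_append, skip L1, List.flatMap_cons, List.foldl_append,
    foldl_bracketStep_close (letter := rowLetter) (i := i) (c := ((⟨i, by omega⟩ : Fin m), j)) rfl,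
    List.flatMap_append, List.foldl_append, skip L3,
    List.flatMap_cons, List.foldl_append,
    foldl_bracketStep_open (letter := rowLetter) (i := i) (c := ((⟨i + 1, hi⟩ : Fin m), j)) rfl,
    skip L4,
    entries_mk M (by omega) j.2, entries_mk M hi j.2]
  · intro p hp
    have := h4 p hp
    simp only [Fin.lt_def] at this
    omega
  · intro p hp
    have h5 := h34 p (Or.inl hp)
    have h6 := h3 p hp ⟨i + 1, hi⟩ (Or.inl rfl)
    simp only [Fin.lt_def] at h5 h6
    omega
  · intro p hp
    have := h1 p hp ⟨i, by omega⟩ (Or.inl rfl)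
    simp only [Fin.lt_def] at this
    omega

theorem phi_succ (k i : ℕ) (A : ℕ → ℕ → ℕ) :
    phi (k + 1) i A = max (phi k i A) (height A i k).toNat := by
  rw [phi, Finset.range_add_one, Finset.sup_insert, sup_comm, ← phi]

theorem height_eq_excess_add (A : ℕ → ℕ → ℕ) (i k : ℕ) : height A i k = excess k A i + A i k := by
  rw [height, excess, pre_succ]
  ring

/-- The state of the bracketing algorithm after the first `k` columns. -/
theorem bracketing_take (M : Matrix (Fin m) (Fin n) ℕ) {i : ℕ} (hi : i + 1 < m) {k : ℕ}
    (hk : k ≤ n) {cl op : List (Fin m × Fin n)}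
    (hs : (((List.finRange n).take k).flatMap fun j => (List.finRange m).flatMap fun p =>
      List.replicate (M p j) (p, j)).foldl (bracketStep rowLetter i) ([], []) = (cl, op)) :
    cl.length = phi k i (entries M) ∧ op.length = eps k i (entries M) ∧
    (cl ≠ [] → ∃ a : Fin n, cl.head? = some (⟨i, by omega⟩, a) ∧ (a : ℕ) < k ∧
      (∀ c' < k, height (entries M) i c' ≤ height (entries M) i a) ∧
      ∀ c' < (a : ℕ), height (entries M) i c' < height (entries M) i a) ∧
    (op ≠ [] → ∃ c : Fin n, op.getLast? = some (⟨i + 1, hi⟩, c) ∧ (c : ℕ) < k ∧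
      (∀ c' < k, height (entries M) i c' ≤ height (entries M) i c) ∧
      ∀ c' < k, (c : ℕ) < c' → height (entries M) i c' < height (entries M) i c) := by
  induction k generalizing cl op with
  | zero =>
    simp only [List.take_zero, List.flatMap_nil, List.foldl_nil, Prod.mk.injEq] at hs
    obtain ⟨rfl, rfl⟩ := hs
    simp [phi, eps, excess, pre]
  | succ k ih =>
    set A := entries M with hA
    obtain ⟨⟨cl0, op0⟩, hs0⟩ : ∃ s, (((List.finRange n).take k).flatMap fun j =>
        (List.finRange m).flatMap fun p => List.replicate (M p j) (p, j)).foldl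
          (bracketStep rowLetter i) ([], []) = s := ⟨_, rfl⟩
    obtain ⟨h1, h2, h3, h4⟩ := ih (by omega) hs0
    have htake : (List.finRange n).take (k + 1) =
        (List.finRange n).take k ++ [(⟨k, hk⟩ : Fin n)] := by
      rw [List.take_add_one, List.getElem?_eq_getElem (by simpa using hk)]
      simp
    rw [htake, List.flatMap_append, List.foldl_append, hs0, List.flatMap_cons, List.flatMap_nil,
      List.append_nil, foldl_bracketStep_column M hi, ← hA] at hs
    simp only [Prod.mk.injEq] at hs
    obtain ⟨rfl, rfl⟩ := hs
    have hphi := phi_succ k i A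
    have heps := eps_cast k i A
    have heps' := eps_cast (k + 1) i A
    have hh := height_eq_excess_add A i k
    have hex := excess_succ A i k
    have hle : ∀ c' < k, height A i c' ≤ phi k i A := phi_le_iff.mp le_rfl
    refine ⟨?_, ?_, ?_, ?_⟩
    · rw [List.length_append, List.length_replicate]
      omega
    · rw [List.length_append, List.length_replicate, List.length_drop]
      omega
    · intro hne
      -- The column `k` leaves a closing bracket unmatched exactly when its height is a new strict
      -- maximum.
      by_cases hlt : op0.length < A i k
      · refine ⟨⟨k, hk⟩, ?_, k.lt_succ_self, fun c' hc' => ?_, fun c' hc' => ?_⟩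
        · rw [List.head?_append, List.head?_replicate, if_neg (by omega)]
          rfl
        · rcases (Nat.lt_succ_iff.mp hc').lt_or_eq with hc' | rfl
          · have := hle c' hc'
            simp only
            omega
          · exact le_rfl
        · have := hle c' hc'
          simp only
          omega
      · have hzero : A i k - op0.length = 0 := by omega
        simp only [hzero, List.replicate_zero, List.nil_append] at hne ⊢
        obtain ⟨a, ha1, ha2, ha3, ha4⟩ := h3 hne
        refine ⟨a, ha1, by omega, fun c' hc' => ?_, ha4⟩
        rcases (Nat.lt_succ_iff.mp hc').lt_or_eq with hc' | rfl
        · exact ha3 c' hc'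
        · have := phi_eq_height ha2 ha3
          omega
    · intro hne
      -- If an old opening bracket survives, the height at `k` is below the maximum; otherwise `k`
      -- becomes the last maximum.
      by_cases hlt : A i k < op0.length
      · have hop : op0 ≠ [] := by
          rintro rfl
          simp at hlt
        obtain ⟨c, hc1, hc2, hc3, hc4⟩ := h4 hop
        have hkc : height A i k < height A i c := by
          have := phi_eq_height hc2 hc3
          omega
        refine ⟨c, ?_, by omega, fun c' hc' => ?_, fun c' hc' hcc => ?_⟩
        · rw [List.getLast?_append, List.getLast?_drop, if_neg (by omega), hc1]
          rfl
        · rcases (Nat.lt_succ_iff.mp hc').lt_or_eq with hc' | rfl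
          · exact hc3 c' hc'
          · exact hkc.le
        · rcases (Nat.lt_succ_iff.mp hc').lt_or_eq with hc' | rfl
          · exact hc4 c' hc' hcc
          · exact hkc
      · have hdrop : op0.drop (A i k) = [] := List.drop_eq_nil_of_le (by omega)
        simp only [hdrop, List.append_nil] at hne ⊢
        refine ⟨⟨k, hk⟩, ?_, k.lt_succ_self, fun c' hc' => ?_, fun c' hc' hcc => ?_⟩
        · rw [List.getLast?_replicate, if_neg]
          intro h0
          simp [h0] at hne
        · rcases (Nat.lt_succ_iff.mp hc').lt_or_eq with hc' | rfl
          · have := hle c' hc'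
            simp only
            omega
          · exact le_rfl
        · simp only at hcc
          omega

theorem bracketing_rowCells (M : Matrix (Fin m) (Fin n) ℕ) {i : ℕ} (hi : i + 1 < m) :
    (unmatched rowLetter i (rowCells M)).1.length = phi n i (entries M) ∧
    (unmatched rowLetter i (rowCells M)).2.length = eps n i (entries M) ∧
    ((unmatched rowLetter i (rowCells M)).1 ≠ [] → ∃ a : Fin n,
      (unmatched rowLetter i (rowCells M)).1.head? = some (⟨i, by omega⟩, a) ∧
      (∀ c' < n, height (entries M) i c' ≤ height (entries M) i a) ∧
      ∀ c' < (a : ℕ), height (entries M) i c' < height (entries M) i a) ∧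
    ((unmatched rowLetter i (rowCells M)).2 ≠ [] → ∃ c : Fin n,
      (unmatched rowLetter i (rowCells M)).2.getLast? = some (⟨i + 1, hi⟩, c) ∧
      (∀ c' < n, height (entries M) i c' ≤ height (entries M) i c) ∧
      ∀ c' < n, (c : ℕ) < c' → height (entries M) i c' < height (entries M) i c) := by
  have htake : (List.finRange n).take n = List.finRange n := by
    rw [List.take_of_length_le]
    simp
  have h := bracketing_take M hi le_rfl (cl := (unmatched rowLetter i (rowCells M)).1)
    (op := (unmatched rowLetter i (rowCells M)).2) (by
      rw [htake, unmatched_eq_foldl]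
      rfl)
  obtain ⟨h1, h2, h3, h4⟩ := h
  refine ⟨h1, h2, fun hne => ?_, fun hne => ?_⟩
  · obtain ⟨a, ha1, -, ha3, ha4⟩ := h3 hne
    exact ⟨a, ha1, ha3, ha4⟩
  · obtain ⟨c, hc1, -, hc3, hc4⟩ := h4 hne
    exact ⟨c, hc1, hc3, hc4⟩

theorem exists_eRow_eq {M : Matrix (Fin m) (Fin n) ℕ} {i : ℕ} (hi : i + 1 < m) {B : ℕ → ℕ → ℕ}
    (h : Raise n i (entries M) B) : ∃ N, eRow i M = some N ∧ entries N = B := by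
  obtain ⟨-, hlen, -, hop⟩ := bracketing_rowCells M hi
  have heps := (isString_raise n i).eps_eq h
  obtain ⟨c, hc1, hc2, hc3⟩ := hop fun h0 => by
    rw [h0, heps] at hlen
    simp at hlen
  refine ⟨_, by rw [eRow, hc1]; rfl, ?_⟩
  have hR : Raise n i (entries M) (raiseAt i c (entries M)) := by
    refine ⟨c, c.2, hc2, hc3, ?_, rfl⟩
    have h1 := phi_eq_height c.2 hc2
    have h2 := eps_cast n i (entries M)
    omega
  rw [(isString_raise n i).right_unique h hR]
  funext p q
  by_cases hpq : p < m ∧ q < n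
  · rw [entries_mk _ hpq.1 hpq.2, raiseAt, entries_mk _ hpq.1 hpq.2]
    simp [Fin.ext_iff]
  · rw [entries, dif_neg hpq, raiseAt, if_neg, if_neg, entries, dif_neg hpq]
    · rintro ⟨rfl, rfl⟩
      exact hpq ⟨by omega, c.2⟩
    · rintro ⟨rfl, rfl⟩
      exact hpq ⟨hi, c.2⟩

theorem exists_fRow_eq {M : Matrix (Fin m) (Fin n) ℕ} {i : ℕ} (hi : i + 1 < m) {B : ℕ → ℕ → ℕ}
    (h : Raise n i B (entries M)) : ∃ N, fRow i M = some N ∧ entries N = B := by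
  obtain ⟨hlen, -, hcl, -⟩ := bracketing_rowCells M hi
  have hphi := (isString_raise n i).phi_eq h
  obtain ⟨a, ha1, ha2, ha3⟩ := hcl fun h0 => by
    rw [h0, hphi] at hlen
    simp at hlen
  refine ⟨_, by rw [fRow, ha1]; rfl, ?_⟩
  have hR : Raise n i (lowerAt i a (entries M)) (entries M) := by
    refine raise_iff.mpr ⟨a, a.2, ha2, ha3, ?_, rfl⟩
    have h1 := phi_eq_height a.2 ha2
    omega
  rw [(isString_raise n i).left_unique h hR]
  funext p q
  by_cases hpq : p < m ∧ q < n
  · rw [entries_mk _ hpq.1 hpq.2, lowerAt, entries_mk _ hpq.1 hpq.2]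
    simp [Fin.ext_iff]
  · rw [entries, dif_neg hpq, lowerAt, if_neg, if_neg, entries, dif_neg hpq]
    · rintro ⟨rfl, rfl⟩
      exact hpq ⟨hi, a.2⟩
    · rintro ⟨rfl, rfl⟩
      exact hpq ⟨by omega, a.2⟩

/-- Transposition reduces the column operators and the column word to the row case. -/
theorem colCells_eq (M : Matrix (Fin m) (Fin n) ℕ) :
    colCells M = (rowCells M.transpose).map Prod.swap := by
  simp [colCells, rowCells, List.map_flatMap]

theorem eCol_eq (j : ℕ) (M : Matrix (Fin m) (Fin n) ℕ) :
    eCol j M = (eRow j M.transpose).map Matrix.transpose := by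
  rw [eCol, colCells_eq, unmatched_map, List.getLast?_map, eRow, Option.map_map, Option.map_map]
  rfl

theorem fCol_eq (j : ℕ) (M : Matrix (Fin m) (Fin n) ℕ) :
    fCol j M = (fRow j M.transpose).map Matrix.transpose := by
  rw [fCol, colCells_eq, unmatched_map, List.head?_map, fRow, Option.map_map, Option.map_map]
  rfl

theorem colWord_eq (M : Matrix (Fin m) (Fin n) ℕ) : colWord M = rowWord M.transpose := by
  rw [colWord, colCells_eq, List.map_map, rowWord]
  rfl

/-- Both sides say that no opening bracket is unmatched, that is `eps = 0`. -/
theorem yamanouchiAt_rowWord_iff (M : Matrix (Fin m) (Fin n) ℕ) {i : ℕ} (hi : i + 1 < m) :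
    YamanouchiAt i (rowWord M) ↔
      ∀ c < n, height (entries M) i c ≤ excess n (entries M) i := by
  have h1 := length_unmatched_le_iff i (rowWord M) 0
  rw [rowWord, unmatched_map] at h1
  have h2 := (bracketing_rowCells M hi).2.1
  have h3 : (unmatched (id ∘ fun c : Fin m × Fin n => (c.1 : ℕ)) i (rowCells M)).2.length =
      eps n i (entries M) := h2
  simp only [List.length_map, h3, add_zero] at h1
  refine Iff.trans h1.symm ?_
  have h4 := eps_cast n i (entries M)
  constructor
  · intro h c hc
    have := phi_le_iff.mp (le_refl (phi n i (entries M))) c hc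
    omega
  · intro h
    rcases n.eq_zero_or_pos with rfl | hn
    · simp [phi, excess, pre] at h4
      omega
    · obtain ⟨c, hc, hmax, -⟩ := exists_last_max (height (entries M) i) hn
      have h5 := phi_eq_height hc hmax
      have h6 := h c hc
      omega

theorem count_rowWord (M : Matrix (Fin m) (Fin n) ℕ) (p : ℕ) :
    ((rowWord M).count p : ℤ) = pre (entries M) p n := by
  have h1 : ∀ j : Fin n, (((List.finRange m).flatMap fun i =>
      List.replicate (M i j) ((i, j) : Fin m × Fin n)).map fun c => (c.1 : ℕ)).count p =
        entries M p j := by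
    intro j
    rw [List.map_flatMap, List.count_flatMap]
    have h2 : (List.count p ∘ fun i : Fin m => List.map (fun c : Fin m × Fin n => (c.1 : ℕ))
        (List.replicate (M i j) (i, j))) = fun i : Fin m => if (i : ℕ) = p then M i j else 0 := by
      funext i
      simp [List.count_replicate]
    rw [h2, ← List.ofFn_eq_map, List.sum_ofFn]
    by_cases hp : p < m
    · rw [Finset.sum_eq_single (⟨p, hp⟩ : Fin m)]
      · rw [if_pos rfl, entries_mk M hp j.2]
      · intro i _ hne
        exact if_neg fun h => hne (Fin.ext h)
      · simp
    · rw [entries, dif_neg fun h => hp h.1]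
      refine Finset.sum_eq_zero fun i _ => if_neg ?_
      have := i.2
      omega
  rw [rowWord, rowCells, List.map_flatMap, List.count_flatMap]
  have h3 : (List.count p ∘ fun j : Fin n => List.map (fun c : Fin m × Fin n => (c.1 : ℕ))
      ((List.finRange m).flatMap fun i => List.replicate (M i j) (i, j))) =
        fun j : Fin n => entries M p j := by
    funext j
    exact h1 j
  rw [h3, ← List.ofFn_eq_map, List.sum_ofFn, pre, Finset.sum_range]
  push_cast
  rfl

end RowCells

/-! ### Filtered RSK, block shapes and weights. -/

section BlockShapes

variable {m n : ℕ}

/-- Suffixes of a filtered word are filtered suffixes, and the two relevant letters are kept. -/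
theorem yamanouchiAt_filter_iff {P : ℕ → Bool} {i : ℕ} (h1 : P i) (h2 : P (i + 1)) (w : List ℕ) :
    YamanouchiAt i (w.filter P) ↔ YamanouchiAt i w := by
  constructor
  · intro h s hs
    have := h _ (hs.filter P)
    rwa [List.count_filter h1, List.count_filter h2] at this
  · intro h s hs
    obtain ⟨s', hs', rfl⟩ := List.suffix_filter_iff.mp hs
    rw [List.count_filter h1, List.count_filter h2]
    exact h _ hs'

theorem sizeUpTo_add_blocksFun_le (I : Composition m) (k : Fin I.length) :
    I.sizeUpTo k + I.blocksFun k ≤ m := by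
  rw [← I.sizeUpTo_succ' k]
  exact I.sizeUpTo_le _

theorem tab_filter_rowWord_eq_iff (M : Matrix (Fin m) (Fin n) ℕ) {a l : ℕ} (hle : a + l ≤ m)
    {P : ℕ → Bool} (hP : ∀ c, P c ↔ a ≤ c ∧ c < a + l)
    (μ : {μ : YoungDiagram // μ.colLen 0 ≤ l}) :
    tab ((rowWord M).filter P) = ⟨μ.1, highestWeight a μ.1⟩ ↔
      IsHighest n a l (entries M) ∧ shapeOf (rowSums n a l (entries M)) = μ := by
  have hmem : ∀ c ∈ (rowWord M).filter P, a ≤ c ∧ c < a + l := fun c hc =>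
    (hP c).mp (List.mem_filter.mp hc).2
  have hP' : ∀ p, p < l → P (a + p) := fun p hp => (hP _).mpr ⟨by omega, by omega⟩
  rw [tab_eq_highestWeight_iff fun c hc => (hmem c hc).1]
  have hY : (∀ i, a ≤ i → YamanouchiAt i ((rowWord M).filter P)) ↔
      IsHighest n a l (entries M) := by
    constructor
    · intro h i hi
      refine (yamanouchiAt_rowWord_iff M (by omega)).mp ?_
      exact (yamanouchiAt_filter_iff (hP' i (by omega)) (hP' (i + 1) hi) _).mp
        (h (a + i) (by omega))
    · intro h i hi
      obtain ⟨i, rfl⟩ := Nat.exists_eq_add_of_le hi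
      by_cases hil : i + 1 < l
      · exact (yamanouchiAt_filter_iff (hP' i (by omega)) (hP' (i + 1) hil) _).mpr
          ((yamanouchiAt_rowWord_iff M (by omega)).mpr (h i hil))
      -- For `i + 1 ≥ l` the letter `a + i + 1` lies beyond the block and does not occur.
      · intro s hs
        rw [List.count_eq_zero.mpr]
        · exact Nat.zero_le _
        · intro hc
          have := (hmem _ (hs.subset hc)).2
          omega
  have hC : (∀ p, ((rowWord M).filter P).count (a + p) = μ.1.rowLen p) ↔
      ∀ p : Fin l, μ.1.rowLen p = rowSums n a l (entries M) p := by
    have hcount : ∀ p : Fin l,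
        ((rowWord M).filter P).count (a + p) = rowSums n a l (entries M) p := by
      intro p
      have h1 := count_rowWord M (a + p)
      rw [← cast_rowSums, Nat.cast_inj] at h1
      rw [← h1]
      exact List.count_filter (hP' p p.2)
    constructor
    · intro h p
      rw [← h, hcount]
    · intro h p
      by_cases hp : p < l
      · rw [hcount ⟨p, hp⟩, ← h]
      · rw [List.count_eq_zero.mpr fun hc => by have := (hmem _ hc).2; omega]
        have hμ := μ.2
        by_contra hne
        have : (p, 0) ∈ μ.1 := YoungDiagram.mem_iff_lt_rowLen.mpr (by omega)
        have := YoungDiagram.mem_iff_lt_colLen.mp this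
        omega
  rw [hY, hC]
  refine and_congr_right fun h => ⟨shapeOf_eq, ?_⟩
  rintro rfl p
  exact rowLen_shapeOf h.antitone p

theorem tab_filterWord_eq_iff (I : Composition m) (M : Matrix (Fin m) (Fin n) ℕ)
    (k : Fin I.length) (μ : {μ : YoungDiagram // μ.colLen 0 ≤ I.blocksFun k}) :
    tab (filterWord I (rowWord M) k) = ⟨μ.1, highestWeight (I.sizeUpTo k) μ.1⟩ ↔
      IsHighest n (I.sizeUpTo k) (I.blocksFun k) (entries M) ∧
        shapeOf (rowSums n (I.sizeUpTo k) (I.blocksFun k) (entries M)) = μ :=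
  tab_filter_rowWord_eq_iff M (sizeUpTo_add_blocksFun_le I k)
    (fun c => by rw [decide_eq_true_eq, I.sizeUpTo_succ']) μ

/-- All row blocks of the array are of highest weight. -/
def AllHighest (I : Composition m) (n : ℕ) (A : ℕ → ℕ → ℕ) : Prop :=
  ∀ k : Fin I.length, IsHighest n (I.sizeUpTo k) (I.blocksFun k) A

/-- The shapes formed by the row sums in the row blocks. -/
noncomputable def shapes (I : Composition m) (n : ℕ) (A : ℕ → ℕ → ℕ) : PartitionTuple I :=
  fun k => shapeOf (rowSums n (I.sizeUpTo k) (I.blocksFun k) A)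

theorem filterRSK_eq_iff (I : Composition m) (J : Composition n) (M : Matrix (Fin m) (Fin n) ℕ)
    (lam : PartitionTuple I) (mu : PartitionTuple J) :
    filterRSK I J M = (highestWeightTuple I lam, highestWeightTuple J mu) ↔
      (AllHighest I n (entries M) ∧ AllHighest J m (Function.swap (entries M))) ∧
        shapes I n (entries M) = lam ∧ shapes J m (Function.swap (entries M)) = mu := by
  simp only [filterRSK, highestWeightTuple, Prod.mk.injEq, funext_iff, colWord_eq,
    tab_filterWord_eq_iff, AllHighest, shapes, entries_transpose, forall_and]
  tauto

theorem matrixWeight_inl_embedding (I : Composition m) (M : Matrix (Fin m) (Fin n) ℕ)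
    (k : Fin I.length) (p : Fin (I.blocksFun k)) :
    matrixWeight M (Sum.inl (I.embedding k p)) =
      rowSums n (I.sizeUpTo k) (I.blocksFun k) (entries M) p := by
  rw [matrixWeight, Sum.elim_inl, rowSums, Finset.sum_range]
  refine Finset.sum_congr rfl fun q _ => ?_
  rw [← entries_apply M (I.embedding k p) q, I.coe_embedding]

theorem matrixWeight_transpose (M : Matrix (Fin m) (Fin n) ℕ) (x : Fin m ⊕ Fin n) :
    matrixWeight M.transpose x.swap = matrixWeight M x := by
  cases x <;> rfl

theorem matrixWeight_inr_embedding (J : Composition n) (M : Matrix (Fin m) (Fin n) ℕ)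
    (k : Fin J.length) (p : Fin (J.blocksFun k)) :
    matrixWeight M (Sum.inr (J.embedding k p)) =
      rowSums m (J.sizeUpTo k) (J.blocksFun k) (Function.swap (entries M)) p := by
  rw [← entries_transpose, ← matrixWeight_inl_embedding, ← matrixWeight_transpose]
  rfl

/-- The weight of a highest weight matrix is determined by its shapes. -/
theorem matrixWeight_eq_of_shapes_eq (I : Composition m) (J : Composition n)
    {M N : Matrix (Fin m) (Fin n) ℕ} (hM : AllHighest I n (entries M))
    (hM' : AllHighest J m (Function.swap (entries M))) (hN : AllHighest I n (entries N))
    (hN' : AllHighest J m (Function.swap (entries N)))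
    (h : shapes I n (entries M) = shapes I n (entries N))
    (h' : shapes J m (Function.swap (entries M)) = shapes J m (Function.swap (entries N))) :
    matrixWeight M = matrixWeight N := by
  funext x
  rcases x with p | q
  · rw [← I.embedding_comp_inv p, matrixWeight_inl_embedding, matrixWeight_inl_embedding,
      ← rowLen_shapeOf (hM _).antitone, ← rowLen_shapeOf (hN _).antitone]
    exact congrArg (fun μ : {μ : YoungDiagram // μ.colLen 0 ≤ I.blocksFun _} => μ.1.rowLen _)
      (congrFun h (I.index p))
  · rw [← J.embedding_comp_inv q, matrixWeight_inr_embedding, matrixWeight_inr_embedding,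
      ← rowLen_shapeOf (hM' _).antitone, ← rowLen_shapeOf (hN' _).antitone]
    exact congrArg (fun μ : {μ : YoungDiagram // μ.colLen 0 ≤ J.blocksFun _} => μ.1.rowLen _)
      (congrFun h' (J.index q))

theorem sum_matrixWeight_inr (M : Matrix (Fin m) (Fin n) ℕ) :
    ∑ x, matrixWeight M x = 2 * ∑ q, matrixWeight M (Sum.inr q) := by
  rw [Fintype.sum_sum_type, two_mul]
  congr 1
  exact Finset.sum_comm (f := fun p q => M p q) (s := Finset.univ) (t := Finset.univ)

theorem cast_matrixWeight_inl (M : Matrix (Fin m) (Fin n) ℕ) (p : Fin m) :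
    (matrixWeight M (Sum.inl p) : ℤ) = pre (entries M) p n := by
  rw [matrixWeight, Sum.elim_inl, pre, Finset.sum_range]
  push_cast
  exact Finset.sum_congr rfl fun q _ => by rw [entries_apply]

theorem cast_matrixWeight_inr (M : Matrix (Fin m) (Fin n) ℕ) (q : Fin n) :
    (matrixWeight M (Sum.inr q) : ℤ) = pre (Function.swap (entries M)) q m := by
  rw [← entries_transpose, ← cast_matrixWeight_inl]
  rfl

/-- The total weight is twice the sum of the column sums, which row operators preserve. This allows
working in one degree at a time. -/
theorem Raise.sum_matrixWeight_eq {M N : Matrix (Fin m) (Fin n) ℕ} {i : ℕ} (hi : i + 1 < m)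
    (h : Raise n i (entries M) (entries N)) :
    ∑ x, matrixWeight M x = ∑ x, matrixWeight N x := by
  rw [sum_matrixWeight_inr, sum_matrixWeight_inr]
  congr 1
  refine Finset.sum_congr rfl fun q _ => ?_
  rw [← Nat.cast_inj (R := ℤ), cast_matrixWeight_inr, cast_matrixWeight_inr, h.pre_swap hi]

end BlockShapes

/-! ### Degrees of split-Schur polynomials. -/

section Homogeneity

variable {m n : ℕ}

theorem isHomogeneous_schur (μ : YoungDiagram) (k : ℕ) : (schur μ k).IsHomogeneous μ.card := by
  refine MvPolynomial.IsHomogeneous.sum _ _ _ fun T _ => ?_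
  have h : μ.card = ∑ i : Fin k, (μ.cells.filter fun c => T.1 c.1 c.2 = (i : ℕ)).card := by
    rw [Finset.sum_fin_eq_sum_range, YoungDiagram.card,
      Finset.card_eq_sum_card_fiberwise (f := fun c => T.1 c.1 c.2) (t := Finset.range k)
        fun c hc => Finset.mem_coe.mpr (Finset.mem_range.mpr (T.2 c hc))]
    refine Finset.sum_congr rfl fun i hi => ?_
    rw [dif_pos (Finset.mem_range.mp hi)]
  rw [h]
  exact MvPolynomial.IsHomogeneous.prod _ _ _ fun i _ => MvPolynomial.isHomogeneous_X_pow _ _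

theorem card_eq_sum_rowLen {μ : YoungDiagram} {l : ℕ} (hμ : μ.colLen 0 ≤ l) :
    μ.card = ∑ p : Fin l, μ.rowLen p := by
  rw [YoungDiagram.card, Finset.card_eq_sum_card_fiberwise (f := Prod.fst) (t := Finset.range l),
    Finset.sum_range]
  · refine Finset.sum_congr rfl fun p _ => ?_
    rw [YoungDiagram.rowLen_eq_card]
    rfl
  · intro c hc
    have h1 := YoungDiagram.mem_iff_lt_colLen.mp (show (c.1, c.2) ∈ μ from hc)
    have h2 := μ.colLen_anti 0 c.2 (Nat.zero_le _)
    exact Finset.mem_coe.mpr (Finset.mem_range.mpr (by omega))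

theorem isHomogeneous_splitSchur (I : Composition m) (lam : PartitionTuple I) :
    (splitSchur I lam).IsHomogeneous (∑ k, (lam k).1.card) :=
  MvPolynomial.IsHomogeneous.prod _ _ _ fun _ _ => (isHomogeneous_schur _ _).rename_isHomogeneous

theorem sum_card_shapes {I : Composition m} {M : Matrix (Fin m) (Fin n) ℕ}
    (hM : AllHighest I n (entries M)) :
    ∑ k, (shapes I n (entries M) k).1.card = ∑ p, matrixWeight M (Sum.inl p) := by
  rw [← I.blocksFinEquiv.sum_comp, Fintype.sum_sigma]
  refine Finset.sum_congr rfl fun k _ => ?_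
  rw [card_eq_sum_rowLen (shapes I n (entries M) k).2]
  refine Finset.sum_congr rfl fun p _ => ?_
  exact (rowLen_shapeOf (hM k).antitone p).trans (matrixWeight_inl_embedding I M k p).symm

/-- The shapes of a highest weight matrix consist of its row and column sums, so each size is the
sum of entries of the corresponding blocks. -/
theorem isHomogeneous_splitSchurProd_shapes {I : Composition m} {J : Composition n}
    {M : Matrix (Fin m) (Fin n) ℕ} (hM : AllHighest I n (entries M))
    (hM' : AllHighest J m (Function.swap (entries M))) :
    (splitSchurProd I J (shapes I n (entries M))
      (shapes J m (Function.swap (entries M)))).IsHomogeneous (∑ x, matrixWeight M x) := by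
  rw [Fintype.sum_sum_type, ← sum_card_shapes hM]
  have h : ∑ k, (shapes J m (Function.swap (entries M)) k).1.card =
      ∑ q, matrixWeight M (Sum.inr q) := by
    rw [← entries_transpose] at hM' ⊢
    exact sum_card_shapes hM'
  rw [← h]
  exact (isHomogeneous_splitSchur I _).rename_isHomogeneous.mul
    (isHomogeneous_splitSchur J _).rename_isHomogeneous

end Homogeneity

/-! ### Independence of the blocks. -/

section BlockStatistics

variable {m n : ℕ}

/-- The row sums of a block, and whether the block is of highest weight. -/
def blockStat (n a l : ℕ) (A : ℕ → ℕ → ℕ) : (ℕ → ℕ) × Prop :=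
  -- Padding by zero gives the statistics of all blocks the same type.
  (fun p => if h : p < l then rowSums n a l A ⟨p, h⟩ else 0, IsHighest n a l A)

theorem blockStat_fst (n a l : ℕ) (A : ℕ → ℕ → ℕ) :
    (fun p : Fin l => (blockStat n a l A).1 p) = rowSums n a l A := by
  funext p
  exact dif_pos p.2

theorem blockStat_eq_of_pre_eq {n a l : ℕ} {A B : ℕ → ℕ → ℕ}
    (h : ∀ p < l, pre A (a + p) n = pre B (a + p) n)
    (h' : ∀ p, p + 1 < l → ((∀ c < n, height A (a + p) c ≤ excess n A (a + p)) ↔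
      ∀ c < n, height B (a + p) c ≤ excess n B (a + p))) :
    blockStat n a l A = blockStat n a l B := by
  refine Prod.ext (funext fun p => ?_) (propext (forall₂_congr h'))
  by_cases hp : p < l
  · simp only [blockStat, dif_pos hp]
    rw [← Nat.cast_inj (R := ℤ), cast_rowSums, cast_rowSums]
    exact h p hp
  · simp only [blockStat, dif_neg hp]

theorem Raise.blockStat_eq {n i a l : ℕ} {A B : ℕ → ℕ → ℕ} (h : Raise n i A B)
    (hd : ∀ p < l, a + p ≠ i ∧ a + p ≠ i + 1) : blockStat n a l A = blockStat n a l B := by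
  have hpre : ∀ p < l, ∀ k, pre B (a + p) k = pre A (a + p) k := fun p hp k =>
    h.pre_of_ne (hd p hp).1 (hd p hp).2 k
  refine blockStat_eq_of_pre_eq (fun p hp => (hpre p hp n).symm) fun p hp => ?_
  have h1 := hpre p (by omega)
  have h2 := hpre (p + 1) hp
  simp only [height, excess, h1, add_assoc, h2]

/-- The column sums are preserved, hence the excesses; the bounds on the column heights are
preserved by the commutation of the two crystal structures. -/
theorem Raise.blockStat_swap_eq {m n i a l : ℕ} {A B : ℕ → ℕ → ℕ} (h : Raise n i A B)
    (hi : i + 1 < m) (hl : a + l ≤ n) :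
    blockStat m a l (Function.swap A) = blockStat m a l (Function.swap B) := by
  refine blockStat_eq_of_pre_eq (fun p hp => (h.pre_swap hi _).symm) fun p hp => ?_
  have h1 := h.height_swap_le_iff hi (j := a + p) (by omega)
    (excess m (Function.swap A) (a + p))
  have h2 : excess m (Function.swap B) (a + p) = excess m (Function.swap A) (a + p) := by
    rw [excess, excess, h.pre_swap hi, h.pre_swap hi]
  rw [h2]
  exact h1

end BlockStatistics

/-! ### The Cauchy identity for finite closed sets of arrays. -/

section BlockSums

variable {m n : ℕ}

open Classical in
/-- The character of a finite set of arrays that is closed under the row operators of the blocks of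
`I` and the column operators of the blocks of `J`. -/
theorem sum_prod_xMonomial_blocks (I : Composition m) (J : Composition n)
    (F : Finset (ℕ → ℕ → ℕ))
    (hrow : ∀ (k : Fin I.length) (i), i + 1 < I.blocksFun k → ∀ A B,
      Raise n (I.sizeUpTo k + i) A B → (A ∈ F ↔ B ∈ F))
    (hcol : ∀ (k : Fin J.length) (j), j + 1 < J.blocksFun k → ∀ A B,
      Raise m (J.sizeUpTo k + j) A B → (Function.swap A ∈ F ↔ Function.swap B ∈ F)) :
    ∑ A ∈ F, (MvPolynomial.rename (Sum.inl : Fin m → Fin m ⊕ Fin n)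
        (∏ k, MvPolynomial.rename (I.embedding k)
          (xMonomial (rowSums n (I.sizeUpTo k) (I.blocksFun k) A))) *
      MvPolynomial.rename (Sum.inr : Fin n → Fin m ⊕ Fin n)
        (∏ k, MvPolynomial.rename (J.embedding k)
          (xMonomial (rowSums m (J.sizeUpTo k) (J.blocksFun k) (Function.swap A))))) =
      ∑ A ∈ F, if AllHighest I n A ∧ AllHighest J m (Function.swap A) then
        splitSchurProd I J (shapes I n A) (shapes J m (Function.swap A)) else 0 := by
  let τ : Fin I.length ⊕ Fin J.length → (ℕ → ℕ → ℕ) → (ℕ → ℕ) × Prop :=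
    Sum.elim (fun k A => blockStat n (I.sizeUpTo k) (I.blocksFun k) A)
      (fun k A => blockStat m (J.sizeUpTo k) (J.blocksFun k) (Function.swap A))
  let u : Fin I.length ⊕ Fin J.length → (ℕ → ℕ) × Prop → MvPolynomial (Fin m ⊕ Fin n) ℤ :=
    Sum.elim (fun k s => MvPolynomial.rename Sum.inl (MvPolynomial.rename (I.embedding k)
        (xMonomial fun p : Fin (I.blocksFun k) => s.1 p)))
      (fun k s => MvPolynomial.rename Sum.inr (MvPolynomial.rename (J.embedding k)
        (xMonomial fun p : Fin (J.blocksFun k) => s.1 p)))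
  let v : Fin I.length ⊕ Fin J.length → (ℕ → ℕ) × Prop → MvPolynomial (Fin m ⊕ Fin n) ℤ :=
    Sum.elim (fun k s => MvPolynomial.rename Sum.inl (MvPolynomial.rename (I.embedding k)
        (if s.2 then schur (shapeOf fun p : Fin (I.blocksFun k) => s.1 p).1 (I.blocksFun k) else 0)))
      (fun k s => MvPolynomial.rename Sum.inr (MvPolynomial.rename (J.embedding k)
        (if s.2 then schur (shapeOf fun p : Fin (J.blocksFun k) => s.1 p).1 (J.blocksFun k)
          else 0)))
  have key := sum_prod_eq_sum_prod F τ u v ?_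
  · simp only [Fintype.prod_sum_type, τ, u, v, Sum.elim_inl, Sum.elim_inr, blockStat_fst] at key
    simp only [map_prod]
    refine key.trans (Finset.sum_congr rfl fun A _ => ?_)
    have h2 : ∀ a n l B, (blockStat n a l B).2 ↔ IsHighest n a l B := fun _ _ _ _ => Iff.rfl
    split_ifs with h
    · rw [splitSchurProd, splitSchur, splitSchur, map_prod, map_prod]
      congr 1
      · exact Finset.prod_congr rfl fun k _ => by rw [if_pos ((h2 _ _ _ _).mpr (h.1 k))]; rfl
      · exact Finset.prod_congr rfl fun k _ => by rw [if_pos ((h2 _ _ _ _).mpr (h.2 k))]; rfl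
    · by_cases hI : AllHighest I n A
      · have hJ : ¬AllHighest J m (Function.swap A) := fun hJ => h ⟨hI, hJ⟩
        obtain ⟨k, hk⟩ := not_forall.mp hJ
        rw [Finset.prod_eq_zero (f := fun k => MvPolynomial.rename Sum.inr
          (MvPolynomial.rename (J.embedding k) _)) (Finset.mem_univ k), mul_zero]
        rw [if_neg ((h2 _ _ _ _).not.mpr hk), map_zero, map_zero]
      · obtain ⟨k, hk⟩ := not_forall.mp hI
        rw [Finset.prod_eq_zero (f := fun k => MvPolynomial.rename Sum.inl
          (MvPolynomial.rename (I.embedding k) _)) (Finset.mem_univ k), zero_mul]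
        rw [if_neg ((h2 _ _ _ _).not.mpr hk), map_zero, map_zero]
  · rintro (k | k) A₀ - C hC
    · simp only [τ, u, v, Sum.elim_inl, blockStat_fst]
      simp only [← map_sum]
      congr 2
      -- The slice `C`, where the statistics of the other blocks are fixed, is closed under the
      -- operators of the block `k`, because these do not change the other statistics.
      refine sum_xMonomial_rowSums n _ _ C fun i hi A B h => ?_
      rw [hC, hC, hrow k i hi A B h]
      refine and_congr_right fun _ => forall₂_congr fun k' hk' => ?_
      suffices hτ : τ k' A = τ k' B by rw [hτ]
      rcases k' with k' | k'
      · refine h.blockStat_eq fun p hp => ?_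
        have hne : k' ≠ k := fun e => hk' (by rw [e])
        have hd : ∀ q : ℕ, ∀ hq : q < I.blocksFun k, I.sizeUpTo k' + p ≠ I.sizeUpTo k + q := by
          intro q hq he
          have := congrArg I.index (show I.embedding k' ⟨p, hp⟩ = I.embedding k ⟨q, hq⟩ from
            Fin.ext (by simpa using he))
          rw [I.index_embedding, I.index_embedding] at this
          exact hne this
        exact ⟨hd i (by omega), hd (i + 1) hi⟩
      · have := sizeUpTo_add_blocksFun_le I k
        exact h.blockStat_swap_eq (m := m) (by omega) (sizeUpTo_add_blocksFun_le J k')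
    · simp only [τ, u, v, Sum.elim_inr, blockStat_fst]
      simp only [← map_sum]
      congr 2
      have hinj : Function.Injective (Function.swap : (ℕ → ℕ → ℕ) → ℕ → ℕ → ℕ) :=
        Function.LeftInverse.injective (g := Function.swap) fun _ => rfl
      have hmem : ∀ A, A ∈ C.image Function.swap ↔ Function.swap A ∈ C := by
        intro A
        rw [Finset.mem_image]
        constructor
        · rintro ⟨B, hB, rfl⟩
          exact hB
        · exact fun hA => ⟨_, hA, rfl⟩
      have himg := sum_xMonomial_rowSums m (J.sizeUpTo k) (J.blocksFun k) (C.image Function.swap) ?_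
      · rwa [Finset.sum_image hinj.injOn, Finset.sum_image hinj.injOn] at himg
      · intro j hj A B h
        rw [hmem, hmem, hC, hC, hcol k j hj A B h]
        refine and_congr_right fun _ => forall₂_congr fun k' hk' => ?_
        suffices hτ : τ k' (Function.swap A) = τ k' (Function.swap B) by rw [hτ]
        rcases k' with k' | k'
        · have := sizeUpTo_add_blocksFun_le J k
          exact h.blockStat_swap_eq (m := n) (by omega) (sizeUpTo_add_blocksFun_le I k')
        · refine h.blockStat_eq fun p hp => ?_
          have hne : k' ≠ k := fun e => hk' (by rw [e])
          have hd : ∀ q : ℕ, ∀ hq : q < J.blocksFun k, J.sizeUpTo k' + p ≠ J.sizeUpTo k + q := by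
            intro q hq he
            have := congrArg J.index (show J.embedding k' ⟨p, hp⟩ = J.embedding k ⟨q, hq⟩ from
              Fin.ext (by simpa using he))
            rw [J.index_embedding, J.index_embedding] at this
            exact hne this
          exact ⟨hd j (by omega), hd (j + 1) hj⟩

theorem prod_rename_xMonomial_blocks (I : Composition m) (f : Fin m → ℕ) :
    ∏ k, MvPolynomial.rename (I.embedding k) (xMonomial fun p => f (I.embedding k p)) =
      ∏ p, (MvPolynomial.X p : MvPolynomial (Fin m) ℤ) ^ f p := by
  rw [← I.blocksFinEquiv.prod_comp, Fintype.prod_sigma]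
  refine Finset.prod_congr rfl fun k _ => ?_
  rw [xMonomial, map_prod]
  refine Finset.prod_congr rfl fun p _ => ?_
  rw [map_pow, MvPolynomial.rename_X]
  rfl

theorem mul_rename_prod_xMonomial_blocks (I : Composition m) (J : Composition n)
    (M : Matrix (Fin m) (Fin n) ℕ) :
    MvPolynomial.rename (Sum.inl : Fin m → Fin m ⊕ Fin n)
        (∏ k, MvPolynomial.rename (I.embedding k)
          (xMonomial (rowSums n (I.sizeUpTo k) (I.blocksFun k) (entries M)))) *
      MvPolynomial.rename (Sum.inr : Fin n → Fin m ⊕ Fin n)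
        (∏ k, MvPolynomial.rename (J.embedding k)
          (xMonomial (rowSums m (J.sizeUpTo k) (J.blocksFun k) (Function.swap (entries M))))) =
      MvPolynomial.monomial (Finsupp.equivFunOnFinite.symm (matrixWeight M)) 1 := by
  have h1 := prod_rename_xMonomial_blocks I fun p => matrixWeight M (Sum.inl p)
  have h2 := prod_rename_xMonomial_blocks J fun q => matrixWeight M (Sum.inr q)
  simp only [matrixWeight_inl_embedding] at h1
  simp only [matrixWeight_inr_embedding] at h2
  refine Eq.trans (congrArg₂ (fun x y => MvPolynomial.rename Sum.inl x *
    MvPolynomial.rename Sum.inr y) h1 h2) ?_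
  rw [MvPolynomial.monomial_eq, Finsupp.prod_fintype _ _ fun _ => pow_zero _,
    Fintype.prod_sum_type]
  simp

end BlockSums

/-! ### Closed sets of standard monomials, degree by degree. -/

section Closure

variable {m n : ℕ}

/-- The index lies strictly between two consecutive cuts, so bicrystal closure covers every operator
inside a block. -/
theorem notMem_cuts (I : Composition m) (k : Fin I.length) {i : ℕ} (hi : i + 1 < I.blocksFun k) :
    I.sizeUpTo k + i + 1 ∉ cuts I := by
  rintro ⟨k', -, h⟩
  have hsucc := I.sizeUpTo_succ' k
  rcases Nat.lt_or_ge (k : ℕ) k' with hlt | hle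
  · have : I.sizeUpTo (k + 1) ≤ I.sizeUpTo k' := I.monotone_sizeUpTo (Nat.succ_le_of_lt hlt)
    omega
  · have := I.monotone_sizeUpTo hle
    omega

theorem sum_matrixWeight_transpose (M : Matrix (Fin m) (Fin n) ℕ) :
    ∑ x, matrixWeight M.transpose x = ∑ x, matrixWeight M x := by
  rw [← (Equiv.sumComm (Fin m) (Fin n)).sum_comp]
  exact Finset.sum_congr rfl fun x _ => matrixWeight_transpose M x

theorem finite_sum_matrixWeight_eq (d : ℕ) :
    {M : Matrix (Fin m) (Fin n) ℕ | ∑ x, matrixWeight M x = d}.Finite := by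
  refine ((Finset.piAntidiag (Finset.univ : Finset (Fin m ⊕ Fin n)) d).finite_toSet.biUnion
    fun a _ => finite_matrixWeight_eq a).subset fun M hM => ?_
  refine Set.mem_biUnion (x := matrixWeight M) (Finset.mem_coe.mpr ?_) rfl
  exact Finset.mem_piAntidiag.mpr ⟨hM, fun x _ => Finset.mem_univ x⟩

variable {I : Composition m} {J : Composition n} {ord : MonomialOrder (Fin m × Fin n)}
  {X : Set (Matrix (Fin m) (Fin n) ℂ)}

theorem IsBicrystalClosed.raise_row_iff (hX : IsBicrystalClosed I J ord X) (d : ℕ)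
    (k : Fin I.length) {i : ℕ} (hi : i + 1 < I.blocksFun k) {A B : ℕ → ℕ → ℕ}
    (h : Raise n (I.sizeUpTo k + i) A B) :
    (∃ M ∈ Std ord X, ∑ x, matrixWeight M x = d ∧ entries M = A) ↔
      ∃ M ∈ Std ord X, ∑ x, matrixWeight M x = d ∧ entries M = B := by
  have hle := sizeUpTo_add_blocksFun_le I k
  have him : I.sizeUpTo k + i + 1 < m := by omega
  constructor
  · rintro ⟨M, hM, hd, rfl⟩
    obtain ⟨N, hN, rfl⟩ := exists_eRow_eq him h
    exact ⟨N, ((hX M hM).1 _ him (notMem_cuts I k hi)).1 N hN,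
      (h.sum_matrixWeight_eq him).symm.trans hd, rfl⟩
  · rintro ⟨M, hM, hd, rfl⟩
    obtain ⟨N, hN, rfl⟩ := exists_fRow_eq him h
    exact ⟨N, ((hX M hM).1 _ him (notMem_cuts I k hi)).2 N hN,
      (h.sum_matrixWeight_eq him).trans hd, rfl⟩

theorem IsBicrystalClosed.raise_col_iff (hX : IsBicrystalClosed I J ord X) (d : ℕ)
    (k : Fin J.length) {j : ℕ} (hj : j + 1 < J.blocksFun k) {A B : ℕ → ℕ → ℕ}
    (h : Raise m (J.sizeUpTo k + j) A B) :
    (∃ M ∈ Std ord X, ∑ x, matrixWeight M x = d ∧ entries M = Function.swap A) ↔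
      ∃ M ∈ Std ord X, ∑ x, matrixWeight M x = d ∧ entries M = Function.swap B := by
  have hle := sizeUpTo_add_blocksFun_le J k
  have hjn : J.sizeUpTo k + j + 1 < n := by omega
  constructor
  · rintro ⟨M, hM, hd, hA⟩
    obtain rfl : entries M.transpose = A := by rw [entries_transpose, hA]
    obtain ⟨N, hN, rfl⟩ := exists_eRow_eq hjn h
    refine ⟨N.transpose, ((hX M hM).2 _ hjn (notMem_cuts J k hj)).1 _ ?_, ?_, ?_⟩
    · rw [eCol_eq, hN]
      rfl
    · rw [sum_matrixWeight_transpose, ← h.sum_matrixWeight_eq hjn, sum_matrixWeight_transpose, hd]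
    · exact entries_transpose N
  · rintro ⟨M, hM, hd, hB⟩
    obtain rfl : entries M.transpose = B := by rw [entries_transpose, hB]
    obtain ⟨N, hN, rfl⟩ := exists_fRow_eq hjn h
    refine ⟨N.transpose, ((hX M hM).2 _ hjn (notMem_cuts J k hj)).2 _ ?_, ?_, ?_⟩
    · rw [fCol_eq, hN]
      rfl
    · rw [sum_matrixWeight_transpose, h.sum_matrixWeight_eq hjn, sum_matrixWeight_transpose, hd]
    · exact entries_transpose N

/-- The matrices all of whose row and column blocks are of highest weight. -/
def IsHighestMatrix (I : Composition m) (J : Composition n) (M : Matrix (Fin m) (Fin n) ℕ) : Prop :=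
  AllHighest I n (entries M) ∧ AllHighest J m (Function.swap (entries M))

/-- The pair of tuples of shapes of a matrix. -/
noncomputable def matrixShapes (I : Composition m) (J : Composition n)
    (M : Matrix (Fin m) (Fin n) ℕ) : PartitionTuple I × PartitionTuple J :=
  (shapes I n (entries M), shapes J m (Function.swap (entries M)))

theorem mem_highestWeightStd_iff {M : Matrix (Fin m) (Fin n) ℕ}
    {p : PartitionTuple I × PartitionTuple J} :
    M ∈ highestWeightStd I J ord X p.1 p.2 ↔
      M ∈ Std ord X ∧ IsHighestMatrix I J M ∧ matrixShapes I J M = p := by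
  refine and_congr_right fun _ => (filterRSK_eq_iff I J M p.1 p.2).trans ?_
  rw [matrixShapes, Prod.ext_iff, IsHighestMatrix]

theorem IsHighestMatrix.matrixWeight_eq {M N : Matrix (Fin m) (Fin n) ℕ}
    (hM : IsHighestMatrix I J M) (hN : IsHighestMatrix I J N)
    (h : matrixShapes I J M = matrixShapes I J N) : matrixWeight M = matrixWeight N :=
  matrixWeight_eq_of_shapes_eq I J hM.1 hM.2 hN.1 hN.2 (Prod.ext_iff.mp h).1 (Prod.ext_iff.mp h).2

/-- The shapes determine all row and column sums, and these bound the entries. -/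
theorem finite_highestWeightStd (lam : PartitionTuple I) (mu : PartitionTuple J) :
    (highestWeightStd I J ord X lam mu).Finite := by
  rcases (highestWeightStd I J ord X lam mu).eq_empty_or_nonempty with h | ⟨M, hM⟩
  · rw [h]
    exact Set.finite_empty
  · refine (finite_matrixWeight_eq (matrixWeight M)).subset fun N hN => ?_
    have h1 := mem_highestWeightStd_iff (p := (lam, mu)).mp hM
    have h2 := mem_highestWeightStd_iff (p := (lam, mu)).mp hN
    exact h2.2.1.matrixWeight_eq h1.2.1 (h2.2.2.trans h1.2.2.symm)

open Classical in
/-- The Cauchy identity in a fixed total degree. -/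
theorem IsBicrystalClosed.sum_monomial_eq (hX : IsBicrystalClosed I J ord X) (d : ℕ)
    (S : Finset (Matrix (Fin m) (Fin n) ℕ))
    (hS : ∀ M, M ∈ S ↔ M ∈ Std ord X ∧ ∑ x, matrixWeight M x = d) :
    ∑ M ∈ S, (MvPolynomial.monomial (Finsupp.equivFunOnFinite.symm (matrixWeight M)) 1 :
        MvPolynomial (Fin m ⊕ Fin n) ℤ) =
      ∑ M ∈ S, if IsHighestMatrix I J M then
        splitSchurProd I J (matrixShapes I J M).1 (matrixShapes I J M).2 else 0 := by
  have hmem : ∀ A, A ∈ S.image entries ↔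
      ∃ M ∈ Std ord X, ∑ x, matrixWeight M x = d ∧ entries M = A := by
    intro A
    simp only [Finset.mem_image, hS, and_assoc]
  have h := sum_prod_xMonomial_blocks I J (S.image entries)
    (fun k i hi A B hAB => by rw [hmem, hmem, hX.raise_row_iff d k hi hAB])
    (fun k j hj A B hAB => by rw [hmem, hmem, hX.raise_col_iff d k hj hAB])
  rw [Finset.sum_image entries_injective.injOn, Finset.sum_image entries_injective.injOn] at h
  simp only [mul_rename_prod_xMonomial_blocks] at h
  exact h.trans (Finset.sum_congr rfl fun M _ => if_congr Iff.rfl rfl rfl)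

-- A coefficient sees only the standard monomials of one total degree. Grouping the highest weight
-- ones among them by their shapes turns the identity of that degree into a finite sum over shapes.
open Classical in
theorem IsBicrystalClosed.hasSum_coeff (hX : IsBicrystalClosed I J ord X)
    (a : Fin m ⊕ Fin n →₀ ℕ) :
    HasSum (fun p : PartitionTuple I × PartitionTuple J =>
      MvPowerSeries.coeff a (((highestWeightStd I J ord X p.1 p.2).ncard : ℤ) •
        (splitSchurProd I J p.1 p.2 : MvPowerSeries (Fin m ⊕ Fin n) ℤ)))
      ({M ∈ Std ord X | matrixWeight M = a}.ncard : ℤ) := by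
  set d := a.degree with hd
  have hfin : {M ∈ Std ord X | ∑ x, matrixWeight M x = d}.Finite :=
    (finite_sum_matrixWeight_eq d).subset fun M hM => hM.2
  set S := hfin.toFinset with hSdef
  have hS : ∀ M, M ∈ S ↔ M ∈ Std ord X ∧ ∑ x, matrixWeight M x = d := fun M =>
    hfin.mem_toFinset
  have hleft : ({M ∈ Std ord X | matrixWeight M = a}.ncard : ℤ) =
      MvPolynomial.coeff a (∑ M ∈ S, (MvPolynomial.monomial
        (Finsupp.equivFunOnFinite.symm (matrixWeight M)) 1 :
          MvPolynomial (Fin m ⊕ Fin n) ℤ)) := by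
    have hset : {M ∈ Std ord X | matrixWeight M = a} =
        (S.filter fun M => Finsupp.equivFunOnFinite.symm (matrixWeight M) = a :
          Set (Matrix (Fin m) (Fin n) ℕ)) := by
      ext M
      rw [Finset.mem_coe, Finset.mem_filter, hS, Equiv.symm_apply_eq]
      refine ⟨fun h => ⟨⟨h.1, ?_⟩, h.2⟩, fun h => ⟨h.1.1, h.2⟩⟩
      rw [h.2, hd, Finsupp.degree_eq_sum]
    rw [hset, Set.ncard_coe_finset, MvPolynomial.coeff_sum]
    simp only [MvPolynomial.coeff_monomial]
    rw [Finset.sum_boole]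
  have hcoeff : ∀ p : PartitionTuple I × PartitionTuple J,
      MvPowerSeries.coeff a (((highestWeightStd I J ord X p.1 p.2).ncard : ℤ) •
        (splitSchurProd I J p.1 p.2 : MvPowerSeries (Fin m ⊕ Fin n) ℤ)) =
      ((highestWeightStd I J ord X p.1 p.2).ncard : ℤ) *
        MvPolynomial.coeff a (splitSchurProd I J p.1 p.2) := by
    intro p
    rw [map_zsmul, MvPolynomial.coeff_coe, smul_eq_mul]
  simp only [hcoeff]
  have hright : MvPolynomial.coeff a (∑ M ∈ S, if IsHighestMatrix I J M then
        splitSchurProd I J (matrixShapes I J M).1 (matrixShapes I J M).2 else 0) =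
      ∑ p ∈ (S.filter (IsHighestMatrix I J)).image (matrixShapes I J),
        ((highestWeightStd I J ord X p.1 p.2).ncard : ℤ) *
          MvPolynomial.coeff a (splitSchurProd I J p.1 p.2) := by
    rw [← Finset.sum_filter, MvPolynomial.coeff_sum, ← Finset.sum_fiberwise_of_maps_to
      (g := matrixShapes I J) fun M hM => Finset.mem_image_of_mem _ hM]
    refine Finset.sum_congr rfl fun p hp => ?_
    obtain ⟨M₀, hM₀, hp₀⟩ := Finset.mem_image.mp hp
    rw [Finset.mem_filter, hS] at hM₀
    have hset : highestWeightStd I J ord X p.1 p.2 =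
        ((S.filter (IsHighestMatrix I J)).filter fun M => matrixShapes I J M = p :
          Set (Matrix (Fin m) (Fin n) ℕ)) := by
      ext M
      rw [Finset.mem_coe, Finset.mem_filter, Finset.mem_filter, hS, mem_highestWeightStd_iff]
      refine ⟨fun h => ⟨⟨⟨h.1, ?_⟩, h.2.1⟩, h.2.2⟩, fun h => ⟨h.1.1.1, h.1.2, h.2⟩⟩
      rw [h.2.1.matrixWeight_eq hM₀.2 (h.2.2.trans hp₀.symm), hM₀.1.2]
    rw [hset, Set.ncard_coe_finset, ← nsmul_eq_mul, ← Finset.sum_const]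
    refine Finset.sum_congr rfl fun M hM => ?_
    rw [(Finset.mem_filter.mp hM).2]
  rw [hleft, hX.sum_monomial_eq d S hS, hright]
  -- A shape outside the finite set either has no highest weight monomial, or its split-Schur
  -- product is homogeneous of a degree different from that of `a`.
  refine hasSum_sum_of_ne_finset_zero fun p hp => ?_
  rcases (highestWeightStd I J ord X p.1 p.2).eq_empty_or_nonempty with h | ⟨M, hM⟩
  · rw [h, Set.ncard_empty, Nat.cast_zero, zero_mul]
  · obtain ⟨h1, h2, rfl⟩ := mem_highestWeightStd_iff.mp hM
    have hne : a.degree ≠ ∑ x, matrixWeight M x := fun he =>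
      hp (Finset.mem_image_of_mem _ (Finset.mem_filter.mpr ⟨(hS M).mpr ⟨h1, he.symm⟩, h2⟩))
    have h3 := (isHomogeneous_splitSchurProd_shapes h2.1 h2.2).coeff_eq_zero hne
    rw [matrixShapes, h3, mul_zero]

end Closure

end GenCauchy

open GenCauchy
theorem theorem1p7 {m n : ℕ} (I : Composition m) (J : Composition n)
    (X : Set (Matrix (Fin m) (Fin n) ℂ)) (hvar : IsVariety X)
    (ord : MonomialOrder (Fin m × Fin n)) (hX : IsBicrystalline I J ord X) :
    (∀ (lam : PartitionTuple I) (mu : PartitionTuple J),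
      (highestWeightStd I J ord X lam mu).Finite) ∧
    ∃ χ : MvPowerSeries (Fin m ⊕ Fin n) ℤ,
      HasTorusCharacter (torusRep hX.stable) χ ∧
      HasSum (fun p : PartitionTuple I × PartitionTuple J =>
        ((highestWeightStd I J ord X p.1 p.2).ncard : ℤ) •
          (splitSchurProd I J p.1 p.2 : MvPowerSeries (Fin m ⊕ Fin n) ℤ)) χ := by
  refine ⟨fun lam mu => finite_highestWeightStd lam mu,
    -- The generating series of the standard monomials by row and column sums.
    fun a => ({M ∈ Std ord X | matrixWeight M = a}.ncard : ℤ), ?_, ?_⟩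
  · exact hasTorusCharacter_torusRep hX.stable ord _ fun a => rfl
  · exact MvPowerSeries.WithPiTopology.hasSum_iff_hasSum_coeff.mpr fun a =>
      hX.closed.hasSum_coeff a
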